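/- **Setting.** Let $\varepsilon_0,\mu_0,\alpha,\beta,\gamma,\eta>0$ and $k\in\mathbb R$ be fixed, and put $$p(\omega)=\beta-\omega^2+\eta k^2-i\gamma\omega,\qquad \varepsilon(\omega,k)=\varepsilon_0+\frac{\alpha}{p(\omega)},\qquad \xi(\omega,k)=\mu_0(\varepsilon(\omega,k)-\varepsilon_0),\qquad k_0=\mu_0\varepsilon_0\omega .$$ Let $P=\{\omega: p(\omega)=0\}$ be the set of poles of the permittivity. All frequencies are taken in $\mathbb C\setminus(-\infty,0]$, outside $P$. Let $N\ge 2$ and let $D_1,\dots,D_N\subset\mathbb R^2$ be open sets (the particles), with size parameter $\rho=\tfrac12\max_i\operatorname{diam}D_i$. Fix $c,d,R>0$ and assume that all $D_i$ lie in the ball of radius $R$ about $0$, that $|x-y|\ge d$ for $x\in D_i$, $y\in D_j$, $i\ne j$, and that $|D_i|\ge c\rho^2$ for all $i$. Let $G(x,\kappa)=-\frac i4H^{(1)}_0(\kappa|x|)$, $\hat\gamma=\frac12e^{\gamma_E-i\pi/2}$ ($\gamma_E$ is Euler's constant) and $\log(\kappa\hat\gamma):=\log\kappa+\log\hat\gamma$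 with principal logarithms. For $u\in L^2(D_i)$ and $\kappa=\delta k_0$ let $$(K^{\kappa}_{D_i}u)(x)=-\int_{D_i}G(x-y,\kappa)u(y)\,dy\quad (x\in D_i),$$ $$(M^{\kappa}_{D_i}u)(x)=\int_{D_i}\Big[-\frac1{2\pi}\log(\kappa\hat\gamma)-\frac1{2\pi}\log|x-y|+\kappa^2\log(\kappa\hat\gamma)\,\frac{|x-y|^2}{8\pi}\Big]u(y)\,dy\quad (x\in D_i),$$ and let $R^{\kappa}_{D_iD_j}u$, $N^{\kappa}_{D_iD_j}u$ ($i\neq j$) be given by the same two formulas for $x\in D_j$. A *resonant frequency* is an $\omega$ for which the system $$u_i-\delta^2\omega^2\xi\,K^{\delta k_0}_{D_i}u_i-\delta^2\omega^2\xi\sum_{j\ne i}R^{\delta k_0}_{D_jD_i}u_j=0\ \text{ in } L^2(D_i),\qquad i=1,\dots,N,$$ has a solution $(u_1,\dots,u_N)\neq0$ in $L^2(D_1)\times\dots\times L^2(D_N)$. An *expanded resonant frequency* is defined in the same way with $M,N$ in place of $K,R$. A *principal eigenpair* $(\nu_i,\phi_i)$ of $M^{\delta k_0}_{D_i}$ is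 an eigenvalue of largest modulus together with an eigenvector of norm $1$ in $L^2(D_i)$. With such pairs, with $i^+=i+1$ for $i<N$ and $N^+=1$, and with $L^2$ inner products, put $$\mathcal B_i=\frac{\delta^2\omega^2\xi}{1-\delta^2\omega^2\xi\,\nu_i},\qquad \mathcal L_{ii}=\langle N^{\delta k_0}_{D_iD_{i^+}}\phi_i,\phi_{i^+}\rangle,\qquad \mathcal L_{ij}=-\mathcal B_i\,\langle N^{\delta k_0}_{D_jD_i}\phi_j,\phi_i\rangle\,\langle N^{\delta k_0}_{D_iD_{i^+}}\phi_i,\phi_{i^+}\rangle\quad(i\ne j).$$ We write "$\det\mathcal L(\omega)=0$" to mean that, for some choice of principal eigenpairs at $\omega$, $\delta^2\omega^2\xi\,\nu_i\ne1$ for all $i$ and the determinant vanishes. **Theorem.** Let in addition $\kappa_0,C>0$ and a compact set $Z\subset\mathbb C\setminus(-\infty,0]$ be given. For every $\epsilon>0$ there is $\rho_0>0$, depending only on $N$, $k$, the material constants, $c,d,R,\kappa_0,C,Z$ and $\epsilon$, such that for all $D_1,\dots,D_N$ as above with $\rho<\rho_0$ and all $\delta>0$ with $\rho\le\kappa_0\delta$,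 $\delta\le\kappa_0\rho$: 1. For all $\omega\in Z$ and all $i$, a principal eigenpair of $M^{\delta k_0}_{D_i}$ exists, $\nu_i$ is unique, and $\phi_i$ is unique up to a factor of modulus $1$. 2. If $\omega\in Z$ is a resonant frequency or an expanded resonant frequency, and $|\delta^2\omega^2\xi\,\nu_i|\le C$ and $|1-\delta^2\omega^2\xi\,\nu_i|\ge 1/C$ for all $i$, then there is $\omega'$ with $\det\mathcal L(\omega')=0$ and $|\omega'-\omega|\le\epsilon\,\operatorname{dist}(\omega,P)$. 3. If $\omega\in Z$ and $\det\mathcal L(\omega)=0$, then there are a resonant frequency $\omega'$ and an expanded resonant frequency $\omega''$ with $|\omega'-\omega|\le\epsilon\,\operatorname{dist}(\omega,P)$ and $|\omega''-\omega|\le\epsilon\,\operatorname{dist}(\omega,P)$. -/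

import Mathlib

open MeasureTheory

noncomputable section

namespace HalideResonators

/-- The plane with its Euclidean norm and Lebesgue measure. -/
abbrev Plane := EuclideanSpace ℝ (Fin 2)

/-! ### Material parameters -/

/-- The positive material constants: background permittivity and permeability, and the four
constants of the dispersive permittivity. -/
structure Material where
  eps0 : ℝ
  mu0 : ℝ
  alpha : ℝ
  beta : ℝ
  gamma : ℝ
  eta : ℝ
  eps0_pos : 0 < eps0
  mu0_pos : 0 < mu0
  alpha_pos : 0 < alpha
  beta_pos : 0 < beta
  gamma_pos : 0 < gamma
  eta_pos : 0 < eta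

/-- The denominator `β - ω² + η k² - i γ ω` of the permittivity. -/
def dispersion (m : Material) (k : ℝ) (ω : ℂ) : ℂ :=
  m.beta - ω ^ 2 + m.eta * (k : ℂ) ^ 2 - Complex.I * m.gamma * ω

/-- The poles (in `ω`) of the permittivity. -/
def materialPoles (m : Material) (k : ℝ) : Set ℂ := {ω | dispersion m k ω = 0}

/-- `ε(ω,k) = ε₀ + α / (β - ω² + η k² - i γ ω)`. -/
def permittivity (m : Material) (k : ℝ) (ω : ℂ) : ℂ := m.eps0 + m.alpha / dispersion m k ω

/-- The contrast `ξ(ω,k) = μ₀ (ε(ω,k) - ε₀)`. -/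
def contrast (m : Material) (k : ℝ) (ω : ℂ) : ℂ := m.mu0 * (permittivity m k ω - m.eps0)

/-- The rescaled background wavenumber `δ k₀`, with `k₀ = μ₀ ε₀ ω`. -/
def scaledWavenumber (m : Material) (δ : ℝ) (ω : ℂ) : ℂ := δ * (m.mu0 * m.eps0 * ω)

/-- The factor `δ² ω² ξ(ω,k)`. -/
def strength (m : Material) (k δ : ℝ) (ω : ℂ) : ℂ := (δ : ℂ) ^ 2 * ω ^ 2 * contrast m k ω

/-! ### The outgoing Green's function in two dimensions -/

/-- Bessel function of the first kind of order zero. -/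
def besselJ0 (z : ℂ) : ℂ := ∑' n : ℕ, (-1) ^ n / ((n.factorial : ℂ) ^ 2) * (z / 2) ^ (2 * n)

/-- Bessel function of the second kind of order zero (principal branch, cut along `(-∞, 0]`). -/
def besselY0 (z : ℂ) : ℂ :=
  2 / Real.pi * (Complex.log (z / 2) + Real.eulerMascheroniConstant) * besselJ0 z +
    2 / Real.pi * ∑' n : ℕ, (-1) ^ n * ((harmonic (n + 1) : ℚ) : ℂ) /
      (((n + 1).factorial : ℂ) ^ 2) * (z / 2) ^ (2 * (n + 1))

/-- Hankel function of the first kind of order zero. -/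
def hankel0 (z : ℂ) : ℂ := besselJ0 z + Complex.I * besselY0 z

/-- `G(x,κ) = -(i/4) H₀⁽¹⁾(κ|x|)`. -/
def green (κ : ℂ) (x : Plane) : ℂ := -(Complex.I / 4) * hankel0 (κ * ‖x‖)

/-! ### The integral operators

An operator with source particle `S` sends a function `u` on `S` to a function on the plane; its
values on the target particle are the ones that are used (equations on a particle are read almost
everywhere there). -/

/-- `K_S^κ u = - ∫_S G(x-y,κ) u(y) dy`, on `S`. -/
def opK (κ : ℂ) (S : Set Plane) (u : Plane → ℂ) (x : Plane) : ℂ :=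
  -∫ y in S, green κ (x - y) * u y

/-- `R_{S S'}^κ u = - ∫_S G(x-y,κ) u(y) dy`, on the other particle `S'`. -/
def opR (κ : ℂ) (S : Set Plane) (u : Plane → ℂ) (x : Plane) : ℂ :=
  -∫ y in S, green κ (x - y) * u y

/-- The constant `exp(γ_E - iπ/2) / 2`, with `γ_E` the Euler constant. -/
def gammaHat : ℂ :=
  Complex.exp (Real.eulerMascheroniConstant - Complex.I * (Real.pi / 2)) / 2

/-- `log(κ γ̂)`, holomorphic for `κ` off `(-∞, 0]`. -/
def logGammaHat (κ : ℂ) : ℂ := Complex.log κ + Complex.log gammaHat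

/-- The term `-(1/2π) log(γ̂ κ) ∫_S u`, of order `log κ`. -/
def opHat (κ : ℂ) (S : Set Plane) (u : Plane → ℂ) (_x : Plane) : ℂ :=
  -(1 / (2 * Real.pi)) * logGammaHat κ * ∫ y in S, u y

/-- The term of order zero, with the static kernel `-(1/2π) log|x-y|`. -/
def opZero (S : Set Plane) (u : Plane → ℂ) (x : Plane) : ℂ :=
  ∫ y in S, ((-(1 / (2 * Real.pi)) * Real.log ‖x - y‖ : ℝ) : ℂ) * u y

/-- The operator whose kernel `|x-y|²/(8π)` is the coefficient of `κ² log(γ̂ κ)` in the expansion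
of `-G(x-y,κ)` as `κ → 0`. -/
def opOne (S : Set Plane) (u : Plane → ℂ) (x : Plane) : ℂ :=
  ∫ y in S, ((1 / (8 * Real.pi) * ‖x - y‖ ^ 2 : ℝ) : ℂ) * u y

/-- The single-particle operator `M_S^κ`, on `S`. -/
def opM (κ : ℂ) (S : Set Plane) (u : Plane → ℂ) (x : Plane) : ℂ :=
  opHat κ S u x + opZero S u x + κ ^ 2 * logGammaHat κ * opOne S u x

/-- The interaction operator `N_{S S'}^κ`, on the other particle `S'`. -/
def opN (κ : ℂ) (S : Set Plane) (u : Plane → ℂ) (x : Plane) : ℂ :=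
  opHat κ S u x + opZero S u x + κ ^ 2 * logGammaHat κ * opOne S u x

/-! ### The resonance problem -/

/-- The frequency `ω` is one at which the system
`u_i - δ²ω²ξ A_{D_i} u_i - δ²ω²ξ ∑_{j ≠ i} B_{D_j D_i} u_j = 0` on `D_i`, for all `i`,
has a solution `u ≠ 0` in `L²(D_1) × ... × L²(D_N)`; here `A`, `B` are the diagonal and the
off-diagonal operators, taken at the wavenumber `δ k₀`. -/
def IsSystemResonance (A B : ℂ → Set Plane → (Plane → ℂ) → Plane → ℂ)
    {N : ℕ} (m : Material) (k δ : ℝ) (D : Fin N → Set Plane) (ω : ℂ) : Prop :=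
  ω ∈ Complex.slitPlane ∧ ω ∉ materialPoles m k ∧
  ∃ u : Fin N → Plane → ℂ,
    (∀ i, MemLp (u i) 2 (volume.restrict (D i))) ∧
    (∃ i, ¬ u i =ᵐ[volume.restrict (D i)] 0) ∧
    ∀ i, ∀ᵐ x ∂(volume.restrict (D i)),
      u i x - strength m k δ ω * A (scaledWavenumber m δ ω) (D i) (u i) x
        - strength m k δ ω *
          ∑ j ∈ Finset.univ.erase i, B (scaledWavenumber m δ ω) (D j) (u j) x = 0

/-- Resonant frequencies: the integral formulation with the Green's function itself. -/
def IsResonance {N : ℕ} (m : Material) (k δ : ℝ) (D : Fin N → Set Plane) (ω : ℂ) : Prop :=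
  IsSystemResonance opK opR m k δ D ω

/-- Resonant frequencies of the system with the expanded operators `M` and `N`. -/
def IsExpandedResonance {N : ℕ} (m : Material) (k δ : ℝ) (D : Fin N → Set Plane) (ω : ℂ) : Prop :=
  IsSystemResonance opM opN m k δ D ω

/-! ### Single-particle eigenpairs and the matrix -/

/-- The inner product of `L²(S)`. -/
def pairing (S : Set Plane) (f g : Plane → ℂ) : ℂ := ∫ x in S, f x * starRingEnd ℂ (g x)

/-- `φ` is a normalised eigenvector of `M_S^κ` in `L²(S)` with eigenvalue `ν`, and `ν` has the
largest modulus among the eigenvalues. -/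
def IsPrincipalEigenpair (κ : ℂ) (S : Set Plane) (ν : ℂ) (φ : Plane → ℂ) : Prop :=
  MemLp φ 2 (volume.restrict S) ∧ pairing S φ φ = 1 ∧
  (∀ᵐ x ∂(volume.restrict S), opM κ S φ x = ν * φ x) ∧
  ∀ (ν' : ℂ) (ψ : Plane → ℂ), MemLp ψ 2 (volume.restrict S) →
    (¬ ψ =ᵐ[volume.restrict S] 0) →
    (∀ᵐ x ∂(volume.restrict S), opM κ S ψ x = ν' * ψ x) → ‖ν'‖ ≤ ‖ν‖

/-- `𝓑_i = δ²ω²ξ / (1 - δ²ω²ξ ν_i)`. -/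
def bFactor (m : Material) (k δ : ℝ) (ω ν : ℂ) : ℂ :=
  strength m k δ ω / (1 - strength m k δ ω * ν)

/-- The `N × N` matrix `𝓛`; `finRotate N i` is the cyclic successor of `i`. -/
def matL {N : ℕ} (m : Material) (k δ : ℝ) (D : Fin N → Set Plane) (ω : ℂ)
    (ν : Fin N → ℂ) (φ : Fin N → Plane → ℂ) : Matrix (Fin N) (Fin N) ℂ :=
  Matrix.of fun i j =>
    if i = j then
      pairing (D (finRotate N i)) (opN (scaledWavenumber m δ ω) (D i) (φ i)) (φ (finRotate N i))
    else
      -bFactor m k δ ω (ν i)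
        * pairing (D i) (opN (scaledWavenumber m δ ω) (D j) (φ j)) (φ i)
        * pairing (D (finRotate N i)) (opN (scaledWavenumber m δ ω) (D i) (φ i))
            (φ (finRotate N i))

/-- `det 𝓛(ω) = 0`, where `𝓛` is formed with principal eigenpairs and all `𝓑_i` are finite. -/
def IsDetZero {N : ℕ} (m : Material) (k δ : ℝ) (D : Fin N → Set Plane) (ω : ℂ) : Prop :=
  ω ∈ Complex.slitPlane ∧ ω ∉ materialPoles m k ∧
  ∃ (ν : Fin N → ℂ) (φ : Fin N → Plane → ℂ),
    (∀ i, IsPrincipalEigenpair (scaledWavenumber m δ ω) (D i) (ν i) (φ i)) ∧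
    (∀ i, 1 - strength m k δ ω * ν i ≠ 0) ∧
    (matL m k δ D ω ν φ).det = 0

/-! ### Geometry -/

/-- The particle size parameter `ρ = (1/2) max_i diam(D_i)`. -/
def sizeParam {N : ℕ} (D : Fin N → Set Plane) : ℝ := (⨆ i, Metric.diam (D i)) / 2

/-- Dilute configurations: open particles in a fixed bounded region, at mutual distance at least
`d`, each of area at least `c ρ²`. -/
structure IsDilute {N : ℕ} (c d R : ℝ) (D : Fin N → Set Plane) : Prop where
  isOpen : ∀ i, IsOpen (D i)
  bounded : ∀ i, D i ⊆ Metric.ball 0 R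
  separated : ∀ i j, i ≠ j → ∀ x ∈ D i, ∀ y ∈ D j, d ≤ dist x y
  area : ∀ i, c * sizeParam D ^ 2 ≤ (volume (D i)).toReal

/-- At the frequency `ω` the principal eigenvalues `ν_i` satisfy `|δ²ω²ξ ν_i| ≤ C` and
`|1 - δ²ω²ξ ν_i| ≥ 1/C` for all `i`. -/
def InPrincipalRegime {N : ℕ} (C : ℝ) (m : Material) (k δ : ℝ) (D : Fin N → Set Plane)
    (ω : ℂ) : Prop :=
  ∀ (i : Fin N) (ν : ℂ) (φ : Plane → ℂ),
    IsPrincipalEigenpair (scaledWavenumber m δ ω) (D i) ν φ →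
      ‖strength m k δ ω * ν‖ ≤ C ∧ C⁻¹ ≤ ‖1 - strength m k δ ω * ν‖

/-- `ω'` agrees with `ω` at leading order, up to the relative error `ε`: their difference is at most
`ε` times the distance of `ω` to the poles of the permittivity. -/
def CloseAtLeadingOrder (ε : ℝ) (m : Material) (k : ℝ) (ω ω' : ℂ) : Prop :=
  ‖ω' - ω‖ ≤ ε * Metric.infDist ω (materialPoles m k)

end HalideResonators

end

open HalideResonators

/-!
When `ρ → 0` with `δ ~ ρ`, both `-log (κ γ̂)` and, for two points of one particle, `-log |x - y|`
are `|log ρ| + O(1)`, while `-log |x - y| = O(1)` for points of different particles. In units of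
`|log ρ| ρ² / 2π` the operators `K`, `R`, `M` and `N` therefore act as a matrix `A` on the span of
the constants, with entries `2 aᵢ²` on and `aᵢ aⱼ` off the diagonal (`aᵢ² = |Dᵢ| / ρ²`), up to
remainders `O(1 / |log ρ|)`.

Let `z(ω) = p(ω) / (τ ω²)` be the inverse of `δ²ω²ξ` in these units. A Feshbach reduction to the
constants turns resonance into `det (z(ω) - B(ω)) = 0`, and the principal eigenvectors, which are
close to the constants, turn `det 𝓛(ω) = 0` into the same equation with another `B`. Both `B(ω)` are
continuous and close to the matrix `A`, which is Hermitian and bounded below. As `τ → 0`, a bounded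
`z(ω)` forces `ω` close to a pole, and there `z` is nearly affine in `ω` on the disc of radius
`ε dist(ω, P)`. On a suitable circle in that disc `det (z - B)` is then close to a product of nearly
affine factors, one of which vanishes inside, and a winding number argument, which needs no
holomorphy of the eigenvectors, gives a zero of every such determinant in the disc.
-/

noncomputable section

namespace HalideResonators

open Set Filter Topology

/-! ### Winding numbers and zeros of products of nearly affine functions -/

section Winding

/-- The loop `φ`, parametrised by `[0, 2π]`, winds `n` times around the origin. Encoded by a
continuous logarithm of increment `2πin`, so that only loops in `ℂ \ {0}` have a winding number. -/
def HasWinding (φ : ℝ → ℂ) (n : ℤ) : Prop :=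
  ∃ h : ℝ → ℂ, Continuous h ∧ (∀ θ, Complex.exp (h θ) = φ θ) ∧
    h (2 * Real.pi) = h 0 + n * (2 * Real.pi * Complex.I)

lemma exists_continuous_log {X : Type*} [TopologicalSpace X] [LocallyPathConnectedSpace X]
    [SimplyConnectedSpace X] {g : X → ℂ} (hg : Continuous g) (h0 : ∀ x, g x ≠ 0) :
    ∃ h : X → ℂ, Continuous h ∧ ∀ x, Complex.exp (h x) = g x := by
  obtain ⟨x₀⟩ : Nonempty X := inferInstance
  obtain ⟨h, ⟨-, hh⟩, -⟩ := Complex.isCoveringMapOn_exp.existsUnique_continuousMap_lifts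
    ⟨g, hg⟩ (Complex.exp_log (h0 x₀)) (fun x => by simpa using h0 x)
  exact ⟨h, h.continuous, fun x => by simpa using congrFun hh x⟩

lemma sub_eq_sub_of_exp_eq_exp {X : Type*} [TopologicalSpace X] [PreconnectedSpace X]
    {h₁ h₂ : X → ℂ} (c₁ : Continuous h₁) (c₂ : Continuous h₂)
    (he : ∀ x, Complex.exp (h₁ x) = Complex.exp (h₂ x)) (x y : X) :
    h₁ x - h₂ x = h₁ y - h₂ y := by
  choose n hn using fun x => Complex.exp_eq_exp_iff_exists_int.1 (he x)
  have hn_eq : ∀ x, (n x : ℝ) = ((h₁ x - h₂ x) / (2 * Real.pi * Complex.I)).re := by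
    intro x
    rw [hn x, add_sub_cancel_left, mul_div_cancel_right₀ _ Complex.two_pi_I_ne_zero,
      Complex.intCast_re]
  have hn_cont : Continuous n := by
    rw [Int.isClosedEmbedding_coe_real.isEmbedding.continuous_iff]
    simp only [Function.comp_def, hn_eq]
    fun_prop
  have hxy : n x = n y := PreconnectedSpace.constant inferInstance hn_cont
  rw [hn x, hn y, hxy]
  ring

namespace HasWinding

variable {φ ψ : ℝ → ℂ} {n n' : ℤ}

protected lemma continuous (h : HasWinding φ n) : Continuous φ := by
  obtain ⟨f, hf, hfe, -⟩ := h
  exact funext hfe ▸ Complex.continuous_exp.comp hf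

lemma ne_zero (h : HasWinding φ n) (θ : ℝ) : φ θ ≠ 0 := by
  obtain ⟨f, -, hfe, -⟩ := h
  exact hfe θ ▸ Complex.exp_ne_zero _

lemma apply_two_pi (h : HasWinding φ n) : φ (2 * Real.pi) = φ 0 := by
  obtain ⟨f, -, hfe, hfp⟩ := h
  rw [← hfe, ← hfe, hfp, Complex.exp_add, Complex.exp_int_mul_two_pi_mul_I, mul_one]

lemma unique (h : HasWinding φ n) (h' : HasWinding φ n') : n = n' := by
  obtain ⟨f, hf, hfe, hfp⟩ := h
  obtain ⟨g, hg, hge, hgp⟩ := h'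
  have hincr := sub_eq_sub_of_exp_eq_exp hf hg (fun x => by rw [hfe, hge]) (2 * Real.pi) 0
  rw [hfp, hgp] at hincr
  have : (n : ℂ) * (2 * Real.pi * Complex.I) = n' * (2 * Real.pi * Complex.I) := by
    linear_combination hincr
  exact_mod_cast mul_right_cancel₀ Complex.two_pi_I_ne_zero this

lemma mul (h : HasWinding φ n) (h' : HasWinding ψ n') :
    HasWinding (fun θ => φ θ * ψ θ) (n + n') := by
  obtain ⟨f, hf, hfe, hfp⟩ := h
  obtain ⟨g, hg, hge, hgp⟩ := h'
  refine ⟨fun θ => f θ + g θ, hf.add hg, fun θ => by rw [Complex.exp_add, hfe, hge], ?_⟩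
  simp only [hfp, hgp]
  push_cast
  ring

lemma const {c : ℂ} (hc : c ≠ 0) : HasWinding (fun _ => c) 0 :=
  ⟨fun _ => Complex.log c, continuous_const, fun _ => Complex.exp_log hc, by simp⟩

lemma prod {ι : Type*} (s : Finset ι) {φ : ι → ℝ → ℂ} {n : ι → ℤ}
    (h : ∀ i ∈ s, HasWinding (φ i) (n i)) :
    HasWinding (fun θ => ∏ i ∈ s, φ i θ) (∑ i ∈ s, n i) := by
  classical
  induction s using Finset.induction_on with
  | empty => simpa using const one_ne_zero
  | insert a s ha ih =>
    simp only [Finset.prod_insert ha, Finset.sum_insert ha]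
    exact (h a (by simp)).mul (ih fun i hi => h i (by simp [hi]))

lemma of_norm_sub_one_lt (hφ : Continuous φ) (hp : φ (2 * Real.pi) = φ 0)
    (h1 : ∀ θ, ‖φ θ - 1‖ < 1) : HasWinding φ 0 := by
  have hs : ∀ θ, φ θ ∈ Complex.slitPlane := fun θ =>
    Complex.ball_one_subset_slitPlane (by simpa [dist_eq_norm] using h1 θ)
  exact ⟨fun θ => Complex.log (φ θ), hφ.clog hs,
    fun θ => Complex.exp_log (Complex.slitPlane_ne_zero (hs θ)), by simp [hp]⟩

/-- The quotient of the two loops stays in the disc of radius `1` about `1`. -/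
lemma of_norm_sub_lt (h : HasWinding ψ n) (hφ : Continuous φ) (hp : φ (2 * Real.pi) = φ 0)
    (hlt : ∀ θ, ‖φ θ - ψ θ‖ < ‖ψ θ‖) : HasWinding φ n := by
  have hquot : HasWinding (fun θ => φ θ / ψ θ) 0 :=
    of_norm_sub_one_lt (hφ.div h.continuous h.ne_zero) (by rw [hp, h.apply_two_pi]) fun θ => by
      rw [div_sub_one (h.ne_zero θ), norm_div, div_lt_one (norm_pos_iff.2 (h.ne_zero θ))]
      exact hlt θ
  simpa only [mul_div_cancel₀ _ (h.ne_zero _), add_zero] using h.mul hquot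

end HasWinding

lemma circleMap_two_pi (c : ℂ) (s : ℝ) : circleMap c s (2 * Real.pi) = circleMap c s 0 := by
  simpa using periodic_circleMap c s 0

lemma hasWinding_circleMap {s : ℝ} (hs : s ≠ 0) : HasWinding (circleMap 0 s) 1 := by
  refine ⟨fun θ => Complex.log s + θ * Complex.I, by fun_prop, fun θ => ?_, by simp⟩
  rw [Complex.exp_add, Complex.exp_log (Complex.ofReal_ne_zero.2 hs), circleMap_zero]

lemma hasWinding_circleMap_sub {s : ℝ} (hs : 0 < s) {w : ℂ} (hw : ‖w‖ ≠ s) :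
    HasWinding (fun θ => circleMap 0 s θ - w) (if ‖w‖ < s then 1 else 0) := by
  have hper : circleMap 0 s (2 * Real.pi) - w = circleMap 0 s 0 - w := by rw [circleMap_two_pi]
  split_ifs with h
  · exact (hasWinding_circleMap hs.ne').of_norm_sub_lt (by fun_prop) hper
      (by simpa [abs_of_pos hs] using h)
  · have hsw : s < ‖w‖ := lt_of_le_of_ne (not_lt.1 h) hw.symm
    exact (HasWinding.const (neg_ne_zero.2 (norm_pos_iff.1 (hs.trans hsw)))).of_norm_sub_lt
      (by fun_prop) hper (by simpa [abs_of_pos hs] using hsw)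

lemma hasWinding_zero_of_disc {f : ℂ → ℂ} {s : ℝ} (hs : 0 ≤ s)
    (hf : ContinuousOn f (Metric.closedBall 0 s))
    (h0 : ∀ t ∈ Metric.closedBall (0 : ℂ) s, f t ≠ 0) :
    HasWinding (fun θ => f (circleMap 0 s θ)) 0 := by
  set polar : ℝ × ℝ → ℂ := fun p => circleMap 0 (projIcc 0 s hs p.1 : ℝ) p.2 with hpolar
  have hmem : ∀ p, polar p ∈ Metric.closedBall (0 : ℂ) s := by
    intro p
    have := (projIcc 0 s hs p.1).2
    simp [hpolar, abs_of_nonneg this.1, this.2]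
  have hcont : Continuous polar := by
    have : Continuous fun p : ℝ × ℝ => (projIcc 0 s hs p.1 : ℝ) :=
      continuous_subtype_val.comp (continuous_projIcc.comp continuous_fst)
    simp only [hpolar, circleMap]
    fun_prop
  obtain ⟨h, hh, hhe⟩ := exists_continuous_log (hf.comp_continuous hcont hmem)
    (fun p => h0 _ (hmem p))
  -- the increment over a full turn does not depend on the radius, and vanishes at radius `0`
  have hradial := sub_eq_sub_of_exp_eq_exp (X := ℝ) (h₁ := fun r => h (r, 2 * Real.pi))
    (h₂ := fun r => h (r, 0)) (by fun_prop) (by fun_prop)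
    (fun r => by simp only [hhe, hpolar, Function.comp_apply, circleMap_two_pi]) s 0
  have hcentre := sub_eq_sub_of_exp_eq_exp (X := ℝ) (h₁ := fun θ => h (0, θ))
    (h₂ := fun _ => h (0, 0)) (by fun_prop) (by fun_prop)
    (fun θ => by rw [hhe, hhe]; simp [hpolar]) (2 * Real.pi) 0
  refine ⟨fun θ => h (s, θ), by fun_prop, fun θ => by rw [hhe]; simp [hpolar], ?_⟩
  rw [Int.cast_zero, zero_mul, add_zero, ← sub_eq_zero, hradial, hcentre, sub_self]

theorem exists_eq_zero_of_hasWinding {f : ℂ → ℂ} {s : ℝ} (hs : 0 ≤ s)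
    (hf : ContinuousOn f (Metric.closedBall 0 s)) {n : ℤ} (hn : n ≠ 0)
    (h : HasWinding (fun θ => f (circleMap 0 s θ)) n) :
    ∃ t ∈ Metric.closedBall (0 : ℂ) s, f t = 0 := by
  by_contra! h0
  exact hn (h.unique (hasWinding_zero_of_disc hs hf h0))

end Winding

section NearlyAffine

lemma exists_mem_Icc_forall_le_abs_sub {ι : Type*} [Fintype ι] (x : ι → ℝ) {a b r : ℝ}
    (h : Fintype.card ι * (2 * r) < b - a) (hab : a ≤ b) :
    ∃ s ∈ Icc a b, ∀ j, r ≤ |s - x j| := by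
  by_contra! H
  have hcover : Icc a b ⊆ ⋃ j, Metric.ball (x j) r := fun s hs => by
    simpa [Real.dist_eq] using H s hs
  have hvol : ENNReal.ofReal (b - a) ≤ Fintype.card ι * ENNReal.ofReal (2 * r) :=
    calc ENNReal.ofReal (b - a) = volume (Icc a b) := Real.volume_Icc.symm
      _ ≤ ∑ j, volume (Metric.ball (x j) r) :=
        (measure_mono hcover).trans (measure_iUnion_fintype_le _ _)
      _ = Fintype.card ι * ENNReal.ofReal (2 * r) := by
        simp only [Real.volume_ball, Finset.sum_const, Finset.card_univ, nsmul_eq_mul]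
  obtain ⟨j, hj⟩ := H a (left_mem_Icc.2 hab)
  have hr : 0 < r := (abs_nonneg _).trans_lt hj
  rw [← ENNReal.ofReal_natCast, ← ENNReal.ofReal_mul (by positivity),
    ENNReal.ofReal_le_ofReal_iff (by positivity)] at hvol
  exact hvol.not_gt h

lemma abs_sub_norm_le_norm_circleMap_sub {s : ℝ} (hs : 0 ≤ s) (w : ℂ) (θ : ℝ) :
    |s - ‖w‖| ≤ ‖circleMap 0 s θ - w‖ := by
  simpa [abs_of_nonneg hs] using abs_norm_sub_norm_le (circleMap 0 s θ) w

variable {z₀ b l : ℂ} {s m : ℝ} {g : ℂ → ℂ}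

lemma mul_abs_sub_le_norm_sub_of_near_affine (hs : 0 ≤ s) (hb : b ≠ 0) {θ : ℝ}
    (hga : ‖g (circleMap 0 s θ) - (z₀ + b * circleMap 0 s θ)‖ ≤ m) :
    ‖b‖ * |s - ‖(l - z₀) / b‖| - m ≤ ‖g (circleMap 0 s θ) - l‖ := by
  set t := circleMap 0 s θ
  have haffine : ‖b‖ * |s - ‖(l - z₀) / b‖| ≤ ‖b * (t - (l - z₀) / b)‖ := by
    rw [norm_mul]
    gcongr
    exact abs_sub_norm_le_norm_circleMap_sub hs _ θ
  have htri := norm_sub_le_norm_add (b * (t - (l - z₀) / b)) (g t - (z₀ + b * t))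
  have hsum : b * (t - (l - z₀) / b) + (g t - (z₀ + b * t)) = g t - l := by
    field_simp
    ring
  rw [hsum] at htri
  linarith

lemma hasWinding_sub_of_near_affine (hs : 0 < s) (hb : b ≠ 0)
    (hg : Continuous fun θ => g (circleMap 0 s θ))
    (hga : ∀ θ, ‖g (circleMap 0 s θ) - (z₀ + b * circleMap 0 s θ)‖ ≤ m)
    (hm : m < ‖b‖ * |s - ‖(l - z₀) / b‖|) :
    HasWinding (fun θ => g (circleMap 0 s θ) - l) (if ‖(l - z₀) / b‖ < s then 1 else 0) := by
  have hne : ‖(l - z₀) / b‖ ≠ s := by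
    intro h
    rw [h, sub_self, abs_zero, mul_zero] at hm
    exact hm.not_ge ((norm_nonneg _).trans (hga 0))
  have haffine := (HasWinding.const hb).mul (hasWinding_circleMap_sub hs hne)
  rw [zero_add] at haffine
  refine haffine.of_norm_sub_lt (hg.sub continuous_const) (by rw [circleMap_two_pi]) fun θ => ?_
  have hdiff : g (circleMap 0 s θ) - l - b * (circleMap 0 s θ - (l - z₀) / b) =
      g (circleMap 0 s θ) - (z₀ + b * circleMap 0 s θ) := by
    field_simp
    ring
  rw [hdiff, norm_mul]
  refine ((hga θ).trans_lt hm).trans_le ?_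
  gcongr
  exact abs_sub_norm_le_norm_circleMap_sub hs.le _ θ

variable {ι : Type*} [Fintype ι] {l : ι → ℂ}

lemma pow_card_le_norm_prod_sub_of_near_affine (hs : 0 ≤ s) (hb : b ≠ 0) (hm : 0 ≤ m) {θ : ℝ}
    (hga : ‖g (circleMap 0 s θ) - (z₀ + b * circleMap 0 s θ)‖ ≤ m)
    (hgap : ∀ j, 2 * m ≤ ‖b‖ * |s - ‖(l j - z₀) / b‖|) :
    m ^ Fintype.card ι ≤ ‖∏ j, (g (circleMap 0 s θ) - l j)‖ := by
  rw [norm_prod, ← Finset.card_univ, ← Finset.prod_const]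
  refine Finset.prod_le_prod (fun _ _ => hm) fun j _ => ?_
  linarith [hgap j, mul_abs_sub_le_norm_sub_of_near_affine (l := l j) hs hb hga]

lemma sum_ite_norm_lt_ne_zero (hb : b ≠ 0) {ε : ℝ} (hs : ε / 2 ≤ s) (hε : 0 < ε)
    (hl : ∃ j, ‖l j - z₀‖ ≤ ‖b‖ * ε / 4) :
    (∑ j, if ‖(l j - z₀) / b‖ < s then 1 else 0 : ℤ) ≠ 0 := by
  obtain ⟨j, hj⟩ := hl
  have hb' : 0 < ‖b‖ := norm_pos_iff.2 hb
  have hjs : ‖(l j - z₀) / b‖ < s := by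
    rw [norm_div, div_lt_iff₀ hb']
    nlinarith
  exact (Finset.sum_pos' (fun i _ => by split_ifs <;> simp)
    ⟨j, Finset.mem_univ j, by rw [if_pos hjs]; exact one_pos⟩).ne'

/-- A version of Hurwitz' theorem without holomorphy: the winding number of `f` around a circle
which keeps its distance from the zeros of the affine functions `z₀ + b t - l j` counts the zeros
inside, and there is one. -/
theorem exists_zero_of_near_prod {ε η : ℝ} (hε : 0 < ε) (hb : b ≠ 0) {f : ℂ → ℂ}
    (hg : ContinuousOn g (Metric.closedBall 0 ε)) (hf : ContinuousOn f (Metric.closedBall 0 ε))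
    (hga : ∀ t ∈ Metric.closedBall (0 : ℂ) ε,
      ‖g t - (z₀ + b * t)‖ ≤ ‖b‖ * ε / (16 * (Fintype.card ι + 1)))
    (hl : ∃ j, ‖l j - z₀‖ ≤ ‖b‖ * ε / 4)
    (hη : η < (‖b‖ * ε / (16 * (Fintype.card ι + 1))) ^ Fintype.card ι)
    (hfg : ∀ t ∈ Metric.closedBall (0 : ℂ) ε, ‖f t - ∏ j, (g t - l j)‖ ≤ η) :
    ∃ t ∈ Metric.closedBall (0 : ℂ) ε, f t = 0 := by
  set m : ℝ := ‖b‖ * ε / (16 * (Fintype.card ι + 1)) with hm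
  have hm0 : 0 < m := by positivity
  obtain ⟨s, ⟨hs_ge, hs_le⟩, hgap⟩ := exists_mem_Icc_forall_le_abs_sub (a := ε / 2) (b := ε)
    (r := ε / (8 * (Fintype.card ι + 1))) (fun j => ‖(l j - z₀) / b‖)
    (by field_simp; linarith) (by linarith)
  have hs : 0 < s := by linarith
  have hgap' : ∀ j, 2 * m ≤ ‖b‖ * |s - ‖(l j - z₀) / b‖| := fun j =>
    calc 2 * m = ‖b‖ * (ε / (8 * (Fintype.card ι + 1))) := by rw [hm]; field_simp; norm_num
      _ ≤ _ := by gcongr; exact hgap j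
  have hsub : Metric.closedBall (0 : ℂ) s ⊆ Metric.closedBall 0 ε :=
    Metric.closedBall_subset_closedBall hs_le
  have hcircle : ∀ θ, circleMap 0 s θ ∈ Metric.closedBall (0 : ℂ) ε := fun θ =>
    hsub (by simp [abs_of_pos hs])
  have hprod := HasWinding.prod Finset.univ fun j _ =>
    hasWinding_sub_of_near_affine (l := l j) hs hb (hg.comp_continuous (by fun_prop) hcircle)
      (fun θ => hga _ (hcircle θ)) (by linarith [hgap' j])
  have hwinding := hprod.of_norm_sub_lt (hf.comp_continuous (by fun_prop) hcircle)
    (congrArg f (circleMap_two_pi 0 s)) fun θ => ((hfg _ (hcircle θ)).trans_lt hη).trans_le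
      (pow_card_le_norm_prod_sub_of_near_affine hs.le hb hm0.le (hga _ (hcircle θ)) hgap')
  obtain ⟨t, ht, hft⟩ := exists_eq_zero_of_hasWinding hs.le (hf.mono hsub)
    (sum_ite_norm_lt_ne_zero hb hs_ge hε hl) hwinding
  exact ⟨t, hsub ht, hft⟩

end NearlyAffine

/-! ### Perturbations of rank-one operators -/

section DominantVector

variable {𝕜 E : Type*} [RCLike 𝕜] [NormedAddCommGroup E] [InnerProductSpace 𝕜 E]

open InnerProductSpace (rankOne rankOne_apply)

/-- The map whose fixed points `φ` are the eigenvectors of `rankOne 𝕜 e e + s` with `⟪e, φ⟫ = 1`: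
pairing `μ φ = e + s φ` with `e` gives `μ = 1 + ⟪e, s φ⟫`. -/
def eigenvectorMap (e : E) (s : E →L[𝕜] E) (φ : E) : E := e + s φ - inner 𝕜 e (s φ) • φ

variable (𝕜) in
lemma norm_inner_smul_le {e : E} (he : ‖e‖ = 1) (x y : E) : ‖inner 𝕜 e x • y‖ ≤ ‖x‖ * ‖y‖ := by
  rw [norm_smul]
  gcongr
  simpa [he] using norm_inner_le_norm (𝕜 := 𝕜) e x

lemma norm_le_two_of_norm_sub_le {e φ : E} (he : ‖e‖ = 1) (h : ‖φ - e‖ ≤ 1) : ‖φ‖ ≤ 2 := by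
  linarith [norm_sub_norm_le φ e]

lemma norm_eigenvectorMap_sub_le {e : E} (he : ‖e‖ = 1) (s s' : E →L[𝕜] E) {φ φ' : E}
    (hφ : ‖φ‖ ≤ 2) (hφ' : ‖φ'‖ ≤ 2) :
    ‖eigenvectorMap e s φ - eigenvectorMap e s' φ'‖ ≤ 5 * ‖s‖ * ‖φ - φ'‖ + 6 * ‖s - s'‖ := by
  have hdecomp : eigenvectorMap e s φ - eigenvectorMap e s' φ' =
      s (φ - φ') - inner 𝕜 e (s (φ - φ')) • φ - inner 𝕜 e (s φ') • (φ - φ') +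
        (s - s') φ' - inner 𝕜 e ((s - s') φ') • φ' := by
    simp only [eigenvectorMap, map_sub, inner_sub_right, sub_apply, sub_smul, smul_sub]
    abel
  have hs_diff : ‖s (φ - φ')‖ ≤ ‖s‖ * ‖φ - φ'‖ := s.le_opNorm _
  have hs_φ' : ‖s φ'‖ ≤ ‖s‖ * 2 := s.le_of_opNorm_le_of_le le_rfl hφ'
  have hdiff_φ' : ‖(s - s') φ'‖ ≤ ‖s - s'‖ * 2 := (s - s').le_of_opNorm_le_of_le le_rfl hφ'
  rw [hdecomp]
  calc _ ≤ ‖s (φ - φ')‖ + ‖s (φ - φ')‖ * ‖φ‖ + ‖s φ'‖ * ‖φ - φ'‖ + ‖(s - s') φ'‖ +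
        ‖(s - s') φ'‖ * ‖φ'‖ := by
        refine norm_sub_le_of_le (norm_add_le_of_le (norm_sub_le_of_le (norm_sub_le_of_le le_rfl ?_)
          ?_) le_rfl) ?_ <;> exact norm_inner_smul_le 𝕜 he _ _
    _ ≤ ‖s‖ * ‖φ - φ'‖ + ‖s‖ * ‖φ - φ'‖ * 2 + ‖s‖ * 2 * ‖φ - φ'‖ + ‖s - s'‖ * 2 +
        ‖s - s'‖ * 2 * 2 := by gcongr
    _ = _ := by ring

lemma exists_eigenvectorMap_eq [CompleteSpace E] {e : E} (he : ‖e‖ = 1) {s : E →L[𝕜] E}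
    (hs : ‖s‖ ≤ 1 / 16) : ∃ φ, ‖φ - e‖ ≤ 1 ∧ eigenvectorMap e s φ = φ := by
  have hmaps : MapsTo (eigenvectorMap e s) (Metric.closedBall e 1) (Metric.closedBall e 1) := by
    intro φ hφ
    rw [mem_closedBall_iff_norm] at hφ ⊢
    have hφ2 := norm_le_two_of_norm_sub_le he hφ
    have hle := norm_eigenvectorMap_sub_le he s 0 hφ2 hφ2
    simp only [eigenvectorMap, zero_apply, inner_zero_right, zero_smul,
      add_zero, sub_zero, sub_self, norm_zero, mul_zero, zero_add] at hle
    rw [eigenvectorMap]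
    linarith
  have hcontr : ContractingWith (1 / 2) hmaps.restrict := by
    refine ⟨by norm_num [← NNReal.coe_lt_coe], LipschitzWith.of_dist_le_mul fun x y => ?_⟩
    have hle := norm_eigenvectorMap_sub_le he s s
      (norm_le_two_of_norm_sub_le he (mem_closedBall_iff_norm.1 x.2))
      (norm_le_two_of_norm_sub_le he (mem_closedBall_iff_norm.1 y.2))
    rw [sub_self, norm_zero, mul_zero, add_zero] at hle
    rw [Subtype.dist_eq, Subtype.dist_eq, dist_eq_norm, dist_eq_norm]
    refine hle.trans ?_
    push_cast
    gcongr
    linarith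
  obtain ⟨φ, hφ, hfix, -⟩ := hcontr.exists_fixedPoint' Metric.isClosed_closedBall.isComplete hmaps
    (x := e) (by simp) (edist_ne_top _ _)
  exact ⟨φ, mem_closedBall_iff_norm.1 hφ, hfix⟩

/-- For small `s`, the eigenvector `φ` of `rankOne 𝕜 e e + s` near `e`, normalised by
`⟪e, φ⟫ = 1`. -/
def dominantVector (e : E) (s : E →L[𝕜] E) : E :=
  Classical.epsilon fun φ => ‖φ - e‖ ≤ 1 ∧ eigenvectorMap e s φ = φ

/-- For small `s`, the eigenvalue of `rankOne 𝕜 e e + s` near `1`. -/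
def dominantValue (e : E) (s : E →L[𝕜] E) : 𝕜 := 1 + inner 𝕜 e (s (dominantVector e s))

section EigenvectorEquation

variable {e : E} (he : ‖e‖ = 1) {s : E →L[𝕜] E} (hs : ‖s‖ ≤ 1 / 16) {μ : 𝕜} (hμ : 1 / 2 ≤ ‖μ‖)
  {χ : E}
include he hs hμ

lemma norm_sub_le_one_of_smul_eq (h : μ • χ = e + s χ)
    (hfix : eigenvectorMap e s χ = χ) : ‖χ - e‖ ≤ 1 := by
  have hsχ : ‖s χ‖ ≤ 1 / 16 * ‖χ‖ := s.le_of_opNorm_le hs χ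
  have hχ : ‖χ‖ ≤ 16 / 7 := by
    have hle : ‖μ‖ * ‖χ‖ ≤ 1 + 1 / 16 * ‖χ‖ := by
      rw [← norm_smul, h]
      exact norm_add_le_of_le he.le hsχ
    nlinarith [norm_nonneg χ]
  have hsub : χ - e = s χ - inner 𝕜 e (s χ) • χ := by
    rw [eigenvectorMap, add_sub_assoc] at hfix
    exact sub_eq_of_eq_add' hfix.symm
  rw [hsub]
  have hle := norm_sub_le_of_le hsχ (norm_inner_smul_le 𝕜 he (s χ) χ)
  nlinarith [norm_nonneg χ]

omit he in
lemma inner_ne_zero_of_eigenvector {ψ : E} (hψ : ψ ≠ 0) (h : (rankOne 𝕜 e e + s) ψ = μ • ψ) :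
    inner 𝕜 e ψ ≠ 0 := by
  intro h0
  rw [add_apply, rankOne_apply, h0, zero_smul, zero_add] at h
  have hle := s.le_of_opNorm_le hs ψ
  rw [h, norm_smul] at hle
  linarith [le_of_mul_le_mul_right hle (norm_pos_iff.2 hψ)]

end EigenvectorEquation

lemma eq_one_add_inner_of_smul_eq {e : E} (he : ‖e‖ = 1) {s : E →L[𝕜] E} {μ : 𝕜} {χ : E}
    (heχ : inner 𝕜 e χ = 1) (h : μ • χ = e + s χ) : μ = 1 + inner 𝕜 e (s χ) := by
  simpa [inner_smul_right, inner_add_right, heχ, inner_self_eq_norm_sq_to_K, he]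
    using congrArg (inner 𝕜 e) h

variable [CompleteSpace E] {e : E} (he : ‖e‖ = 1) {s : E →L[𝕜] E} (hs : ‖s‖ ≤ 1 / 16)
include he hs

lemma norm_dominantVector_sub_le_one : ‖dominantVector e s - e‖ ≤ 1 :=
  (Classical.epsilon_spec (exists_eigenvectorMap_eq he hs)).1

lemma eigenvectorMap_dominantVector :
    eigenvectorMap e s (dominantVector e s) = dominantVector e s :=
  (Classical.epsilon_spec (exists_eigenvectorMap_eq he hs)).2

lemma norm_dominantVector_le_two : ‖dominantVector e s‖ ≤ 2 :=
  norm_le_two_of_norm_sub_le he (norm_dominantVector_sub_le_one he hs)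

lemma norm_dominantValue_sub_one_le : ‖dominantValue e s - 1‖ ≤ 2 * ‖s‖ := by
  rw [dominantValue, add_sub_cancel_left, mul_comm]
  calc _ ≤ ‖e‖ * ‖s (dominantVector e s)‖ := norm_inner_le_norm _ _
    _ ≤ ‖s‖ * 2 := by
      rw [he, one_mul]
      exact s.le_of_opNorm_le_of_le le_rfl (norm_dominantVector_le_two he hs)

lemma inner_dominantVector : inner 𝕜 e (dominantVector e s) = 1 := by
  set φ := dominantVector e s with hφ
  have hpair : inner 𝕜 e φ = 1 + inner 𝕜 e (s φ) - inner 𝕜 e (s φ) * inner 𝕜 e φ := by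
    conv_lhs => rw [hφ, ← eigenvectorMap_dominantVector he hs, ← hφ]
    simp [eigenvectorMap, inner_sub_right, inner_add_right, inner_smul_right,
      inner_self_eq_norm_sq_to_K, he]
  have hval : 1 + inner 𝕜 e (s φ) ≠ 0 := by
    intro h0
    have hle := norm_dominantValue_sub_one_le he hs
    rw [dominantValue, ← hφ, h0, zero_sub, norm_neg, norm_one] at hle
    linarith
  exact sub_eq_zero.1 ((mul_eq_zero.1
    (show (inner 𝕜 e φ - 1) * (1 + inner 𝕜 e (s φ)) = 0 by linear_combination hpair)).resolve_right
    hval)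

lemma rankOne_add_dominantVector :
    (rankOne 𝕜 e e + s) (dominantVector e s) = dominantValue e s • dominantVector e s := by
  have hfix := eigenvectorMap_dominantVector he hs
  rw [eigenvectorMap, sub_eq_iff_eq_add] at hfix
  rw [add_apply, rankOne_apply, inner_dominantVector he hs, one_smul, hfix, dominantValue, add_smul,
    one_smul]

lemma norm_dominantVector_sub_le : ‖dominantVector e s - e‖ ≤ 6 * ‖s‖ := by
  have hφ := norm_dominantVector_le_two he hs
  have hle := norm_eigenvectorMap_sub_le he s 0 hφ hφ
  rw [eigenvectorMap_dominantVector he hs] at hle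
  simpa [eigenvectorMap] using hle

lemma one_le_norm_dominantVector : 1 ≤ ‖dominantVector e s‖ := by
  simpa [inner_dominantVector he hs, he] using norm_inner_le_norm (𝕜 := 𝕜) e (dominantVector e s)

lemma norm_dominantVector_sub_dominantVector_le {s' : E →L[𝕜] E} (hs' : ‖s'‖ ≤ 1 / 16) :
    ‖dominantVector e s - dominantVector e s'‖ ≤ 12 * ‖s - s'‖ := by
  have hle := norm_eigenvectorMap_sub_le he s s' (norm_dominantVector_le_two he hs)
    (norm_dominantVector_le_two he hs')
  rw [eigenvectorMap_dominantVector he hs, eigenvectorMap_dominantVector he hs'] at hle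
  have : 5 * ‖s‖ * ‖dominantVector e s - dominantVector e s'‖ ≤
    1 / 2 * ‖dominantVector e s - dominantVector e s'‖ := by gcongr; linarith
  linarith

lemma eq_dominantVector_of_eigenvectorMap_eq {χ : E} (hχ : ‖χ - e‖ ≤ 1)
    (hfix : eigenvectorMap e s χ = χ) : χ = dominantVector e s := by
  have hle := norm_eigenvectorMap_sub_le he s s (norm_le_two_of_norm_sub_le he hχ)
    (norm_dominantVector_le_two he hs)
  rw [hfix, eigenvectorMap_dominantVector he hs, sub_self, norm_zero, mul_zero, add_zero] at hle
  rw [← sub_eq_zero, ← norm_le_zero_iff]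
  nlinarith [norm_nonneg (χ - dominantVector e s)]

theorem eq_dominant_of_eigenvector {μ : 𝕜} (hμ : 1 / 2 ≤ ‖μ‖) {ψ : E} (hψ : ψ ≠ 0)
    (h : (rankOne 𝕜 e e + s) ψ = μ • ψ) :
    μ = dominantValue e s ∧ ψ = inner 𝕜 e ψ • dominantVector e s := by
  have hc := inner_ne_zero_of_eigenvector hs hμ hψ h
  set χ : E := (inner 𝕜 e ψ)⁻¹ • ψ with hχ
  have heχ : inner 𝕜 e χ = 1 := by rw [hχ, inner_smul_right, inv_mul_cancel₀ hc]
  have hμχ : μ • χ = e + s χ := by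
    rw [hχ, smul_comm, ← h, add_apply, rankOne_apply, smul_add, smul_smul, inv_mul_cancel₀ hc,
      one_smul, map_smul]
  have hμ_eq := eq_one_add_inner_of_smul_eq he heχ hμχ
  have hfix : eigenvectorMap e s χ = χ := by
    rw [eigenvectorMap, ← hμχ, hμ_eq, add_smul, one_smul, add_sub_cancel_right]
  have hχ_eq := eq_dominantVector_of_eigenvectorMap_eq he hs
    (norm_sub_le_one_of_smul_eq he hs hμ hμχ hfix) hfix
  rw [dominantValue, ← hχ_eq, ← hμ_eq, hχ, smul_smul, mul_inv_cancel₀ hc, one_smul]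
  exact ⟨rfl, rfl⟩

omit hs in
lemma continuousOn_dominantVector {X : Type*} [TopologicalSpace X] {U : Set X} {S : X → E →L[𝕜] E}
    (hS : ∀ t ∈ U, ‖S t‖ ≤ 1 / 16) (hc : ContinuousOn S U) :
    ContinuousOn (fun t => dominantVector e (S t)) U := by
  have hlip : LipschitzOnWith 12 (dominantVector e) {s : E →L[𝕜] E | ‖s‖ ≤ 1 / 16} :=
    LipschitzOnWith.of_dist_le_mul fun s hs s' hs' => by
      simpa [dist_eq_norm] using norm_dominantVector_sub_dominantVector_le he hs hs'
  exact hlip.continuousOn.comp hc hS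

end DominantVector

/-! ### Determinants of matrices close to Hermitian ones -/

section Determinants

open Matrix
open scoped ComplexOrder

variable {ι : Type*}

lemma norm_apply_le_add_one {A X : Matrix ι ι ℂ} {K η : ℝ} (hA : ∀ i j, ‖A i j‖ ≤ K) (hη : η ≤ 1)
    (hX : ∀ i j, ‖X i j - A i j‖ ≤ η) (i j : ι) : ‖X i j‖ ≤ K + 1 := by
  linarith [norm_sub_norm_le (X i j) (A i j), hX i j, hA i j]

lemma norm_smul_one_sub_apply_le [DecidableEq ι] {B : Matrix ι ι ℂ} {z : ℂ} {K M : ℝ} (hz : ‖z‖ ≤ K)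
    (hB : ∀ i j, ‖B i j‖ ≤ M) (i j : ι) : ‖(z • (1 : Matrix ι ι ℂ) - B) i j‖ ≤ K + M := by
  refine (norm_sub_le _ _).trans (add_le_add ?_ (hB i j))
  rw [Matrix.smul_apply, one_apply]
  split_ifs
  · simpa using hz
  · simpa using (norm_nonneg z).trans hz

variable [Fintype ι]

lemma exists_norm_sub_le_of_norm_prod_le {l : ι → ℂ} {z : ℂ} {r : ℝ} (hr : 0 ≤ r)
    (h : ‖∏ j, (z - l j)‖ < r ^ Fintype.card ι) : ∃ j, ‖l j - z‖ ≤ r := by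
  by_contra! hfar
  refine h.not_ge ?_
  rw [norm_prod, ← Finset.card_univ, ← Finset.prod_const]
  exact Finset.prod_le_prod (fun _ _ => hr) fun j _ => norm_sub_rev (l j) z ▸ (hfar j).le

lemma norm_of_le {M : ℝ} (hM : 0 ≤ M) {X : Matrix ι ι ℂ} (hX : ∀ i j, ‖X i j‖ ≤ M) :
    ‖(fun i j => X i j : ι → ι → ℂ)‖ ≤ M :=
  (pi_norm_le_iff_of_nonneg hM).2 fun i => (pi_norm_le_iff_of_nonneg hM).2 (hX i)

lemma norm_star_dotProduct_mulVec_le {B : Matrix ι ι ℂ} {η : ℝ} (hη : 0 ≤ η)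
    (hB : ∀ i j, ‖B i j‖ ≤ η) (v : ι → ℂ) :
    ‖star v ⬝ᵥ B *ᵥ v‖ ≤ Fintype.card ι * η * ∑ i, ‖v i‖ ^ 2 :=
  calc ‖∑ i, star v i * ∑ j, B i j * v j‖ ≤ ∑ i, ‖v i‖ * ∑ j, η * ‖v j‖ := by
        refine norm_sum_le_of_le _ fun i _ => ?_
        rw [norm_mul, Pi.star_apply, norm_star]
        gcongr
        refine norm_sum_le_of_le _ fun j _ => ?_
        rw [norm_mul]
        gcongr
        exact hB i j
    _ = η * (∑ i, ‖v i‖) ^ 2 := by rw [← Finset.sum_mul, ← Finset.mul_sum]; ring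
    _ ≤ η * (Fintype.card ι * ∑ i, ‖v i‖ ^ 2) := by gcongr; exact sq_sum_le_card_mul_sum_sq
    _ = _ := by ring

variable [DecidableEq ι]

lemma continuousOn_det {X : Type*} [TopologicalSpace X] {U : Set X} {A : X → Matrix ι ι ℂ}
    (hA : ContinuousOn A U) : ContinuousOn (fun t => (A t).det) U :=
  (continuous_id.matrix_det).comp_continuousOn hA

variable (ι) in
lemma exists_norm_det_sub_det_le (M : ℝ) {e : ℝ} (he : 0 < e) :
    ∃ η > 0, ∀ X Y : Matrix ι ι ℂ, (∀ i j, ‖X i j‖ ≤ M) → (∀ i j, ‖Y i j‖ ≤ M) →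
      (∀ i j, ‖X i j - Y i j‖ ≤ η) → ‖X.det - Y.det‖ ≤ e := by
  have hcont : Continuous fun X : ι → ι → ℂ => (of X).det := Continuous.matrix_det continuous_id
  have hunif := (isCompact_closedBall (0 : ι → ι → ℂ) |M|).uniformContinuousOn_of_continuous
    hcont.continuousOn
  obtain ⟨η, hη, h⟩ := Metric.uniformContinuousOn_iff_le.1 hunif e he
  have hmem : ∀ X : Matrix ι ι ℂ, (∀ i j, ‖X i j‖ ≤ M) →
      (fun i j => X i j) ∈ Metric.closedBall (0 : ι → ι → ℂ) |M| := fun X hX =>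
    mem_closedBall_zero_iff.2 (norm_of_le (abs_nonneg M) fun i j => (hX i j).trans (le_abs_self M))
  refine ⟨η, hη, fun X Y hX hY hXY => ?_⟩
  have hdist := h _ (hmem X hX) _ (hmem Y hY) (by
    rw [dist_eq_norm]
    exact norm_of_le hη.le hXY)
  rwa [dist_eq_norm] at hdist

lemma exists_det_smul_one_sub_eq_prod (A : Matrix ι ι ℂ) :
    ∃ l : ι → ℂ, ∀ z : ℂ, (z • (1 : Matrix ι ι ℂ) - A).det = ∏ j, (z - l j) := by
  have hsplits := IsAlgClosed.splits A.charpoly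
  have hlen : Fintype.card ι = A.charpoly.roots.toList.length := by
    rw [Multiset.length_toList, ← hsplits.natDegree_eq_card_roots, A.charpoly_natDegree_eq_dim]
  refine ⟨fun j => A.charpoly.roots.toList[Fintype.equivFinOfCardEq hlen j], fun z => ?_⟩
  calc _ = A.charpoly.eval z := by rw [eval_charpoly, scalar_apply, smul_one_eq_diagonal]
    _ = (A.charpoly.roots.toList.map (z - ·)).prod := by
      rw [hsplits.eval_eq_prod_roots_of_monic A.charpoly_monic, ← Multiset.prod_coe,
        ← Multiset.map_coe, Multiset.coe_toList]
    _ = ∏ k : Fin A.charpoly.roots.toList.length, (z - A.charpoly.roots.toList[k]) :=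
      (Fin.prod_univ_fun_getElem _ _).symm
    _ = _ := (Equiv.prod_comp (Fintype.equivFinOfCardEq hlen)
      fun k => z - A.charpoly.roots.toList[k]).symm

lemma exists_mulVec_eq_smul_of_det_eq_zero {B : Matrix ι ι ℂ} {z : ℂ}
    (h : (z • (1 : Matrix ι ι ℂ) - B).det = 0) : ∃ v ≠ 0, B *ᵥ v = z • v := by
  obtain ⟨v, hv, hz⟩ := exists_mulVec_eq_zero_iff.2 h
  rw [sub_mulVec, smul_mulVec, one_mulVec, sub_eq_zero] at hz
  exact ⟨v, hv, hz.symm⟩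

lemma norm_le_of_det_eq_zero {B : Matrix ι ι ℂ} {M : ℝ} (hB : ∀ i j, ‖B i j‖ ≤ M) {z : ℂ}
    (h : (z • (1 : Matrix ι ι ℂ) - B).det = 0) : ‖z‖ ≤ Fintype.card ι * M := by
  obtain ⟨v, hv, hz⟩ := exists_mulVec_eq_smul_of_det_eq_zero h
  obtain ⟨i₀, -⟩ := Function.ne_iff.1 hv
  have hM : 0 ≤ M := (norm_nonneg _).trans (hB i₀ i₀)
  have hmulVec : ‖B *ᵥ v‖ ≤ Fintype.card ι * M * ‖v‖ := by
    refine (pi_norm_le_iff_of_nonneg (by positivity)).2 fun i => ?_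
    calc ‖∑ j, B i j * v j‖ ≤ ∑ _j : ι, M * ‖v‖ := by
          refine norm_sum_le_of_le _ fun j _ => ?_
          rw [norm_mul]
          gcongr
          exacts [hB i j, norm_le_pi_norm v j]
      _ = _ := by rw [Finset.sum_const, Finset.card_univ, nsmul_eq_mul, mul_assoc]
  rw [hz, norm_smul] at hmulVec
  exact le_of_mul_le_mul_right hmulVec (norm_pos_iff.2 hv)

variable (ι) in
lemma exists_norm_det_shift_sub_le (K L : ℝ) {e : ℝ} (he : 0 < e) :
    ∃ η > 0, η ≤ 1 ∧ ∀ (A X : Matrix ι ι ℂ) (z : ℂ), (∀ i j, ‖A i j‖ ≤ K) →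
      (∀ i j, ‖X i j - A i j‖ ≤ η) → ‖z‖ ≤ L →
      ‖(z • (1 : Matrix ι ι ℂ) - X).det - (z • (1 : Matrix ι ι ℂ) - A).det‖ ≤ e := by
  obtain ⟨η, hη, hdet⟩ := exists_norm_det_sub_det_le ι (L + (K + 1)) he
  refine ⟨min η 1, lt_min hη one_pos, min_le_right _ _, fun A X z hA hX hz => ?_⟩
  refine hdet _ _
    (norm_smul_one_sub_apply_le hz (norm_apply_le_add_one hA (min_le_right _ _) hX))
    (norm_smul_one_sub_apply_le hz fun i j => (hA i j).trans (by linarith)) fun i j => ?_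
  rw [Matrix.sub_apply, Matrix.sub_apply, sub_sub_sub_cancel_left, norm_sub_rev]
  exact (hX i j).trans (min_le_left _ _)

variable (ι) in
theorem exists_det_eq_zero_of_near {K β ε : ℝ} (hβ : 0 < β) (hε : 0 < ε) (hε1 : ε ≤ 1) :
    ∃ η > 0, η ≤ 1 ∧ ∀ A : Matrix ι ι ℂ, (∀ i j, ‖A i j‖ ≤ K) →
      ∀ (z₀ b : ℂ) (z : ℂ → ℂ) (B₀ : Matrix ι ι ℂ) (B : ℂ → Matrix ι ι ℂ),
      β ≤ ‖b‖ → ‖b‖ ≤ 2 * ‖z₀‖ →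
      ContinuousOn z (Metric.closedBall 0 ε) → ContinuousOn B (Metric.closedBall 0 ε) →
      (∀ t ∈ Metric.closedBall (0 : ℂ) ε,
        ‖z t - (z₀ + b * t)‖ ≤ ‖b‖ * ε / (16 * (Fintype.card ι + 1))) →
      (∀ t ∈ Metric.closedBall (0 : ℂ) ε, ∀ i j, ‖B t i j - A i j‖ ≤ η) →
      (∀ i j, ‖B₀ i j - A i j‖ ≤ η) → (z₀ • (1 : Matrix ι ι ℂ) - B₀).det = 0 →
      ∃ t ∈ Metric.closedBall (0 : ℂ) ε, (z t • (1 : Matrix ι ι ℂ) - B t).det = 0 := by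
  set n : ℝ := (Fintype.card ι : ℝ)
  have : 0 ≤ n := Nat.cast_nonneg _
  set e : ℝ := (β * ε / (16 * (n + 1))) ^ Fintype.card ι / 2 with he
  have he0 : 0 < e := by positivity
  obtain ⟨η, hη, hη1, hdet⟩ := exists_norm_det_shift_sub_le ι K (4 * (n * (K + 1))) he0
  refine ⟨η, hη, hη1, fun A hA z₀ b z B₀ B hβb hbz₀ hz hB hzt hBt hB₀ h₀ => ?_⟩
  obtain ⟨l, hl⟩ := exists_det_smul_one_sub_eq_prod A
  have hz₀ : ‖z₀‖ ≤ n * (K + 1) := norm_le_of_det_eq_zero (norm_apply_le_add_one hA hη1 hB₀) h₀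
  have hsmall : e < (‖b‖ * ε / (16 * (n + 1))) ^ Fintype.card ι := by
    have : (β * ε / (16 * (n + 1))) ^ Fintype.card ι ≤
      (‖b‖ * ε / (16 * (n + 1))) ^ Fintype.card ι := by gcongr
    linarith
  refine exists_zero_of_near_prod (η := e) (l := l) hε (norm_pos_iff.1 (hβ.trans_le hβb)) hz
    (continuousOn_det ((hz.smul continuousOn_const).sub hB)) hzt ?_ hsmall fun t ht => ?_
  · refine exists_norm_sub_le_of_norm_prod_le (by positivity) ?_
    have hclose := hdet A B₀ z₀ hA hB₀ (by linarith [norm_nonneg z₀])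
    rw [h₀, hl, zero_sub, norm_neg] at hclose
    refine hclose.trans_lt (hsmall.trans_le ?_)
    gcongr
    linarith
  · rw [← hl]
    refine hdet A (B t) (z t) hA (hBt t ht) ?_
    have hbt : ‖b * t‖ ≤ ‖b‖ * 1 := norm_mul_le_of_le le_rfl
      ((mem_closedBall_zero_iff.1 ht).trans hε1)
    have hrem : ‖b‖ * ε / (16 * (n + 1)) ≤ ‖b‖ * 1 / 16 := by gcongr; linarith
    linarith [norm_sub_norm_le (z t) (z₀ + b * t), hzt t ht, norm_add_le z₀ (b * t)]

lemma le_norm_of_det_eq_zero {A B : Matrix ι ι ℂ} {α η : ℝ} (hA : (A - (α : ℂ) • 1).PosSemidef)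
    (hB : ∀ i j, ‖B i j - A i j‖ ≤ η) {z : ℂ} (h : (z • (1 : Matrix ι ι ℂ) - B).det = 0) :
    α - Fintype.card ι * η ≤ ‖z‖ := by
  obtain ⟨v, hv, hz⟩ := exists_mulVec_eq_smul_of_det_eq_zero h
  obtain ⟨i₀, hi₀⟩ := Function.ne_iff.1 hv
  set q : ℝ := ∑ i, ‖v i‖ ^ 2 with hq
  have hq0 : 0 < q := Finset.sum_pos' (fun i _ => by positivity)
    ⟨i₀, Finset.mem_univ i₀, by have := norm_pos_iff.2 hi₀; positivity⟩
  have hvv : star v ⬝ᵥ v = (q : ℂ) := by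
    simp [dotProduct, hq, Complex.conj_mul']
  have hpert := norm_star_dotProduct_mulVec_le (B := B - A)
    ((norm_nonneg _).trans (hB i₀ i₀)) hB v
  have hcoercive := (Complex.le_def.1 (hA.dotProduct_mulVec_nonneg v)).1
  have hsplit : star v ⬝ᵥ (A - (α : ℂ) • 1) *ᵥ v =
      z * q - star v ⬝ᵥ (B - A) *ᵥ v - α * q := by
    simp only [sub_mulVec, dotProduct_sub, hz, smul_mulVec, one_mulVec, dotProduct_smul, hvv,
      smul_eq_mul]
    ring
  rw [hsplit, Complex.zero_re, Complex.sub_re, Complex.re_mul_ofReal, Complex.ofReal_re]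
    at hcoercive
  have hre := (Complex.re_le_norm _).trans
    (norm_sub_le_of_le (norm_mul_le z (q : ℂ)) hpert)
  rw [Complex.norm_real, Real.norm_of_nonneg hq0.le] at hre
  refine le_of_mul_le_mul_right ?_ hq0
  linarith

/-- The interaction matrix at leading order, when the particle `i` has area `a i ^ 2`: the entries
are relative to `-(log ρ) / 2π`, and a particle interacts with itself twice as strongly as with
the others. -/
def leadingMatrix (a : ι → ℝ) : Matrix ι ι ℂ :=
  of fun i j => (((if i = j then 2 else 1) * (a i * a j) : ℝ) : ℂ)

omit [Fintype ι] in
lemma leadingMatrix_apply_self (a : ι → ℝ) (i : ι) :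
    leadingMatrix a i i = ((2 * a i ^ 2 : ℝ) : ℂ) := by
  simp [leadingMatrix, sq]

omit [Fintype ι] in
lemma norm_leadingMatrix_le {a : ι → ℝ} {a₁ : ℝ} (h0 : ∀ i, 0 ≤ a i) (h1 : ∀ i, a i ≤ a₁)
    (i j : ι) : ‖leadingMatrix a i j‖ ≤ 2 * a₁ ^ 2 := by
  have hprod : a i * a j ≤ a₁ ^ 2 := by
    rw [sq]
    exact mul_le_mul (h1 i) (h1 j) (h0 j) ((h0 i).trans (h1 i))
  have hprod0 := mul_nonneg (h0 i) (h0 j)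
  rw [leadingMatrix, of_apply, Complex.norm_real, Real.norm_eq_abs,
    abs_of_nonneg (by split_ifs <;> positivity)]
  split_ifs <;> linarith

omit [Fintype ι] in
/-- `leadingMatrix a` is the diagonal matrix of the `a i ^ 2` plus a rank-one matrix. -/
lemma posSemidef_leadingMatrix_sub [Finite ι] {a : ι → ℝ} {a₀ : ℝ} (h0 : 0 ≤ a₀)
    (ha : ∀ i, a₀ ≤ a i) :
    (leadingMatrix a - ((a₀ ^ 2 : ℝ) : ℂ) • 1).PosSemidef := by
  have hdiag : (diagonal fun i => ((a i ^ 2 - a₀ ^ 2 : ℝ) : ℂ)).PosSemidef :=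
    PosSemidef.diagonal fun i => by
      rw [Pi.zero_apply, Complex.zero_le_real, sub_nonneg]
      exact pow_le_pow_left₀ h0 (ha i) 2
  have heq : leadingMatrix a - ((a₀ ^ 2 : ℝ) : ℂ) • 1 =
      (diagonal fun i => ((a i ^ 2 - a₀ ^ 2 : ℝ) : ℂ)) +
        vecMulVec (fun i => (a i : ℂ)) (star fun i => (a i : ℂ)) := by
    ext i j
    rcases eq_or_ne i j with rfl | hij
    · simp [leadingMatrix, vecMulVec]
      ring
    · simp [leadingMatrix, vecMulVec, hij]
  rw [heq]
  exact hdiag.add (posSemidef_vecMulVec_self_star _)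

end Determinants

/-! ### Feshbach reduction of block operators -/

section Blocks

open InnerProductSpace (rankOne rankOne_apply)

variable {ι : Type*} {H : ι → Type*} [∀ i, NormedAddCommGroup (H i)]
  [∀ i, InnerProductSpace ℂ (H i)]

/-- The blocks `A i j • e i ⊗ e j + S i j`: a matrix `A` acting between the lines `ℂ e i`, perturbed
by operators `S i j`. -/
def blockMap (e : ∀ i, H i) (A : Matrix ι ι ℂ) (S : ∀ i j, H j →L[ℂ] H i) (i j : ι) :
    H j →L[ℂ] H i :=
  A i j • rankOne ℂ (e i) (e j) + S i j

/-- The perturbation of the `i`-th diagonal block, scaled so that the unperturbed block becomes the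
projection `e i ⊗ e i`. -/
def scaledRemainder (A : Matrix ι ι ℂ) (S : ∀ i j, H j →L[ℂ] H i) (i : ι) : H i →L[ℂ] H i :=
  (A i i)⁻¹ • S i i

/-- The normalised dominant eigenvector of the `i`-th diagonal block. -/
def unitVector (e : ∀ i, H i) (A : Matrix ι ι ℂ) (S : ∀ i j, H j →L[ℂ] H i) (i : ι) : H i :=
  ((‖dominantVector (e i) (scaledRemainder A S i)‖⁻¹ : ℝ) : ℂ) •
    dominantVector (e i) (scaledRemainder A S i)

/-- The dominant eigenvalue of the `i`-th diagonal block. -/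
def blockValue (e : ∀ i, H i) (A : Matrix ι ι ℂ) (S : ∀ i j, H j →L[ℂ] H i) (i : ι) : ℂ :=
  A i i * dominantValue (e i) (scaledRemainder A S i)

open scoped Classical in
/-- The matrix of the blocks with respect to their dominant eigenvectors. -/
def interactionMatrix (e : ∀ i, H i) (A : Matrix ι ι ℂ) (S : ∀ i j, H j →L[ℂ] H i) :
    Matrix ι ι ℂ :=
  Matrix.of fun i j => if i = j then blockValue e A S i else
    inner ℂ (unitVector e A S i) (blockMap e A S i j (unitVector e A S j))

variable {e : ∀ i, H i} {A : Matrix ι ι ℂ} {S : ∀ i j, H j →L[ℂ] H i}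

lemma blockMap_apply (i j : ι) (u : H j) :
    blockMap e A S i j u = (A i j * inner ℂ (e j) u) • e i + S i j u := by
  rw [blockMap, add_apply, smul_apply, rankOne_apply, smul_smul]

lemma interactionMatrix_self (i : ι) : interactionMatrix e A S i i = blockValue e A S i :=
  if_pos rfl

lemma interactionMatrix_of_ne {i j : ι} (hij : i ≠ j) :
    interactionMatrix e A S i j =
      inner ℂ (unitVector e A S i) (blockMap e A S i j (unitVector e A S j)) :=
  if_neg hij

lemma norm_scaledRemainder_le {β η : ℝ} (hβ : 0 < β) (hA : ∀ i, β ≤ ‖A i i‖)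
    (hS : ∀ i j, ‖S i j‖ ≤ η) (i : ι) : ‖scaledRemainder A S i‖ ≤ η / β := by
  have hη : 0 ≤ η := (norm_nonneg _).trans (hS i i)
  rw [scaledRemainder, norm_smul, norm_inv, ← div_eq_inv_mul]
  exact div_le_div₀ hη (hS i i) hβ (hA i)

lemma blockMap_self {i : ι} (hA : A i i ≠ 0) :
    blockMap e A S i i = A i i • (rankOne ℂ (e i) (e i) + scaledRemainder A S i) := by
  rw [blockMap, smul_add, scaledRemainder, smul_inv_smul₀ hA]

section Eigen

variable [∀ i, CompleteSpace (H i)] (he : ∀ i, ‖e i‖ = 1)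
  (hs : ∀ i, ‖scaledRemainder A S i‖ ≤ 1 / 16)
include he hs

lemma norm_unitVector (i : ι) : ‖unitVector e A S i‖ = 1 := by
  have := one_le_norm_dominantVector (he i) (hs i)
  rw [unitVector, norm_smul, Complex.norm_real, Real.norm_of_nonneg (by positivity),
    inv_mul_cancel₀ (by positivity)]

lemma blockMap_unitVector {i : ι} (hA : A i i ≠ 0) :
    blockMap e A S i i (unitVector e A S i) = blockValue e A S i • unitVector e A S i := by
  rw [unitVector, map_smul, blockMap_self hA, smul_apply,
    rankOne_add_dominantVector (he i) (hs i), smul_smul (A i i), smul_comm, ← blockValue]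

lemma norm_blockValue_sub_le {η : ℝ} {i : ι} (hA : A i i ≠ 0) (hS : ∀ i j, ‖S i j‖ ≤ η) :
    ‖blockValue e A S i - A i i‖ ≤ 2 * η := by
  have hsi : ‖A i i‖ * ‖scaledRemainder A S i‖ ≤ η := by
    rw [← norm_smul, scaledRemainder, smul_inv_smul₀ hA]
    exact hS i i
  calc ‖blockValue e A S i - A i i‖
      = ‖A i i‖ * ‖dominantValue (e i) (scaledRemainder A S i) - 1‖ := by
        rw [blockValue, ← mul_sub_one, norm_mul]
    _ ≤ ‖A i i‖ * (2 * ‖scaledRemainder A S i‖) := by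
        gcongr
        exact norm_dominantValue_sub_one_le (he i) (hs i)
    _ ≤ 2 * η := by linarith

lemma le_norm_blockValue (i : ι) : ‖A i i‖ / 2 ≤ ‖blockValue e A S i‖ := by
  have hclose := norm_dominantValue_sub_one_le (he i) (hs i)
  have htri := norm_sub_norm_le (1 : ℂ) (dominantValue (e i) (scaledRemainder A S i))
  rw [norm_sub_rev, norm_one] at htri
  rw [blockValue, norm_mul, div_eq_mul_one_div]
  gcongr
  linarith [hs i]

lemma eq_blockValue_of_eigenvector {i : ι} (hA : A i i ≠ 0) {μ : ℂ} (hμ : ‖A i i‖ / 2 ≤ ‖μ‖)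
    {ψ : H i} (hψ : ψ ≠ 0) (h : blockMap e A S i i ψ = μ • ψ) :
    μ = blockValue e A S i ∧ ∃ c : ℂ, ψ = c • unitVector e A S i := by
  set φ := dominantVector (e i) (scaledRemainder A S i)
  have hφ : ((‖φ‖ : ℝ) : ℂ) ≠ 0 := by
    have := one_le_norm_dominantVector (he i) (hs i)
    exact_mod_cast (by positivity)
  have hscaled : (rankOne ℂ (e i) (e i) + scaledRemainder A S i) ψ = ((A i i)⁻¹ * μ) • ψ := by
    rw [mul_smul, ← h, blockMap_self hA, smul_apply, inv_smul_smul₀ hA]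
  obtain ⟨hvalue, hvector⟩ := eq_dominant_of_eigenvector (he i) (hs i) (by
    rw [norm_mul, norm_inv, ← div_eq_inv_mul, le_div_iff₀ (norm_pos_iff.2 hA)]
    linarith) hψ hscaled
  refine ⟨by rw [blockValue, ← hvalue, mul_inv_cancel_left₀ hA], inner ℂ (e i) ψ * ‖φ‖, ?_⟩
  rw [unitVector, smul_smul, Complex.ofReal_inv, mul_assoc, mul_inv_cancel₀ hφ, mul_one]
  exact hvector

lemma inner_unitVector_blockMap_unitVector (i j : ι) :
    inner ℂ (unitVector e A S i) (blockMap e A S i j (unitVector e A S j)) =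
      ((‖dominantVector (e i) (scaledRemainder A S i)‖ *
        ‖dominantVector (e j) (scaledRemainder A S j)‖ : ℝ) : ℂ)⁻¹ *
      (A i j + inner ℂ (dominantVector (e i) (scaledRemainder A S i))
        (S i j (dominantVector (e j) (scaledRemainder A S j)))) := by
  have hleft : inner ℂ (dominantVector (e i) (scaledRemainder A S i)) (e i) = 1 := by
    rw [← inner_conj_symm, inner_dominantVector (he i) (hs i), map_one]
  simp only [unitVector, map_smul, inner_smul_left, inner_smul_right, Complex.conj_ofReal,
    blockMap_apply, inner_add_right, hleft, inner_dominantVector (he j) (hs j), mul_one]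
  push_cast
  rw [mul_inv]
  ring

lemma norm_mul_norm_dominantVector_le {σ : ℝ} (hσ : ∀ i, ‖scaledRemainder A S i‖ ≤ σ) (i j : ι) :
    ‖dominantVector (e i) (scaledRemainder A S i)‖ *
      ‖dominantVector (e j) (scaledRemainder A S j)‖ ≤ 1 + 15 * σ := by
  have hφ (i : ι) :
      ‖dominantVector (e i) (scaledRemainder A S i)‖ ≤ 1 + 6 * ‖scaledRemainder A S i‖ := by
    have := norm_sub_norm_le (dominantVector (e i) (scaledRemainder A S i)) (e i)
    rw [he i] at this
    linarith [norm_dominantVector_sub_le (he i) (hs i)]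
  have hprod : ‖scaledRemainder A S i‖ * ‖scaledRemainder A S j‖ ≤ 1 / 16 * σ := by
    gcongr
    exacts [hs i, hσ j]
  calc _ ≤ (1 + 6 * ‖scaledRemainder A S i‖) * (1 + 6 * ‖scaledRemainder A S j‖) := by
        gcongr <;> exact hφ _
    _ ≤ 1 + 15 * σ := by linarith [hσ i, hσ j, norm_nonneg (scaledRemainder A S i), hσ i]

omit he hs [∀ i, CompleteSpace (H i)] in
lemma norm_inv_mul_add_sub_le {x y : ℂ} {p τ : ℝ} (hp : 1 ≤ p) (hτ : p ≤ 1 + τ) :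
    ‖(p : ℂ)⁻¹ * (x + y) - x‖ ≤ τ * ‖x‖ + ‖y‖ := by
  have hpos : 0 < p := by linarith
  have hinv : p⁻¹ ≤ 1 := inv_le_one_of_one_le₀ hp
  have hsplit : (p : ℂ)⁻¹ * (x + y) - x = ((p⁻¹ - 1 : ℝ) : ℂ) * x + (p⁻¹ : ℝ) * y := by
    push_cast
    ring
  have hcoef : 1 - p⁻¹ ≤ τ := by
    have : 2 ≤ p + p⁻¹ := by
      have := mul_inv_cancel₀ hpos.ne'
      nlinarith [sq_nonneg (p - 1), inv_pos.2 hpos]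
    linarith
  rw [hsplit]
  refine (norm_add_le _ _).trans ?_
  rw [norm_mul, norm_mul, Complex.norm_real, Complex.norm_real,
    Real.norm_of_nonneg (inv_nonneg.2 hpos.le), Real.norm_of_nonpos (by linarith), neg_sub]
  gcongr
  exact mul_le_of_le_one_left (norm_nonneg _) hinv

lemma norm_interactionMatrix_sub_le {β K η : ℝ} (hβ : 0 < β) (hAd : ∀ i, β ≤ ‖A i i‖)
    (hAK : ∀ i j, ‖A i j‖ ≤ K) (hS : ∀ i j, ‖S i j‖ ≤ η) (i j : ι) :
    ‖interactionMatrix e A S i j - A i j‖ ≤ (15 * K / β + 4) * η := by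
  have hη : 0 ≤ η := (norm_nonneg _).trans (hS i j)
  have hK : 0 ≤ K := (norm_nonneg _).trans (hAK i j)
  rcases eq_or_ne i j with rfl | hij
  · rw [interactionMatrix_self]
    refine (norm_blockValue_sub_le he hs (norm_pos_iff.1 (hβ.trans_le (hAd i))) hS).trans ?_
    have : 0 ≤ 15 * K / β := by positivity
    gcongr
    linarith
  set φi := dominantVector (e i) (scaledRemainder A S i)
  set φj := dominantVector (e j) (scaledRemainder A S j)
  have hinner : ‖inner ℂ φi (S i j φj)‖ ≤ 2 * (η * 2) := by
    refine (norm_inner_le_norm _ _).trans ?_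
    gcongr
    · exact norm_dominantVector_le_two (he i) (hs i)
    · exact (S i j).le_of_opNorm_le_of_le (hS i j) (norm_dominantVector_le_two (he j) (hs j))
  rw [interactionMatrix_of_ne hij, inner_unitVector_blockMap_unitVector he hs]
  refine (norm_inv_mul_add_sub_le (one_le_mul_of_one_le_of_one_le
    (one_le_norm_dominantVector (he i) (hs i)) (one_le_norm_dominantVector (he j) (hs j)))
    (norm_mul_norm_dominantVector_le he hs (norm_scaledRemainder_le hβ hAd hS) i j)).trans ?_
  calc _ ≤ 15 * (η / β) * K + 2 * (η * 2) := by
        gcongr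
        exact hAK i j
    _ = (15 * K / β + 4) * η := by ring

end Eigen

lemma continuousOn_interactionMatrix [∀ i, CompleteSpace (H i)] {T : Type*} [TopologicalSpace T]
    {U : Set T} {S : T → ∀ i j, H j →L[ℂ] H i} (he : ∀ i, ‖e i‖ = 1)
    (hs : ∀ t ∈ U, ∀ i, ‖scaledRemainder A (S t) i‖ ≤ 1 / 16)
    (hc : ∀ i j, ContinuousOn (fun t => S t i j) U) :
    ContinuousOn (fun t => interactionMatrix e A (S t)) U := by
  have hsc (i : ι) : ContinuousOn (fun t => scaledRemainder A (S t) i) U :=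
    (hc i i).const_smul (A i i)⁻¹
  have hd (i : ι) : ContinuousOn (fun t => dominantVector (e i) (scaledRemainder A (S t) i)) U :=
    continuousOn_dominantVector (he i) (fun t ht => hs t ht i) (hsc i)
  have hu (i : ι) : ContinuousOn (fun t => unitVector e A (S t) i) U := by
    refine (Complex.continuous_ofReal.comp_continuousOn ((hd i).norm.inv₀ fun t ht => ?_)).smul
      (hd i)
    exact (zero_lt_one.trans_le (one_le_norm_dominantVector (he i) (hs t ht i))).ne'
  refine continuousOn_pi.2 fun i => continuousOn_pi.2 fun j => ?_
  rcases eq_or_ne i j with rfl | hij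
  · simp only [interactionMatrix_self, blockValue, dominantValue]
    exact continuousOn_const.mul (continuousOn_const.add
      (continuousOn_const.inner ((hsc i).clm_apply (hd i))))
  · simp only [interactionMatrix_of_ne hij]
    exact (hu i).inner ((continuousOn_const.add (hc i j)).clm_apply (hu j))

end Blocks

section Inverse

variable {E : Type*} [NormedRing E] [HasSummableGeomSeries E] {x : E}

lemma isUnit_one_sub_of_norm_le (hx : ‖x‖ ≤ 1 / 2) : IsUnit (1 - x) :=
  (Units.oneSub x (by linarith)).isUnit

lemma norm_inverse_one_sub_sub_one_le (hx : ‖x‖ ≤ 1 / 2) :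
    ‖Ring.inverse (1 - x) - 1‖ ≤ 2 * ‖x‖ := by
  set R := Ring.inverse (1 - x)
  have hR : (1 - x) * R = 1 := Ring.mul_inverse_cancel _ (isUnit_one_sub_of_norm_le hx)
  have hfix : R - 1 = x + x * (R - 1) := by
    rw [← sub_eq_zero] at hR ⊢
    rw [← hR]
    noncomm_ring
  have : ‖R - 1‖ ≤ ‖x‖ + ‖x‖ * ‖R - 1‖ :=
    calc ‖R - 1‖ = ‖x + x * (R - 1)‖ := congrArg _ hfix
      _ ≤ ‖x‖ + ‖x‖ * ‖R - 1‖ := (norm_add_le _ _).trans (by gcongr; exact norm_mul_le _ _)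
  nlinarith [norm_nonneg (R - 1)]

lemma continuousOn_inverse_one_sub {T : Type*} [TopologicalSpace T] {U : Set T} {x : T → E}
    (hc : ContinuousOn x U) (hx : ∀ t ∈ U, ‖x t‖ ≤ 1 / 2) :
    ContinuousOn (fun t => Ring.inverse (1 - x t)) U := by
  intro t ht
  obtain ⟨y, hy⟩ := isUnit_one_sub_of_norm_le (hx t ht)
  have hinv : ContinuousAt Ring.inverse (1 - x t) := hy ▸ NormedRing.inverse_continuousAt y
  exact hinv.comp_continuousWithinAt (f := fun t => 1 - x t) (continuousOn_const.sub hc t ht)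

end Inverse

section Feshbach

variable {ι : Type*} [Fintype ι] [DecidableEq ι] {H : ι → Type*} [∀ i, NormedAddCommGroup (H i)]

section BlockOperator

variable [∀ i, NormedSpace ℂ (H i)]

/-- The operator on the product space with blocks `S i j`. -/
def blockOperator (S : ∀ i j, H j →L[ℂ] H i) : (∀ i, H i) →L[ℂ] (∀ i, H i) :=
  ∑ i, ∑ j, ContinuousLinearMap.single ℂ H i ∘L S i j ∘L ContinuousLinearMap.proj j

lemma blockOperator_apply (S : ∀ i j, H j →L[ℂ] H i) (u : ∀ i, H i) (i : ι) :
    blockOperator S u i = ∑ j, S i j (u j) := by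
  simp only [blockOperator, sum_apply, Finset.sum_apply,
    ContinuousLinearMap.comp_apply, ContinuousLinearMap.proj_apply,
    ContinuousLinearMap.single_apply]
  rw [Finset.sum_eq_single i (fun k _ hk => Finset.sum_eq_zero fun j _ => by simp [hk.symm])
    (by simp)]
  simp

lemma norm_blockOperator_le {S : ∀ i j, H j →L[ℂ] H i} {η : ℝ} (hη : 0 ≤ η)
    (hS : ∀ i j, ‖S i j‖ ≤ η) : ‖blockOperator S‖ ≤ Fintype.card ι * η := by
  refine ContinuousLinearMap.opNorm_le_bound _ (by positivity) fun u => ?_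
  refine (pi_norm_le_iff_of_nonneg (by positivity)).2 fun i => ?_
  rw [blockOperator_apply]
  calc _ ≤ ∑ j, ‖S i j (u j)‖ := norm_sum_le _ _
    _ ≤ ∑ _j : ι, η * ‖u‖ := by
        gcongr with j
        exact (S i j).le_of_opNorm_le_of_le (hS i j) (norm_le_pi_norm u j)
    _ = Fintype.card ι * η * ‖u‖ := by
        rw [Finset.sum_const, Finset.card_univ, nsmul_eq_mul, mul_assoc]

lemma norm_inv_smul_blockOperator_le {S : ∀ i j, H j →L[ℂ] H i} {η ζ : ℝ} (hη : 0 ≤ η)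
    (hS : ∀ i j, ‖S i j‖ ≤ η) {z : ℂ} (hζ : 0 < ζ) (hz : ζ ≤ ‖z‖) :
    ‖z⁻¹ • blockOperator S‖ ≤ Fintype.card ι * η / ζ := by
  rw [norm_smul, norm_inv, ← div_eq_inv_mul]
  exact div_le_div₀ (by positivity) (norm_blockOperator_le hη hS) hζ hz

/-- The resolvent factor `(1 - S / z)⁻¹`. -/
def resolventFactor (S : ∀ i j, H j →L[ℂ] H i) (z : ℂ) : (∀ i, H i) →L[ℂ] (∀ i, H i) :=
  Ring.inverse (1 - z⁻¹ • blockOperator S)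

end BlockOperator

variable [∀ i, InnerProductSpace ℂ (H i)]

variable (e : ∀ i, H i) in
/-- The coefficients of a family of vectors along the lines `ℂ e i`. -/
def coefficients : (∀ i, H i) →L[ℂ] (ι → ℂ) :=
  ContinuousLinearMap.pi fun i => innerSL ℂ (e i) ∘L ContinuousLinearMap.proj i

variable (e : ∀ i, H i) in
/-- The family of vectors on the lines `ℂ e i` with given coefficients. -/
def fromCoefficients : (ι → ℂ) →L[ℂ] ∀ i, H i :=
  ContinuousLinearMap.pi fun i => (ContinuousLinearMap.proj i).smulRight (e i)

variable (e : ∀ i, H i) in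
/-- The matrix of the compression of an operator on the product space to the lines `ℂ e i`. -/
def compression (T : (∀ i, H i) →L[ℂ] (∀ i, H i)) : Matrix ι ι ℂ :=
  LinearMap.toMatrix' (coefficients e ∘L T ∘L fromCoefficients e).toLinearMap

variable (e : ∀ i, H i) in
/-- The Schur complement of the block system obtained by eliminating the components orthogonal to
the lines `ℂ e i`. -/
def feshbachMatrix (A : Matrix ι ι ℂ) (S : ∀ i j, H j →L[ℂ] H i) (z : ℂ) : Matrix ι ι ℂ :=
  compression e (resolventFactor S z) * A

variable {e : ∀ i, H i} {A : Matrix ι ι ℂ} {S : ∀ i j, H j →L[ℂ] H i}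

lemma compression_mulVec (T : (∀ i, H i) →L[ℂ] (∀ i, H i)) (w : ι → ℂ) :
    (compression e T).mulVec w = coefficients e (T (fromCoefficients e w)) :=
  LinearMap.toMatrix'_mulVec _ _

lemma compression_sub (T T' : (∀ i, H i) →L[ℂ] (∀ i, H i)) :
    compression e (T - T') = compression e T - compression e T' := by
  rw [compression, ContinuousLinearMap.sub_comp, ContinuousLinearMap.comp_sub]
  exact map_sub LinearMap.toMatrix' _ _

lemma compression_one (he : ∀ i, ‖e i‖ = 1) : compression e 1 = 1 := by
  refine Matrix.ext_of_mulVec_single fun j => ?_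
  rw [compression_mulVec, Matrix.one_mulVec]
  ext i
  simp [coefficients, fromCoefficients, inner_self_eq_norm_sq_to_K, he i]

lemma compression_apply (T : (∀ i, H i) →L[ℂ] (∀ i, H i)) (i j : ι) :
    compression e T i j = inner ℂ (e i) (T (fromCoefficients e (Pi.single j 1)) i) := by
  rw [compression, LinearMap.toMatrix'_apply]
  rfl

lemma norm_compression_apply_le (he : ∀ i, ‖e i‖ = 1) (T : (∀ i, H i) →L[ℂ] (∀ i, H i))
    (i j : ι) : ‖compression e T i j‖ ≤ ‖T‖ := by
  have hj : ‖fromCoefficients e (Pi.single j 1)‖ ≤ 1 := by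
    refine (pi_norm_le_iff_of_nonneg zero_le_one).2 fun k => ?_
    rcases eq_or_ne k j with rfl | hkj
    · simp [fromCoefficients, he]
    · simp [fromCoefficients, hkj]
  rw [compression_apply]
  calc _ ≤ ‖e i‖ * ‖T (fromCoefficients e (Pi.single j 1)) i‖ := norm_inner_le_norm _ _
    _ ≤ 1 * ‖T (fromCoefficients e (Pi.single j 1))‖ := by
        rw [he i]
        gcongr
        exact norm_le_pi_norm (T (fromCoefficients e (Pi.single j 1))) i
    _ ≤ ‖T‖ := (one_mul _).trans_le (T.le_of_opNorm_le_of_le le_rfl hj |>.trans_eq (mul_one _))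

lemma smul_eq_sum_blockMap_iff {z : ℂ} (hz0 : z ≠ 0) (u : ∀ i, H i) :
    (∀ i, z • u i = ∑ j, blockMap e A S i j (u j)) ↔
      (1 - z⁻¹ • blockOperator S) u =
        z⁻¹ • fromCoefficients e (A.mulVec (coefficients e u)) := by
  rw [funext_iff]
  refine forall_congr' fun i => ?_
  have hsum : ∑ j, blockMap e A S i j (u j) =
      fromCoefficients e (A.mulVec (coefficients e u)) i + blockOperator S u i := by
    simp only [blockMap_apply, Finset.sum_add_distrib, ← Finset.sum_smul, blockOperator_apply]
    rfl
  rw [hsum, ← sub_eq_iff_eq_add, Pi.smul_apply, eq_inv_smul_iff₀ hz0]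
  simp only [sub_apply, smul_apply, one_apply_eq_self, Pi.sub_apply, Pi.smul_apply, smul_sub,
    smul_inv_smul₀ hz0]

variable [∀ i, CompleteSpace (H i)]

theorem exists_blockMap_eigenvector_iff {z : ℂ} (hz0 : z ≠ 0)
    (hz : ‖z⁻¹ • blockOperator S‖ ≤ 1 / 2) :
    (∃ u : ∀ i, H i, u ≠ 0 ∧ ∀ i, z • u i = ∑ j, blockMap e A S i j (u j)) ↔
      (z • (1 : Matrix ι ι ℂ) - feshbachMatrix e A S z).det = 0 := by
  simp only [smul_eq_sum_blockMap_iff hz0, ← Matrix.exists_mulVec_eq_zero_iff, Matrix.sub_mulVec,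
    Matrix.smul_mulVec, Matrix.one_mulVec, sub_eq_zero, feshbachMatrix, ← Matrix.mulVec_mulVec,
    compression_mulVec]
  have hunit := isUnit_one_sub_of_norm_le (E := (∀ i, H i) →L[ℂ] ∀ i, H i) hz
  set R := resolventFactor S z
  have hRl : ∀ u, R ((1 - z⁻¹ • blockOperator S) u) = u :=
    DFunLike.congr_fun (Ring.inverse_mul_cancel _ hunit)
  have hRr : ∀ u, (1 - z⁻¹ • blockOperator S) (R u) = u :=
    DFunLike.congr_fun (Ring.mul_inverse_cancel _ hunit)
  constructor
  · rintro ⟨u, hu, hsys⟩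
    have huR : R (fromCoefficients e (A.mulVec (coefficients e u))) = z • u := by
      rw [← smul_inv_smul₀ hz0 (fromCoefficients e _), ← hsys, map_smul, hRl]
    refine ⟨coefficients e u, fun h0 => hu ?_, by rw [huR, map_smul]⟩
    rw [h0, Matrix.mulVec_zero, map_zero, map_zero] at huR
    exact (smul_eq_zero.1 huR.symm).resolve_left hz0
  · rintro ⟨v, hv, hvz⟩
    have hcoef : coefficients e (z⁻¹ • R (fromCoefficients e (A.mulVec v))) = v := by
      rw [map_smul, ← hvz, inv_smul_smul₀ hz0]
    refine ⟨z⁻¹ • R (fromCoefficients e (A.mulVec v)), fun h0 => hv ?_, ?_⟩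
    · rw [← hcoef, h0, map_zero]
    · rw [hcoef, map_smul, hRr]

theorem norm_feshbachMatrix_sub_le (he : ∀ i, ‖e i‖ = 1) {K η : ℝ} (hA : ∀ i j, ‖A i j‖ ≤ K)
    (hS : ∀ i j, ‖S i j‖ ≤ η) {z : ℂ} {ζ : ℝ} (hζ : 0 < ζ) (hz : ζ ≤ ‖z‖)
    (hη : Fintype.card ι * η ≤ ζ / 2) (i j : ι) :
    ‖feshbachMatrix e A S z i j - A i j‖ ≤ 2 * Fintype.card ι ^ 2 * K / ζ * η := by
  have hη0 : 0 ≤ η := (norm_nonneg _).trans (hS i j)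
  have hx := norm_inv_smul_blockOperator_le hη0 hS hζ hz
  have hhalf : Fintype.card ι * η / ζ ≤ 1 / 2 := by
    rw [div_le_iff₀ hζ]
    linarith
  have hR : ‖resolventFactor S z - 1‖ ≤ 2 * (Fintype.card ι * η / ζ) :=
    (norm_inverse_one_sub_sub_one_le (E := (∀ i, H i) →L[ℂ] ∀ i, H i)
      (hx.trans hhalf)).trans (by gcongr)
  have hdiff : feshbachMatrix e A S z - A = compression e (resolventFactor S z - 1) * A := by
    rw [compression_sub, compression_one he, Matrix.sub_mul, Matrix.one_mul, feshbachMatrix]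
  rw [← Matrix.sub_apply, hdiff, Matrix.mul_apply]
  calc _ ≤ ∑ l, ‖compression e (resolventFactor S z - 1) i l * A l j‖ := norm_sum_le _ _
    _ ≤ ∑ _l : ι, 2 * (Fintype.card ι * η / ζ) * K := by
        gcongr with l
        rw [norm_mul]
        gcongr
        · exact (norm_compression_apply_le he _ i l).trans hR
        · exact hA l j
    _ = 2 * Fintype.card ι ^ 2 * K / ζ * η := by
        rw [Finset.sum_const, Finset.card_univ, nsmul_eq_mul]
        ring

lemma continuousOn_feshbachMatrix {T : Type*} [TopologicalSpace T] {U : Set T}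
    {S : T → ∀ i j, H j →L[ℂ] H i} {z : T → ℂ} (hz : ContinuousOn z U) (hz0 : ∀ t ∈ U, z t ≠ 0)
    (hc : ∀ i j, ContinuousOn (fun t => S t i j) U)
    (hsm : ∀ t ∈ U, ‖(z t)⁻¹ • blockOperator (S t)‖ ≤ 1 / 2) :
    ContinuousOn (fun t => feshbachMatrix e A (S t) (z t)) U := by
  have hb : ContinuousOn (fun t => blockOperator (S t)) U := by
    unfold blockOperator
    refine continuousOn_finsetSum _ fun i _ => continuousOn_finsetSum _ fun j _ => ?_
    exact continuousOn_const.clm_comp ((hc i j).clm_comp continuousOn_const)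
  have hR : ContinuousOn (fun t => resolventFactor (S t) (z t)) U :=
    continuousOn_inverse_one_sub (E := (∀ i, H i) →L[ℂ] ∀ i, H i) ((hz.inv₀ hz0).smul hb) hsm
  have hcomp : ContinuousOn (fun t => compression e (resolventFactor (S t) (z t))) U := by
    refine continuousOn_pi.2 fun i => continuousOn_pi.2 fun l => ?_
    simp only [compression_apply]
    exact continuousOn_const.inner
      ((continuous_apply i).comp_continuousOn (hR.clm_apply continuousOn_const))
  exact (Continuous.matrix_mul continuous_id continuous_const).comp_continuousOn hcomp

end Feshbach

/-! ### Integral operators on `L²` -/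

section KernelOperators

variable {X Y 𝕜 : Type*} [MeasurableSpace X] [MeasurableSpace Y] [RCLike 𝕜]
  {μ : Measure X} {ν : Measure Y} {k k' : Y → X → 𝕜} {m m' : ℝ}

/-- The slices `k x` of the kernel are bounded by `m` in `L²(μ)`, for almost every `x`. -/
def SliceBound (k : Y → X → 𝕜) (μ : Measure X) (ν : Measure Y) (m : ℝ) : Prop :=
  ∀ᵐ x ∂ν, AEStronglyMeasurable (k x) μ ∧ eLpNorm (k x) 2 μ ≤ ENNReal.ofReal m

lemma SliceBound.add (h0 : 0 ≤ m) (h0' : 0 ≤ m') (hm : SliceBound k μ ν m)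
    (hm' : SliceBound k' μ ν m') : SliceBound (fun x y => k x y + k' x y) μ ν (m + m') := by
  filter_upwards [hm, hm'] with x hx hx'
  refine ⟨hx.1.add hx'.1, (eLpNorm_add_le hx.1 hx'.1 (by norm_num)).trans ?_⟩
  rw [ENNReal.ofReal_add h0 h0']
  exact add_le_add hx.2 hx'.2

lemma SliceBound.mono (hm : SliceBound k μ ν m) (h : m ≤ m') : SliceBound k μ ν m' := by
  filter_upwards [hm] with x hx
  exact ⟨hx.1, hx.2.trans (ENNReal.ofReal_le_ofReal h)⟩

lemma SliceBound.congr (hm : SliceBound k μ ν m) (hk : ∀ x, k x =ᵐ[μ] k' x) :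
    SliceBound k' μ ν m := by
  filter_upwards [hm] with x hx
  exact ⟨hx.1.congr (hk x), (eLpNorm_congr_ae (hk x)).symm.trans_le hx.2⟩

lemma SliceBound.of_bound [IsFiniteMeasure μ] {C : ℝ} (hk : ∀ x, AEStronglyMeasurable (k x) μ)
    (h : ∀ᵐ x ∂ν, ∀ᵐ y ∂μ, ‖k x y‖ ≤ C) : SliceBound k μ ν (√(μ.real univ) * C) := by
  filter_upwards [h] with x hx
  refine ⟨hk x, (eLpNorm_le_of_ae_bound hx).trans_eq ?_⟩
  rw [ENNReal.ofReal_mul (by positivity), Real.sqrt_eq_rpow,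
    ← ENNReal.ofReal_rpow_of_nonneg (by positivity) (by positivity), ofReal_measureReal]
  norm_num

lemma integrable_mul_of_eLpNorm_le {f u : X → 𝕜} (hf : AEStronglyMeasurable f μ)
    (hm : eLpNorm f 2 μ ≤ ENNReal.ofReal m) (hu : MemLp u 2 μ) :
    Integrable (fun y => f y * u y) μ :=
  MemLp.integrable_mul ⟨hf, hm.trans_lt ENNReal.ofReal_lt_top⟩ hu

lemma norm_integral_mul_le {f : X → 𝕜} (hf : AEStronglyMeasurable f μ) (hm0 : 0 ≤ m)
    (hm : eLpNorm f 2 μ ≤ ENNReal.ofReal m) (u : Lp 𝕜 2 μ) :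
    ‖∫ y, f y * u y ∂μ‖ ≤ m * ‖u‖ := by
  have holder : ‖∫ y, f y * u y ∂μ‖ₑ ≤ ENNReal.ofReal m * eLpNorm u 2 μ := by
    refine (enorm_integral_le_lintegral_enorm _).trans ?_
    rw [← eLpNorm_one_eq_lintegral_enorm]
    exact (eLpNorm_smul_le_mul_eLpNorm (p := 2) (q := 2) (r := 1)
      (Lp.memLp u).1 hf).trans (by gcongr)
  have := ENNReal.toReal_mono
    (ENNReal.mul_ne_top ENNReal.ofReal_ne_top (Lp.eLpNorm_ne_top u)) holder
  rwa [toReal_enorm, ENNReal.toReal_mul, ENNReal.toReal_ofReal hm0, ← Lp.norm_def] at this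

lemma norm_Lp_two_le_of_ae_bound {E : Type*} [NormedAddCommGroup E] [IsFiniteMeasure μ]
    {f : Lp E 2 μ} {C : ℝ} (hC : 0 ≤ C) (h : ∀ᵐ x ∂μ, ‖f x‖ ≤ C) :
    ‖f‖ ≤ √(μ.real univ) * C := by
  refine (Lp.norm_le_of_ae_bound hC h).trans_eq ?_
  rw [Real.sqrt_eq_rpow]
  congr 2
  norm_num

/-- `T` is the integral operator with kernel `k`. -/
def IsKernelOperator (k : Y → X → 𝕜) (T : Lp 𝕜 2 μ →L[𝕜] Lp 𝕜 2 ν) : Prop :=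
  ∀ u : Lp 𝕜 2 μ, T u =ᵐ[ν] fun x => ∫ y, k x y * u y ∂μ

lemma IsKernelOperator.norm_le [IsFiniteMeasure ν] {T : Lp 𝕜 2 μ →L[𝕜] Lp 𝕜 2 ν}
    (hT : IsKernelOperator k T) (hm0 : 0 ≤ m) (hm : SliceBound k μ ν m) :
    ‖T‖ ≤ √(ν.real univ) * m := by
  refine ContinuousLinearMap.opNorm_le_bound _ (by positivity) fun u => ?_
  rw [mul_assoc]
  refine norm_Lp_two_le_of_ae_bound (by positivity) ?_
  filter_upwards [hT u, hm] with x hx hmx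
  rw [hx]
  exact norm_integral_mul_le hmx.1 hm0 hmx.2 u

lemma IsKernelOperator.sub (hm : SliceBound k μ ν m) (hm' : SliceBound k' μ ν m')
    {T T' : Lp 𝕜 2 μ →L[𝕜] Lp 𝕜 2 ν} (hT : IsKernelOperator k T) (hT' : IsKernelOperator k' T') :
    IsKernelOperator (fun x y => k x y - k' x y) (T - T') := by
  intro u
  filter_upwards [Lp.coeFn_sub (T u) (T' u), hT u, hT' u, hm, hm'] with x hsub hx hx' hmx hmx'
  rw [sub_apply, hsub, Pi.sub_apply, hx, hx']
  simp_rw [sub_mul]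
  rw [integral_sub (integrable_mul_of_eLpNorm_le hmx.1 hmx.2 (Lp.memLp u))
    (integrable_mul_of_eLpNorm_le hmx'.1 hmx'.2 (Lp.memLp u))]

lemma SliceBound.memLp_integral [SFinite μ] [IsFiniteMeasure ν]
    (hk : StronglyMeasurable (Function.uncurry k)) (hm0 : 0 ≤ m) (hm : SliceBound k μ ν m)
    (u : Lp 𝕜 2 μ) : MemLp (fun x => ∫ y, k x y * u y ∂μ) 2 ν := by
  have hmeas : StronglyMeasurable (Function.uncurry fun x y => k x y * u y) :=
    hk.mul ((Lp.stronglyMeasurable u).comp_measurable measurable_snd)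
  refine MemLp.of_bound hmeas.integral_prod_right.aestronglyMeasurable (m * ‖u‖) ?_
  filter_upwards [hm] with x hx
  exact norm_integral_mul_le hx.1 hm0 hx.2 u

lemma SliceBound.integral_mul_add (hm : SliceBound k μ ν m) (u v : Lp 𝕜 2 μ) :
    ∀ᵐ x ∂ν, ∫ y, k x y * (u + v) y ∂μ = ∫ y, k x y * u y ∂μ + ∫ y, k x y * v y ∂μ := by
  filter_upwards [hm] with x hx
  rw [← integral_add (integrable_mul_of_eLpNorm_le hx.1 hx.2 (Lp.memLp u))
    (integrable_mul_of_eLpNorm_le hx.1 hx.2 (Lp.memLp v))]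
  refine integral_congr_ae ?_
  filter_upwards [Lp.coeFn_add u v] with y hy
  rw [hy, Pi.add_apply, mul_add]

lemma integral_mul_smul_Lp (f : X → 𝕜) (c : 𝕜) (u : Lp 𝕜 2 μ) :
    ∫ y, f y * (c • u) y ∂μ = c * ∫ y, f y * u y ∂μ := by
  rw [← integral_const_mul]
  refine integral_congr_ae ?_
  filter_upwards [Lp.coeFn_smul c u] with y hy
  rw [hy, Pi.smul_apply, smul_eq_mul, mul_left_comm]

lemma exists_isKernelOperator [SFinite μ] [IsFiniteMeasure ν]
    (hk : StronglyMeasurable (Function.uncurry k)) (hm0 : 0 ≤ m) (hm : SliceBound k μ ν m) :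
    ∃ T : Lp 𝕜 2 μ →L[𝕜] Lp 𝕜 2 ν, IsKernelOperator k T := by
  have hmem := hm.memLp_integral hk hm0
  let L : Lp 𝕜 2 μ →ₗ[𝕜] Lp 𝕜 2 ν :=
    { toFun := fun u => (hmem u).toLp _
      map_add' := fun u v => by
        rw [← MemLp.toLp_add, MemLp.toLp_eq_toLp_iff]
        exact hm.integral_mul_add u v
      map_smul' := fun c u => by
        rw [RingHom.id_apply, ← MemLp.toLp_const_smul, MemLp.toLp_eq_toLp_iff]
        exact .of_forall fun x => integral_mul_smul_Lp (k x) c u }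
  refine ⟨L.mkContinuous (√(ν.real univ) * m) fun u => ?_, fun u => (hmem u).coeFn_toLp⟩
  rw [mul_assoc]
  refine norm_Lp_two_le_of_ae_bound (by positivity) ?_
  filter_upwards [(hmem u).coeFn_toLp, hm] with x hx hmx
  exact hx ▸ norm_integral_mul_le hmx.1 hm0 hmx.2 u

/-- The constant function of norm one in `L²(μ)`. -/
def constVector (𝕜 : Type*) [RCLike 𝕜] (μ : Measure X) [IsFiniteMeasure μ] : Lp 𝕜 2 μ :=
  Lp.const 2 μ (((√(μ.real univ))⁻¹ : ℝ) : 𝕜)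

lemma coeFn_constVector [IsFiniteMeasure μ] :
    constVector 𝕜 μ =ᵐ[μ] fun _ => (((√(μ.real univ))⁻¹ : ℝ) : 𝕜) :=
  Lp.coeFn_const _ _ _

lemma norm_constVector [IsFiniteMeasure μ] (hμ : 0 < μ.real univ) : ‖constVector 𝕜 μ‖ = 1 := by
  have : NeZero μ := ⟨by rintro rfl; simp at hμ⟩
  refine (Lp.norm_const (p := 2) (μ := μ) (by norm_num) (c := _)).trans ?_
  rw [RCLike.norm_ofReal, abs_of_nonneg (by positivity), ENNReal.toReal_ofNat,
    ← Real.sqrt_eq_rpow]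
  exact inv_mul_cancel₀ (by positivity)

lemma integral_eq_inner_constVector [IsFiniteMeasure μ] (hμ : 0 < μ.real univ) (u : Lp 𝕜 2 μ) :
    ∫ y, u y ∂μ = (√(μ.real univ) : 𝕜) * inner 𝕜 (constVector 𝕜 μ) u := by
  have hinner : inner 𝕜 (constVector 𝕜 μ) u = (((√(μ.real univ))⁻¹ : ℝ) : 𝕜) * ∫ y, u y ∂μ := by
    rw [L2.inner_def, ← integral_const_mul]
    refine integral_congr_ae ?_
    filter_upwards [coeFn_constVector (𝕜 := 𝕜) (μ := μ)] with y hy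
    rw [hy, RCLike.inner_apply, RCLike.conj_ofReal, mul_comm]
  have hne : (√(μ.real univ) : 𝕜) ≠ 0 := by exact_mod_cast (Real.sqrt_pos.2 hμ).ne'
  rw [hinner, RCLike.ofReal_inv, mul_inv_cancel_left₀ hne]

lemma isKernelOperator_const [IsFiniteMeasure μ] [IsFiniteMeasure ν] (hμ : 0 < μ.real univ)
    (hν : 0 < ν.real univ) (c : 𝕜) :
    IsKernelOperator (fun _ _ => c) ((c * (√(ν.real univ) * √(μ.real univ))) •
      InnerProductSpace.rankOne 𝕜 (constVector 𝕜 ν) (constVector 𝕜 μ)) := by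
  intro u
  have hne : (√(ν.real univ) : 𝕜) ≠ 0 := by exact_mod_cast (Real.sqrt_pos.2 hν).ne'
  rw [smul_apply, InnerProductSpace.rankOne_apply, smul_smul]
  filter_upwards [Lp.coeFn_smul (c * (√(ν.real univ) * √(μ.real univ)) *
    inner 𝕜 (constVector 𝕜 μ) u) (constVector 𝕜 ν), coeFn_constVector (𝕜 := 𝕜) (μ := ν)]
    with x hsmul hconst
  rw [hsmul, Pi.smul_apply, hconst, integral_const_mul, integral_eq_inner_constVector hμ,
    smul_eq_mul, RCLike.ofReal_inv]
  field_simp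

end KernelOperators

/-! ### Logarithmic kernels -/

section PowerSeries

variable {a : ℕ → ℂ}

lemma norm_mul_pow_le (ha : ∀ n, ‖a n‖ ≤ (n.factorial : ℝ)⁻¹) {w : ℂ} {r : ℝ} (hw : ‖w‖ ≤ r)
    (n : ℕ) : ‖a n * w ^ n‖ ≤ r ^ n / n.factorial := by
  rw [norm_mul, norm_pow, div_eq_inv_mul]
  gcongr
  exact ha n

lemma continuous_tsum_mul_pow (ha : ∀ n, ‖a n‖ ≤ (n.factorial : ℝ)⁻¹) :
    Continuous fun w => ∑' n, a n * w ^ n := by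
  refine continuous_iff_continuousAt.2 fun w => ?_
  have h : ContinuousOn (fun w => ∑' n, a n * w ^ n) (Metric.ball 0 (‖w‖ + 1)) :=
    continuousOn_tsum (fun n => by fun_prop) (Real.summable_pow_div_factorial (‖w‖ + 1))
      fun n x hx => norm_mul_pow_le ha (mem_ball_zero_iff.1 hx).le n
  exact h.continuousAt (Metric.isOpen_ball.mem_nhds (by simp))

lemma norm_succ_le_inv_factorial (ha : ∀ n, ‖a n‖ ≤ (n.factorial : ℝ)⁻¹) (n : ℕ) :
    ‖a (n + 1)‖ ≤ (n.factorial : ℝ)⁻¹ := by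
  refine (ha (n + 1)).trans ?_
  gcongr
  omega

lemma tsum_mul_pow_eq (ha : ∀ n, ‖a n‖ ≤ (n.factorial : ℝ)⁻¹) (w : ℂ) :
    ∑' n, a n * w ^ n = a 0 + w * ∑' n, a (n + 1) * w ^ n := by
  have hsum : Summable fun n => a n * w ^ n :=
    .of_norm_bounded (Real.summable_pow_div_factorial ‖w‖) (norm_mul_pow_le ha le_rfl)
  rw [hsum.tsum_eq_zero_add, ← tsum_mul_left]
  simp only [pow_zero, mul_one, pow_succ', mul_left_comm]

end PowerSeries

section Bessel

/-- The coefficients of `J₀` as a series in `(z / 2) ^ 2`. -/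
def besselJCoeff (n : ℕ) : ℂ := (-1) ^ n / ((n.factorial : ℂ) ^ 2)

/-- The coefficients of the regular part of `Y₀`, divided by `(z / 2) ^ 2`, as a series in
`(z / 2) ^ 2`. -/
def besselYCoeff (n : ℕ) : ℂ :=
  (-1) ^ n * ((harmonic (n + 1) : ℚ) : ℂ) / (((n + 1).factorial : ℂ) ^ 2)

lemma norm_besselJCoeff_le (n : ℕ) : ‖besselJCoeff n‖ ≤ (n.factorial : ℝ)⁻¹ := by
  have h : (1 : ℝ) ≤ n.factorial := by exact_mod_cast n.factorial_pos
  rw [besselJCoeff, norm_div, norm_pow, norm_pow, norm_neg, norm_one, one_pow, Complex.norm_natCast,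
    one_div]
  gcongr
  exact le_self_pow₀ h two_ne_zero

lemma harmonic_le_self (n : ℕ) : harmonic n ≤ n := by
  rw [harmonic]
  calc _ ≤ ∑ _i ∈ Finset.range n, (1 : ℚ) :=
        Finset.sum_le_sum fun i _ => inv_le_one_of_one_le₀ (by exact_mod_cast i.succ_pos)
    _ = n := by simp

lemma norm_besselYCoeff_le (n : ℕ) : ‖besselYCoeff n‖ ≤ (n.factorial : ℝ)⁻¹ := by
  have hfac : (1 : ℝ) ≤ n.factorial := by exact_mod_cast n.factorial_pos
  have hharm : ‖((harmonic (n + 1) : ℚ) : ℂ)‖ ≤ n + 1 := by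
    have hpos : (0 : ℚ) ≤ harmonic (n + 1) := (harmonic_pos n.succ_ne_zero).le
    rw [← Complex.ofReal_ratCast, Complex.norm_real, Real.norm_of_nonneg (by exact_mod_cast hpos)]
    exact_mod_cast harmonic_le_self (n + 1)
  rw [besselYCoeff, norm_div, norm_mul, norm_pow, norm_pow, norm_neg, norm_one, one_pow, one_mul,
    Complex.norm_natCast, Nat.factorial_succ, div_le_iff₀ (by positivity)]
  push_cast
  have hcancel : ((n.factorial : ℝ))⁻¹ * (((n : ℝ) + 1) * n.factorial) ^ 2 =
      (n + 1) * ((n + 1) * n.factorial) := by field_simp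
  rw [hcancel]
  exact hharm.trans (le_mul_of_one_le_right (by positivity)
    (one_le_mul_of_one_le_of_one_le (le_add_of_nonneg_left n.cast_nonneg) hfac))

/-- The function with `J₀(z) = 1 + (z / 2) ^ 2 besselJTail ((z / 2) ^ 2)`. -/
def besselJTail (w : ℂ) : ℂ := ∑' n, besselJCoeff (n + 1) * w ^ n

/-- The regular part of `Y₀`, divided by `(z / 2) ^ 2`, as a function of `(z / 2) ^ 2`. -/
def besselYTail (w : ℂ) : ℂ := ∑' n, besselYCoeff n * w ^ n

lemma continuous_besselJTail : Continuous besselJTail :=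
  continuous_tsum_mul_pow (norm_succ_le_inv_factorial norm_besselJCoeff_le)

lemma continuous_besselYTail : Continuous besselYTail :=
  continuous_tsum_mul_pow norm_besselYCoeff_le

lemma besselJ0_eq (z : ℂ) : besselJ0 z = 1 + (z / 2) ^ 2 * besselJTail ((z / 2) ^ 2) := by
  have h := tsum_mul_pow_eq norm_besselJCoeff_le ((z / 2) ^ 2)
  simp only [← pow_mul] at h
  rw [besselJTail]
  simp only [← pow_mul]
  refine Eq.trans ?_ (h.trans ?_)
  · rfl
  · simp [besselJCoeff]

lemma besselY0_eq (z : ℂ) : besselY0 z =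
    2 / Real.pi * (Complex.log (z / 2) + Real.eulerMascheroniConstant) * besselJ0 z +
      2 / Real.pi * ((z / 2) ^ 2 * besselYTail ((z / 2) ^ 2)) := by
  rw [besselY0, besselYTail, ← tsum_mul_left (a := (z / 2) ^ 2)]
  congr 3
  ext n
  rw [besselYCoeff]
  generalize z / 2 = w
  ring

lemma log_gammaHat : Complex.log gammaHat =
    Real.eulerMascheroniConstant - Complex.I * (Real.pi / 2) - Real.log 2 := by
  have hmul : gammaHat = Complex.exp (Real.eulerMascheroniConstant - Complex.I * (Real.pi / 2)) *
      (((2 : ℝ)⁻¹ : ℝ) : ℂ) := by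
    rw [gammaHat, div_eq_mul_inv, Complex.ofReal_inv, Complex.ofReal_ofNat]
  have him : (Real.eulerMascheroniConstant - Complex.I * (Real.pi / 2) : ℂ).im
      = -(Real.pi / 2) := by simp
  rw [hmul, Complex.log_mul_ofReal _ (by norm_num) _ (Complex.exp_ne_zero _),
    Complex.log_exp (by rw [him]; linarith [Real.pi_pos]) (by rw [him]; linarith [Real.pi_pos]),
    Real.log_inv]
  push_cast
  ring

end Bessel

section Kernels

/-- The coefficients `a`, `b` in a convolution kernel of the form
`-(1/2π) (log |w| + log (κ γ̂)) + κ² log (κ γ̂) a(κ, w) + κ² b(κ, w)`; both `-G` and the kernel of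
the expanded operators have this form. -/
structure KernelTail where
  logPart : ℂ × Plane → ℂ
  plainPart : ℂ × Plane → ℂ
  continuous_logPart : Continuous logPart
  continuous_plainPart : Continuous plainPart

namespace KernelTail

/-- The part of the kernel that is small for small `κ`. -/
def tail (p : KernelTail) (κ : ℂ) (w : Plane) : ℂ :=
  κ ^ 2 * logGammaHat κ * p.logPart (κ, w) + κ ^ 2 * p.plainPart (κ, w)

/-- The part of the kernel that is continuous at `w = 0`: everything but `-(1/2π) log |w|`. -/
def regular (p : KernelTail) (κ : ℂ) (w : Plane) : ℂ :=
  -(1 / (2 * Real.pi)) * logGammaHat κ + p.tail κ w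

/-- The convolution kernel with the given coefficients. -/
def kernel (p : KernelTail) (κ : ℂ) (w : Plane) : ℂ :=
  ((-(1 / (2 * Real.pi)) * Real.log ‖w‖ : ℝ) : ℂ) + p.regular κ w

lemma continuous_regular (p : KernelTail) (κ : ℂ) : Continuous (p.regular κ) := by
  have := p.continuous_logPart
  have := p.continuous_plainPart
  unfold regular tail
  fun_prop

lemma continuousOn_regular (p : KernelTail) :
    ContinuousOn (fun q : ℂ × Plane => p.regular q.1 q.2) (Complex.slitPlane ×ˢ univ) := by
  have := p.continuous_logPart
  have := p.continuous_plainPart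
  have : ContinuousOn (fun q : ℂ × Plane => logGammaHat q.1) (Complex.slitPlane ×ˢ univ) :=
    (continuousOn_fst.clog fun q hq => hq.1).add continuousOn_const
  unfold regular tail
  fun_prop

lemma stronglyMeasurable_kernel (p : KernelTail) (κ : ℂ) :
    StronglyMeasurable (Function.uncurry fun x y : Plane => p.kernel κ (x - y)) := by
  have hlog : Measurable fun w : Plane => ((-(1 / (2 * Real.pi)) * Real.log ‖w‖ : ℝ) : ℂ) := by
    fun_prop
  have : Measurable (p.kernel κ) := hlog.add (p.continuous_regular κ).measurable
  exact (this.comp (measurable_fst.sub measurable_snd)).stronglyMeasurable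

end KernelTail

/-- The coefficients for the kernel of the expanded operators `M` and `N`. -/
def expandedTail : KernelTail where
  logPart q := ((1 / (8 * Real.pi) * ‖q.2‖ ^ 2 : ℝ) : ℂ)
  plainPart _ := 0
  continuous_logPart := by fun_prop
  continuous_plainPart := continuous_const

/-- The coefficients for the kernel `-G`; see `neg_green_eq`. -/
def greenTail : KernelTail where
  logPart q := -((1 / (8 * Real.pi) * ‖q.2‖ ^ 2 : ℝ) : ℂ) * besselJTail ((q.1 * ‖q.2‖ / 2) ^ 2)
  plainPart q := -((1 / (8 * Real.pi) * (‖q.2‖ * (‖q.2‖ * Real.log ‖q.2‖)) : ℝ) : ℂ) *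
      besselJTail ((q.1 * ‖q.2‖ / 2) ^ 2) -
    ((1 / (8 * Real.pi) * ‖q.2‖ ^ 2 : ℝ) : ℂ) * besselYTail ((q.1 * ‖q.2‖ / 2) ^ 2)
  continuous_logPart := by
    have := continuous_besselJTail
    fun_prop
  continuous_plainPart := by
    have := continuous_besselJTail
    have := continuous_besselYTail
    have : Continuous fun q : ℂ × Plane => ‖q.2‖ * Real.log ‖q.2‖ :=
      Real.continuous_mul_log.comp (continuous_norm.comp continuous_snd)
    fun_prop

lemma neg_green_eq {κ : ℂ} (hκ : κ ∈ Complex.slitPlane) {w : Plane} (hw : w ≠ 0) :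
    -green κ w = greenTail.kernel κ w := by
  have hr : 0 < ‖w‖ := norm_pos_iff.2 hw
  have hpi : (Real.pi : ℂ) ≠ 0 := by exact_mod_cast Real.pi_ne_zero
  have hlog : Complex.log (κ * ‖w‖ / 2) = Complex.log κ + Real.log ‖w‖ - Real.log 2 := by
    have : κ * ‖w‖ / 2 = κ * ((‖w‖ / 2 : ℝ) : ℂ) := by push_cast; ring
    rw [this, Complex.log_mul_ofReal _ (by positivity) _ (Complex.slitPlane_ne_zero hκ),
      Real.log_div hr.ne' (by norm_num)]
    push_cast
    ring
  rw [green, hankel0, besselY0_eq, hlog, besselJ0_eq, KernelTail.kernel, KernelTail.regular,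
    KernelTail.tail, logGammaHat, log_gammaHat]
  simp only [greenTail]
  push_cast
  generalize besselJTail ((κ * ‖w‖ / 2) ^ 2) = j
  generalize besselYTail ((κ * ‖w‖ / 2) ^ 2) = y
  field_simp
  ring_nf
  simp only [Complex.I_sq]
  ring

lemma norm_mul_norm_logGammaHat_le {κ : ℂ} (hκ : ‖κ‖ ≤ 1) :
    ‖κ‖ * ‖logGammaHat κ‖ ≤ 1 + (Real.pi + ‖Complex.log gammaHat‖) := by
  rcases eq_or_ne κ 0 with rfl | hκ0
  · rw [norm_zero, zero_mul]
    positivity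
  have hlog : ‖Complex.log κ‖ ≤ |Real.log ‖κ‖| + Real.pi := by
    refine (Complex.norm_le_abs_re_add_abs_im _).trans ?_
    rw [Complex.log_re, Complex.log_im]
    gcongr
    exact Complex.abs_arg_le_pi κ
  have hmul : ‖κ‖ * |Real.log ‖κ‖| ≤ 1 := by
    have := (Real.abs_log_mul_self_lt ‖κ‖ (norm_pos_iff.2 hκ0) hκ).le
    rwa [abs_mul, abs_norm, mul_comm] at this
  calc ‖κ‖ * ‖logGammaHat κ‖
    _ ≤ ‖κ‖ * (|Real.log ‖κ‖| + Real.pi + ‖Complex.log gammaHat‖) := by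
      rw [logGammaHat]
      gcongr
      exact (norm_add_le _ _).trans (by gcongr)
    _ = ‖κ‖ * |Real.log ‖κ‖| + ‖κ‖ * (Real.pi + ‖Complex.log gammaHat‖) := by ring
    _ ≤ 1 + 1 * (Real.pi + ‖Complex.log gammaHat‖) := by gcongr
    _ = 1 + (Real.pi + ‖Complex.log gammaHat‖) := by rw [one_mul]

lemma KernelTail.norm_tail_le_norm_mul (p : KernelTail) {κ : ℂ} (hκ : ‖κ‖ ≤ 1) {w : Plane}
    {M₁ M₂ : ℝ} (h₁ : ‖p.logPart (κ, w)‖ ≤ M₁) (h₂ : ‖p.plainPart (κ, w)‖ ≤ M₂) :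
    ‖p.tail κ w‖ ≤ ‖κ‖ * ((1 + (Real.pi + ‖Complex.log gammaHat‖)) * M₁ + M₂) := by
  have hlog : ‖κ ^ 2 * logGammaHat κ * p.logPart (κ, w)‖ ≤
      ‖κ‖ * ((1 + (Real.pi + ‖Complex.log gammaHat‖)) * M₁) := by
    have := norm_mul_norm_logGammaHat_le hκ
    calc ‖κ ^ 2 * logGammaHat κ * p.logPart (κ, w)‖
      _ = ‖κ‖ * (‖κ‖ * ‖logGammaHat κ‖ * ‖p.logPart (κ, w)‖) := by
        rw [norm_mul, norm_mul, norm_pow]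
        ring
      _ ≤ _ := by gcongr
  have hplain : ‖κ ^ 2 * p.plainPart (κ, w)‖ ≤ ‖κ‖ * M₂ := by
    rw [norm_mul, norm_pow, sq, mul_assoc]
    gcongr
    exact (mul_le_of_le_one_left (norm_nonneg _) hκ).trans h₂
  exact (norm_add_le_of_le hlog hplain).trans_eq (mul_add _ _ _).symm

lemma KernelTail.exists_norm_tail_le (p : KernelTail) (R : ℝ) :
    ∃ κ₁ > 0, ∀ κ : ℂ, ‖κ‖ ≤ κ₁ → ∀ w : Plane, ‖w‖ ≤ R → ‖p.tail κ w‖ ≤ 1 := by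
  have hK : IsCompact (Metric.closedBall (0 : ℂ) 1 ×ˢ Metric.closedBall (0 : Plane) R) :=
    (isCompact_closedBall _ _).prod (isCompact_closedBall _ _)
  obtain ⟨M₁, hM₁⟩ := hK.exists_bound_of_continuousOn p.continuous_logPart.continuousOn
  obtain ⟨M₂, hM₂⟩ := hK.exists_bound_of_continuousOn p.continuous_plainPart.continuousOn
  set M : ℝ := |(1 + (Real.pi + ‖Complex.log gammaHat‖)) * M₁ + M₂| + 1
  have hM0 : 0 < M := by positivity
  refine ⟨min 1 M⁻¹, by positivity, fun κ hκ w hw => ?_⟩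
  have hκ1 : ‖κ‖ ≤ 1 := hκ.trans (min_le_left _ _)
  have hmem : (κ, w) ∈ Metric.closedBall (0 : ℂ) 1 ×ˢ Metric.closedBall (0 : Plane) R :=
    ⟨by simpa using hκ1, by simpa using hw⟩
  calc ‖p.tail κ w‖
    _ ≤ ‖κ‖ * ((1 + (Real.pi + ‖Complex.log gammaHat‖)) * M₁ + M₂) :=
      p.norm_tail_le_norm_mul hκ1 (hM₁ _ hmem) (hM₂ _ hmem)
    _ ≤ ‖κ‖ * M := by
      gcongr
      exact (le_abs_self _).trans (le_add_of_nonneg_right zero_le_one)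
    _ ≤ M⁻¹ * M := by
      gcongr
      exact hκ.trans (min_le_right _ _)
    _ = 1 := inv_mul_cancel₀ hM0.ne'

end Kernels

section LogIntegrals

lemma restrict_eq_smul_map_sub_smul {E : Type*} [NormedAddCommGroup E] [NormedSpace ℝ E]
    [MeasurableSpace E] [BorelSpace E] [FiniteDimensional ℝ E] (μ : Measure E)
    [μ.IsAddHaarMeasure] {r : ℝ} (hr : 0 < r) (x : E) {s : Set E} (hs : MeasurableSet s) :
    μ.restrict s = ENNReal.ofReal (r ^ Module.finrank ℝ E) •
      (μ.restrict ((fun z => x - r • z) ⁻¹' s)).map fun z => x - r • z := by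
  have hpow : 0 < r ^ Module.finrank ℝ E := by positivity
  have hmap : μ.map (fun z => x - r • z) = ENNReal.ofReal (r ^ Module.finrank ℝ E)⁻¹ • μ := by
    have : (fun z => x - r • z) = (fun y => x - y) ∘ fun z => r • z := rfl
    rw [this, ← Measure.map_map (by fun_prop) (by fun_prop), Measure.map_addHaar_smul μ hr.ne',
      Measure.map_smul, Measure.map_sub_left_eq_self, abs_of_pos (inv_pos.2 hpow)]
  rw [← Measure.restrict_map (by fun_prop) hs, hmap, Measure.restrict_smul, smul_smul,
    ← ENNReal.ofReal_mul hpow.le, mul_inv_cancel₀ hpow.ne', ENNReal.ofReal_one, one_smul]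

lemma memLp_log_norm (r : ℝ) :
    MemLp (fun z : Plane => ((Real.log ‖z‖ : ℝ) : ℂ)) 2 (volume.restrict (Metric.ball 0 r)) := by
  have hmeas : Measurable fun z : Plane => Real.log ‖z‖ := by fun_prop
  refine MemLp.ofReal ((memLp_two_iff_integrable_sq hmeas.aestronglyMeasurable).2 ?_)
  refine (integrableOn_fun_norm_addHaar volume (f := fun y => Real.log y ^ 2)).2 ?_
  have hcont : Continuous fun y : ℝ => 4 * (√y * Real.log √y) ^ 2 :=
    continuous_const.mul ((Real.continuous_mul_log.comp Real.continuous_sqrt).pow 2)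
  refine ((hcont.integrableOn_Icc (a := 0) (b := r)).mono_set Ioo_subset_Icc_self).congr_fun
    (fun y hy => ?_) measurableSet_Ioo
  simp only [finrank_euclideanSpace, Fintype.card_fin, smul_eq_mul]
  rw [Real.log_sqrt hy.1.le, mul_pow, Real.sq_sqrt hy.1.le]
  ring

/-- The `L²` norm of `log |z|` on the ball of radius `3`. -/
def logConst : ℝ :=
  (eLpNorm (fun z : Plane => ((Real.log ‖z‖ : ℝ) : ℂ)) 2
    (volume.restrict (Metric.ball 0 3))).toReal

lemma eLpNorm_log_dist_le {ρ : ℝ} (hρ : 0 < ρ) {D : Set Plane} {x : Plane}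
    (hD : D ⊆ Metric.ball x (3 * ρ)) :
    eLpNorm (fun y => ((Real.log (‖x - y‖ / ρ) : ℝ) : ℂ)) 2 (volume.restrict D) ≤
      ENNReal.ofReal (ρ * logConst) := by
  refine (eLpNorm_mono_measure _ (Measure.restrict_mono hD le_rfl)).trans_eq ?_
  have hnorm (z : Plane) : ‖x - (x - ρ • z)‖ = ρ * ‖z‖ := by
    rw [sub_sub_cancel, norm_smul, Real.norm_of_nonneg hρ.le]
  have hball : (fun z => x - ρ • z) ⁻¹' Metric.ball x (3 * ρ) = Metric.ball (0 : Plane) 3 := by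
    ext z
    rw [mem_preimage, mem_ball_iff_norm', hnorm, mem_ball_zero_iff, mul_comm,
      mul_lt_mul_iff_left₀ hρ]
  have hmeas : Measurable fun y : Plane => ((Real.log (‖x - y‖ / ρ) : ℝ) : ℂ) := by fun_prop
  rw [restrict_eq_smul_map_sub_smul volume hρ x measurableSet_ball,
    eLpNorm_smul_measure_of_ne_top (by norm_num), eLpNorm_map_measure hmeas.aestronglyMeasurable
      (by fun_prop), hball, ENNReal.ofReal_mul hρ.le, logConst,
    ENNReal.ofReal_toReal (memLp_log_norm 3).eLpNorm_ne_top, smul_eq_mul, finrank_euclideanSpace,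
    Fintype.card_fin, ENNReal.ofReal_pow hρ.le, ← ENNReal.rpow_natCast, ← ENNReal.rpow_mul]
  congr 2
  · norm_num
  · ext z
    rw [Function.comp_apply, hnorm, mul_div_cancel_left₀ _ hρ.ne']

lemma memLp_log_dist {S : Set Plane} (hS : Bornology.IsBounded S) (x : Plane) :
    MemLp (fun y => ((Real.log ‖x - y‖ : ℝ) : ℂ)) 2 (volume.restrict S) := by
  obtain ⟨r, hr, hSr⟩ := hS.subset_ball_lt 0 x
  have hbound := eLpNorm_log_dist_le hr (hSr.trans (Metric.ball_subset_ball (by linarith)))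
  have hmeas : Measurable fun y : Plane => ((Real.log (‖x - y‖ / r) : ℝ) : ℂ) := by fun_prop
  have hquot : MemLp (fun y => ((Real.log (‖x - y‖ / r) : ℝ) : ℂ)) 2 (volume.restrict S) :=
    ⟨hmeas.aestronglyMeasurable, hbound.trans_lt ENNReal.ofReal_lt_top⟩
  have : IsFiniteMeasure (volume.restrict S) := ⟨by simpa using hS.measure_lt_top⟩
  refine (hquot.add (memLp_const ((Real.log r : ℝ) : ℂ))).ae_eq ?_
  filter_upwards [ae_restrict_of_ae (Measure.ae_ne volume x)] with y hy
  rw [Pi.add_apply, Real.log_div (norm_ne_zero_iff.2 (sub_ne_zero.2 hy.symm)) hr.ne',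
    Complex.ofReal_sub, sub_add_cancel]

end LogIntegrals

section Realization

/-- The operators `Op κ S` are the integral operators with the convolution kernels
`p.kernel κ`. -/
def Realizes (p : KernelTail) (Op : ℂ → Set Plane → (Plane → ℂ) → Plane → ℂ) : Prop :=
  ∀ κ ∈ Complex.slitPlane, ∀ S : Set Plane, Bornology.IsBounded S → MeasurableSet S →
    ∀ u : Plane → ℂ, MemLp u 2 (volume.restrict S) →
      ∀ x, Op κ S u x = ∫ y in S, p.kernel κ (x - y) * u y

lemma realizes_opK : Realizes greenTail opK := by
  intro κ hκ S _ _ u _ x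
  rw [opK, ← integral_neg]
  refine integral_congr_ae ?_
  filter_upwards [ae_restrict_of_ae (Measure.ae_ne volume x)] with y hy
  rw [← neg_mul, neg_green_eq hκ (sub_ne_zero.2 hy.symm)]

lemma integrable_dist_sq_mul {S : Set Plane} (hS : Bornology.IsBounded S) (hSm : MeasurableSet S)
    {u : Plane → ℂ} (hu : Integrable u (volume.restrict S)) (c : ℝ) (x : Plane) :
    Integrable (fun y => ((c * ‖x - y‖ ^ 2 : ℝ) : ℂ) * u y) (volume.restrict S) := by
  obtain ⟨r, hr⟩ := hS.subset_ball x
  have hcont : Continuous fun y : Plane => ((c * ‖x - y‖ ^ 2 : ℝ) : ℂ) := by fun_prop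
  refine hu.bdd_mul (c := ‖c‖ * r ^ 2) hcont.aestronglyMeasurable ?_
  filter_upwards [ae_restrict_mem hSm] with y hy
  have hxy := Metric.mem_ball'.1 (hr hy)
  rw [dist_eq_norm] at hxy
  rw [Complex.norm_real, norm_mul, norm_pow, norm_norm]
  gcongr

lemma realizes_opM : Realizes expandedTail opM := by
  intro κ _ S hS hSm u hu x
  have : IsFiniteMeasure (volume.restrict S) := ⟨by simpa using hS.measure_lt_top⟩
  have hconst : Integrable u (volume.restrict S) := hu.integrable (by norm_num)
  have hlog : Integrable (fun y => ((-(1 / (2 * Real.pi)) * Real.log ‖x - y‖ : ℝ) : ℂ) * u y)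
      (volume.restrict S) := by
    refine (((memLp_log_dist hS x).integrable_mul hu).const_mul
      ((-(1 / (2 * Real.pi)) : ℝ) : ℂ)).congr (.of_forall fun y => ?_)
    simp only [Pi.mul_apply, Complex.ofReal_mul, mul_assoc]
  have hsq := integrable_dist_sq_mul hS hSm hconst (1 / (8 * Real.pi)) x
  simp only [opM, opHat, opZero, opOne, KernelTail.kernel, KernelTail.regular, KernelTail.tail,
    expandedTail, mul_zero, add_zero]
  rw [← integral_const_mul, ← integral_const_mul, ← integral_add (hconst.const_mul _) hlog,
    ← integral_add ((hconst.const_mul _).fun_add hlog) (hsq.const_mul _)]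
  refine integral_congr_ae (.of_forall fun y => ?_)
  simp only
  ring

end Realization

/-! ### Leading-order operators of dilute configurations -/

section Geometry

variable {N : ℕ} {c d R : ℝ} {D : Fin N → Set Plane}

lemma diam_le_two_mul_sizeParam (D : Fin N → Set Plane) (i : Fin N) :
    Metric.diam (D i) ≤ 2 * sizeParam D := by
  have := le_ciSup (Finite.bddAbove_range fun i => Metric.diam (D i)) i
  rw [sizeParam]
  linarith

/-- The square root of the area of the `i`-th particle, relative to the size parameter. -/
def relSize (D : Fin N → Set Plane) (i : Fin N) : ℝ :=
  √((volume.restrict (D i)).real univ) / sizeParam D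

namespace IsDilute

lemma isBounded (hD : IsDilute c d R D) (i : Fin N) : Bornology.IsBounded (D i) :=
  Metric.isBounded_ball.subset (hD.bounded i)

lemma isFiniteMeasure (hD : IsDilute c d R D) (i : Fin N) :
    IsFiniteMeasure (volume.restrict (D i)) :=
  ⟨by simpa using (hD.isBounded i).measure_lt_top⟩

lemma subset_ball (hD : IsDilute c d R D) (hρ : 0 < sizeParam D) {i : Fin N} {x : Plane}
    (hx : x ∈ D i) : D i ⊆ Metric.ball x (3 * sizeParam D) := by
  intro y hy
  have hdist := Metric.dist_le_diam_of_mem (hD.isBounded i) hy hx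
  have hdiam := diam_le_two_mul_sizeParam D i
  rw [Metric.mem_ball]
  linarith

lemma norm_sub_le_two_mul (hD : IsDilute c d R D) {i j : Fin N} {x y : Plane} (hx : x ∈ D i)
    (hy : y ∈ D j) : ‖x - y‖ ≤ 2 * R := by
  have hxR := mem_ball_zero_iff.1 (hD.bounded i hx)
  have hyR := mem_ball_zero_iff.1 (hD.bounded j hy)
  linarith [norm_sub_le x y]

lemma ae_ae_of_forall_mem {P : Plane → Plane → Prop} (hD : IsDilute c d R D) {i j : Fin N}
    (h : ∀ x ∈ D i, ∀ y ∈ D j, P x y) :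
    ∀ᵐ x ∂(volume.restrict (D i)), ∀ᵐ y ∂(volume.restrict (D j)), P x y := by
  filter_upwards [ae_restrict_mem (hD.isOpen i).measurableSet] with x hx
  filter_upwards [ae_restrict_mem (hD.isOpen j).measurableSet] with y hy
  exact h x hx y hy

lemma le_area (hD : IsDilute c d R D) (i : Fin N) :
    c * sizeParam D ^ 2 ≤ (volume.restrict (D i)).real univ := by
  simpa [measureReal_def] using hD.area i

lemma area_pos (hD : IsDilute c d R D) (hc : 0 < c) (hρ : 0 < sizeParam D) (i : Fin N) :
    0 < (volume.restrict (D i)).real univ :=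
  (by positivity : 0 < c * sizeParam D ^ 2).trans_le (hD.le_area i)

lemma sqrt_area_le (hD : IsDilute c d R D) (hρ : 0 < sizeParam D) (i : Fin N) :
    √((volume.restrict (D i)).real univ) ≤ 6 * sizeParam D := by
  rw [Real.sqrt_le_left (by positivity), measureReal_restrict_apply_univ]
  rcases (D i).eq_empty_or_nonempty with h | ⟨x, hx⟩
  · rw [h, measureReal_empty]
    positivity
  calc volume.real (D i)
    _ ≤ volume.real (Metric.ball x (3 * sizeParam D)) :=
      measureReal_mono (hD.subset_ball hρ hx) measure_ball_lt_top.ne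
    _ = (3 * sizeParam D) ^ 2 * Real.pi := by
      rw [measureReal_def, EuclideanSpace.volume_ball_fin_two, ENNReal.toReal_mul,
        ENNReal.toReal_pow, ENNReal.toReal_ofReal (by positivity),
        ENNReal.toReal_ofReal Real.pi_pos.le]
    _ ≤ (3 * sizeParam D) ^ 2 * 4 := by gcongr; exact Real.pi_le_four
    _ = (6 * sizeParam D) ^ 2 := by ring

lemma relSize_le (hD : IsDilute c d R D) (hρ : 0 < sizeParam D) (i : Fin N) :
    relSize D i ≤ 6 := by
  rw [relSize, div_le_iff₀ hρ]
  exact hD.sqrt_area_le hρ i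

lemma le_relSize (hD : IsDilute c d R D) (hρ : 0 < sizeParam D) (i : Fin N) :
    √c ≤ relSize D i := by
  rw [relSize, le_div_iff₀ hρ, ← Real.sqrt_sq hρ.le, ← Real.sqrt_mul' c (sq_nonneg _)]
  exact Real.sqrt_le_sqrt (hD.le_area i)

lemma two_mul_le_norm_leadingMatrix_self (hD : IsDilute c d R D)
    (hρ : 0 < sizeParam D) (i : Fin N) : 2 * c ≤ ‖leadingMatrix (relSize D) i i‖ := by
  rw [leadingMatrix_apply_self, Complex.norm_real, Real.norm_of_nonneg (by positivity)]
  linarith [(Real.sqrt_le_iff.1 (hD.le_relSize hρ i)).2]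

end IsDilute

end Geometry

section Operators

variable {N : ℕ} {D : Fin N → Set Plane} {c d R : ℝ}

lemma exists_bound_regular (p : KernelTail) (κ : ℂ) (r : ℝ) :
    ∃ M, 0 ≤ M ∧ ∀ w : Plane, ‖w‖ ≤ r → ‖p.regular κ w‖ ≤ M := by
  obtain ⟨M, hM⟩ := (isCompact_closedBall (0 : Plane) r).exists_bound_of_continuousOn
    (p.continuous_regular κ).continuousOn
  exact ⟨|M|, abs_nonneg _, fun w hw => (hM w (by simpa using hw)).trans (le_abs_self _)⟩

lemma aestronglyMeasurable_regular_sub (p : KernelTail) (κ : ℂ) (μ : Measure Plane) (x : Plane) :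
    AEStronglyMeasurable (fun y => p.regular κ (x - y)) μ :=
  ((p.continuous_regular κ).comp (by fun_prop)).aestronglyMeasurable

lemma norm_neg_one_div_two_pi_mul_le (z : ℂ) :
    ‖((-(1 / (2 * Real.pi)) : ℝ) : ℂ) * z‖ ≤ ‖z‖ := by
  rw [norm_mul, Complex.norm_real, norm_neg, Real.norm_of_nonneg (by positivity)]
  refine mul_le_of_le_one_left (norm_nonneg _) ((div_le_one (by positivity)).2 ?_)
  linarith [Real.pi_gt_three]

namespace IsDilute

lemma sliceBound_kernel_sub (hD : IsDilute c d R D) (p : KernelTail) (κ : ℂ) {i j : Fin N} {s : ℝ}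
    (hs : 0 < s) (hball : ∀ x ∈ D i, D j ⊆ Metric.ball x (3 * s)) {b : ℂ} {M : ℝ} (hM0 : 0 ≤ M)
    (hM : ∀ x ∈ D i, ∀ y ∈ D j,
      ‖((-(1 / (2 * Real.pi)) * Real.log s : ℝ) : ℂ) + p.regular κ (x - y) - b‖ ≤ M) :
    SliceBound (fun x y => p.kernel κ (x - y) - b) (volume.restrict (D j)) (volume.restrict (D i))
      (s * logConst + √((volume.restrict (D j)).real univ) * M) := by
  have := hD.isFiniteMeasure j
  have hreg : SliceBound (fun x y => ((-(1 / (2 * Real.pi)) * Real.log s : ℝ) : ℂ) +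
      p.regular κ (x - y) - b) (volume.restrict (D j)) (volume.restrict (D i))
      (√((volume.restrict (D j)).real univ) * M) :=
    .of_bound (fun x => (aestronglyMeasurable_const.add
      (aestronglyMeasurable_regular_sub p κ _ x)).sub aestronglyMeasurable_const)
      (hD.ae_ae_of_forall_mem hM)
  have hlog : SliceBound (fun x y => ((-(1 / (2 * Real.pi)) : ℝ) : ℂ) *
      ((Real.log (‖x - y‖ / s) : ℝ) : ℂ)) (volume.restrict (D j)) (volume.restrict (D i))
      (s * logConst) := by
    filter_upwards [ae_restrict_mem (hD.isOpen i).measurableSet] with x hx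
    have hmeas : Measurable fun y : Plane => ((Real.log (‖x - y‖ / s) : ℝ) : ℂ) := by fun_prop
    exact ⟨(hmeas.const_mul _).aestronglyMeasurable,
      (eLpNorm_mono fun y => norm_neg_one_div_two_pi_mul_le _).trans
        (eLpNorm_log_dist_le hs (hball x hx))⟩
  refine (hlog.add (mul_nonneg hs.le ENNReal.toReal_nonneg) (by positivity) hreg).congr
    fun x => ?_
  filter_upwards [ae_restrict_of_ae (Measure.ae_ne volume x)] with y hy
  rw [KernelTail.kernel, Real.log_div (norm_ne_zero_iff.2 (sub_ne_zero.2 hy.symm)) hs.ne']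
  push_cast
  ring

lemma exists_sliceBound (hD : IsDilute c d R D) (p : KernelTail) (κ : ℂ) (i j : Fin N) :
    ∃ m, 0 ≤ m ∧ SliceBound (fun x y => p.kernel κ (x - y))
      (volume.restrict (D j)) (volume.restrict (D i)) m := by
  obtain ⟨M, hM0, hM⟩ := exists_bound_regular p κ (2 * R)
  have hs : 0 < |R| + 1 := by positivity
  have hball (x) (hx : x ∈ D i) : D j ⊆ Metric.ball x (3 * (|R| + 1)) := fun y hy => by
    rw [mem_ball_iff_norm']
    linarith [hD.norm_sub_le_two_mul hx hy, le_abs_self R, abs_nonneg R]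
  have h := hD.sliceBound_kernel_sub p κ hs hball (b := 0)
    (M := ‖((-(1 / (2 * Real.pi)) * Real.log (|R| + 1) : ℝ) : ℂ)‖ + M) (by positivity)
    fun x hx y hy => by
      rw [sub_zero]
      exact norm_add_le_of_le le_rfl (hM _ (hD.norm_sub_le_two_mul hx hy))
  simp only [sub_zero] at h
  exact ⟨_, add_nonneg (mul_nonneg hs.le ENNReal.toReal_nonneg) (by positivity), h⟩

end IsDilute

/-- The integral operator with kernel `k`, if there is one. -/
def kernelOperator (k : Plane → Plane → ℂ) (μ ν : Measure Plane) :
    Lp ℂ 2 μ →L[ℂ] Lp ℂ 2 ν :=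
  Classical.epsilon (IsKernelOperator k)

/-- The integral operator with convolution kernel `p.kernel κ` from the `j`-th to the `i`-th
particle. -/
def pairOperator (p : KernelTail) (D : Fin N → Set Plane) (κ : ℂ) (i j : Fin N) :
    Lp ℂ 2 (volume.restrict (D j)) →L[ℂ] Lp ℂ 2 (volume.restrict (D i)) :=
  kernelOperator (fun x y => p.kernel κ (x - y)) (volume.restrict (D j)) (volume.restrict (D i))

namespace IsDilute

lemma isKernelOperator (hD : IsDilute c d R D) (p : KernelTail) (κ : ℂ) (i j : Fin N) :
    IsKernelOperator (fun x y => p.kernel κ (x - y)) (pairOperator p D κ i j) := by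
  have := hD.isFiniteMeasure i
  have := hD.isFiniteMeasure j
  obtain ⟨m, hm0, hm⟩ := hD.exists_sliceBound p κ i j
  exact Classical.epsilon_spec (exists_isKernelOperator (p.stronglyMeasurable_kernel κ) hm0 hm)

lemma norm_pairOperator_sub_le (hD : IsDilute c d R D) (p : KernelTail) {κ κ' : ℂ} {i j : Fin N}
    {ε : ℝ} (hε : 0 ≤ ε)
    (h : ∀ w : Plane, ‖w‖ ≤ 2 * R → ‖p.regular κ w - p.regular κ' w‖ ≤ ε) :
    ‖pairOperator p D κ i j - pairOperator p D κ' i j‖ ≤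
      √((volume.restrict (D i)).real univ) * (√((volume.restrict (D j)).real univ) * ε) := by
  have := hD.isFiniteMeasure i
  have := hD.isFiniteMeasure j
  obtain ⟨m, -, hm⟩ := hD.exists_sliceBound p κ i j
  obtain ⟨m', -, hm'⟩ := hD.exists_sliceBound p κ' i j
  have hop := IsKernelOperator.sub hm hm' (hD.isKernelOperator p κ i j)
    (hD.isKernelOperator p κ' i j)
  refine hop.norm_le (by positivity) ?_
  simp only [KernelTail.kernel, add_sub_add_left_eq_sub]
  exact .of_bound (fun x => (aestronglyMeasurable_regular_sub p κ _ x).sub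
    (aestronglyMeasurable_regular_sub p κ' _ x))
    (hD.ae_ae_of_forall_mem fun x hx y hy => h _ (hD.norm_sub_le_two_mul hx hy))

lemma continuousOn_pairOperator (hD : IsDilute c d R D) (p : KernelTail) (i j : Fin N) :
    ContinuousOn (fun κ => pairOperator p D κ i j) Complex.slitPlane := by
  intro κ hκ
  refine Metric.tendsto_nhds.2 fun ε hε => ?_
  set A : ℝ := √((volume.restrict (D i)).real univ) * √((volume.restrict (D j)).real univ)
  have : 0 ≤ A := by positivity
  have hent : {q : ℂ × ℂ | dist q.1 q.2 < ε / (A + 1)} ∈ uniformity ℂ :=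
    Metric.dist_mem_uniformity (by positivity)
  obtain ⟨v, hv, hvq⟩ := (isCompact_closedBall (0 : Plane) (2 * R)).mem_uniformity_of_prod
    (f := fun κ w => p.regular κ w) (s := Complex.slitPlane)
    (p.continuousOn_regular.mono (prod_mono le_rfl (subset_univ _))) hκ hent
  filter_upwards [hv] with κ' hκ'
  have hnorm := hD.norm_pairOperator_sub_le p (i := i) (j := j) (ε := ε / (A + 1))
    (by positivity) fun w hw => (dist_eq_norm (p.regular κ' w) (p.regular κ w)).symm.trans_le
      (hvq κ' hκ' w (by simpa using hw)).le
  rw [dist_eq_norm]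
  refine hnorm.trans_lt ?_
  rw [← mul_assoc, mul_div_assoc', div_lt_iff₀ (by positivity)]
  linarith [mul_comm A ε]

end IsDilute

/-- The order of magnitude `|log ρ| ρ² / 2π` of the operators, for `ρ < 1`. -/
def operatorScale (D : Fin N → Set Plane) : ℝ :=
  -Real.log (sizeParam D) * sizeParam D ^ 2 / (2 * Real.pi)

/-- The leading-order value of the kernel between the `j`-th and the `i`-th particle. The two
logarithms `log κ` and `log |x - y|` contribute equally for `i = j`, and only the first one is
large for `i ≠ j`. -/
def leadingKernel (D : Fin N → Set Plane) (i j : Fin N) : ℝ :=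
  (if i = j then 2 else 1) * (-Real.log (sizeParam D) / (2 * Real.pi))

lemma operatorScale_pos (hρ : 0 < sizeParam D) (hρ1 : sizeParam D < 1) : 0 < operatorScale D := by
  have : 0 < -Real.log (sizeParam D) := neg_pos.2 (Real.log_neg hρ hρ1)
  rw [operatorScale]
  positivity

lemma operatorScale_mul_leadingMatrix (hρ : 0 < sizeParam D) (i j : Fin N) :
    (operatorScale D : ℂ) * leadingMatrix (relSize D) i j =
      leadingKernel D i j * (√((volume.restrict (D i)).real univ) *
        √((volume.restrict (D j)).real univ)) := by
  have : (sizeParam D : ℂ) ≠ 0 := by exact_mod_cast hρ.ne'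
  simp only [leadingMatrix, Matrix.of_apply, relSize, operatorScale, leadingKernel]
  push_cast
  field_simp

namespace IsDilute

lemma sliceBound_kernel_sub_leadingKernel_self (hD : IsDilute c d R D) (hρ : 0 < sizeParam D)
    (p : KernelTail) {κ : ℂ} {L : ℝ} (hL : ‖logGammaHat κ - Real.log (sizeParam D)‖ ≤ L)
    (ht : ∀ w : Plane, ‖w‖ ≤ 2 * R → ‖p.tail κ w‖ ≤ 1) (i : Fin N) :
    SliceBound (fun x y => p.kernel κ (x - y) - (leadingKernel D i i : ℂ))
      (volume.restrict (D i)) (volume.restrict (D i))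
      (sizeParam D * logConst + √((volume.restrict (D i)).real univ) * (L + 1)) := by
  have hL0 : 0 ≤ L := (norm_nonneg _).trans hL
  refine hD.sliceBound_kernel_sub p κ hρ (fun x hx => hD.subset_ball hρ hx) (by positivity)
    fun x hx y hy => ?_
  have hsplit : ((-(1 / (2 * Real.pi)) * Real.log (sizeParam D) : ℝ) : ℂ) +
      p.regular κ (x - y) - (leadingKernel D i i : ℂ) = ((-(1 / (2 * Real.pi)) : ℝ) : ℂ) *
        (logGammaHat κ - Real.log (sizeParam D)) + p.tail κ (x - y) := by
    simp only [leadingKernel, KernelTail.regular, if_true]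
    push_cast
    field_simp
    ring
  rw [hsplit]
  exact norm_add_le_of_le ((norm_neg_one_div_two_pi_mul_le _).trans hL)
    (ht _ (hD.norm_sub_le_two_mul hx hy))

lemma abs_log_norm_sub_le (hD : IsDilute c d R D) (hd : 0 < d) {i j : Fin N} (hij : i ≠ j)
    {x y : Plane} (hx : x ∈ D i) (hy : y ∈ D j) :
    |Real.log ‖x - y‖| ≤ |Real.log d| + |Real.log (2 * R)| := by
  have hdxy : d ≤ ‖x - y‖ := by
    rw [← dist_eq_norm]
    exact hD.separated i j hij x hx y hy
  exact (abs_le_max_abs_abs (Real.log_le_log hd hdxy)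
    (Real.log_le_log (hd.trans_le hdxy) (hD.norm_sub_le_two_mul hx hy))).trans
      (max_le_add_of_nonneg (abs_nonneg _) (abs_nonneg _))

lemma sliceBound_kernel_sub_leadingKernel_of_ne (hD : IsDilute c d R D) (hd : 0 < d)
    (p : KernelTail) {κ : ℂ} {L : ℝ} (hL : ‖logGammaHat κ - Real.log (sizeParam D)‖ ≤ L)
    (ht : ∀ w : Plane, ‖w‖ ≤ 2 * R → ‖p.tail κ w‖ ≤ 1) {i j : Fin N} (hij : i ≠ j) :
    SliceBound (fun x y => p.kernel κ (x - y) - (leadingKernel D i j : ℂ))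
      (volume.restrict (D j)) (volume.restrict (D i))
      (√((volume.restrict (D j)).real univ) *
        (|Real.log d| + |Real.log (2 * R)| + L + 1)) := by
  have := hD.isFiniteMeasure j
  refine .of_bound (fun x => ?_) (hD.ae_ae_of_forall_mem fun x hx y hy => ?_)
  · exact ((p.stronglyMeasurable_kernel κ).measurable.comp
      (measurable_const.prodMk measurable_id)).aestronglyMeasurable.sub aestronglyMeasurable_const
  have hsplit : p.kernel κ (x - y) - (leadingKernel D i j : ℂ) =
      ((-(1 / (2 * Real.pi)) : ℝ) : ℂ) * ((Real.log ‖x - y‖ : ℝ) +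
        (logGammaHat κ - Real.log (sizeParam D))) + p.tail κ (x - y) := by
    simp only [leadingKernel, KernelTail.kernel, KernelTail.regular, if_neg hij]
    push_cast
    field_simp
    ring
  have hlog : ‖((Real.log ‖x - y‖ : ℝ) : ℂ)‖ ≤ |Real.log d| + |Real.log (2 * R)| := by
    rw [Complex.norm_real]
    exact hD.abs_log_norm_sub_le hd hij hx hy
  rw [hsplit]
  exact norm_add_le_of_le
    ((norm_neg_one_div_two_pi_mul_le _).trans (norm_add_le_of_le hlog hL))
    (ht _ (hD.norm_sub_le_two_mul hx hy))

lemma sliceBound_kernel_sub_leadingKernel (hD : IsDilute c d R D) (hd : 0 < d)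
    (hρ : 0 < sizeParam D) (p : KernelTail) {κ : ℂ} {L : ℝ}
    (hL : ‖logGammaHat κ - Real.log (sizeParam D)‖ ≤ L)
    (ht : ∀ w : Plane, ‖w‖ ≤ 2 * R → ‖p.tail κ w‖ ≤ 1) (i j : Fin N) :
    SliceBound (fun x y => p.kernel κ (x - y) - (leadingKernel D i j : ℂ))
      (volume.restrict (D j)) (volume.restrict (D i))
      (sizeParam D * logConst + √((volume.restrict (D j)).real univ) *
        (|Real.log d| + |Real.log (2 * R)| + L + 1)) := by
  rcases eq_or_ne i j with rfl | hij
  · refine (hD.sliceBound_kernel_sub_leadingKernel_self hρ p hL ht i).mono ?_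
    gcongr
    exact le_add_of_nonneg_left (by positivity)
  · exact (hD.sliceBound_kernel_sub_leadingKernel_of_ne hd p hL ht hij).mono
      (le_add_of_nonneg_left (mul_nonneg hρ.le ENNReal.toReal_nonneg))

end IsDilute

variable [∀ i, IsFiniteMeasure (volume.restrict (D i))]

variable (D) in
/-- The normalised constants on the particles. -/
def constVectors (i : Fin N) : Lp ℂ 2 (volume.restrict (D i)) :=
  constVector ℂ (volume.restrict (D i))

variable (D) in
/-- The rank one operator of the leading-order kernel from the `j`-th to the `i`-th particle, in
units of `operatorScale D`. -/
def leadingOperator (i j : Fin N) :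
    Lp ℂ 2 (volume.restrict (D j)) →L[ℂ] Lp ℂ 2 (volume.restrict (D i)) :=
  leadingMatrix (relSize D) i j • InnerProductSpace.rankOne ℂ (constVectors D i) (constVectors D j)

variable (D) in
/-- What is left of the operator from the `j`-th to the `i`-th particle, in units of
`operatorScale D`, after subtracting `leadingOperator D i j`. -/
def remainderOperator (p : KernelTail) (κ : ℂ) (i j : Fin N) :
    Lp ℂ 2 (volume.restrict (D j)) →L[ℂ] Lp ℂ 2 (volume.restrict (D i)) :=
  (operatorScale D : ℂ)⁻¹ • pairOperator p D κ i j - leadingOperator D i j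

lemma blockMap_remainderOperator (p : KernelTail) (κ : ℂ) (i j : Fin N) :
    blockMap (constVectors D) (leadingMatrix (relSize D)) (remainderOperator D p κ) i j =
      (operatorScale D : ℂ)⁻¹ • pairOperator p D κ i j :=
  add_sub_cancel (leadingOperator D i j) _

lemma operatorScale_smul_remainderOperator (hs : operatorScale D ≠ 0)
    (p : KernelTail) (κ : ℂ) (i j : Fin N) :
    (operatorScale D : ℂ) • remainderOperator D p κ i j =
      pairOperator p D κ i j - (operatorScale D : ℂ) • leadingOperator D i j := by
  have hs' : (operatorScale D : ℂ) ≠ 0 := by exact_mod_cast hs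
  rw [remainderOperator, smul_sub, smul_inv_smul₀ hs']

lemma operatorScale_smul_leadingOperator (hρ : 0 < sizeParam D) (i j : Fin N) :
    (operatorScale D : ℂ) • leadingOperator D i j = ((leadingKernel D i j : ℂ) *
      (√((volume.restrict (D i)).real univ) * √((volume.restrict (D j)).real univ))) •
        InnerProductSpace.rankOne ℂ (constVectors D i) (constVectors D j) :=
  (smul_smul _ _ _).trans (congrArg
    (· • InnerProductSpace.rankOne ℂ (constVectors D i) (constVectors D j))
    (operatorScale_mul_leadingMatrix hρ i j))

namespace IsDilute

lemma isKernelOperator_leadingOperator (hD : IsDilute c d R D) (hc : 0 < c)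
    (hρ : 0 < sizeParam D) (i j : Fin N) :
    IsKernelOperator (fun _ _ => (leadingKernel D i j : ℂ))
      ((operatorScale D : ℂ) • leadingOperator D i j) := by
  rw [operatorScale_smul_leadingOperator hρ]
  exact isKernelOperator_const (hD.area_pos hc hρ j) (hD.area_pos hc hρ i) _

lemma norm_operatorScale_smul_remainderOperator_le (hD : IsDilute c d R D) (hc : 0 < c)
    (hd : 0 < d) (hρ : 0 < sizeParam D) (hs : operatorScale D ≠ 0) (p : KernelTail) {κ : ℂ} {L : ℝ}
    (hL : ‖logGammaHat κ - Real.log (sizeParam D)‖ ≤ L)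
    (ht : ∀ w : Plane, ‖w‖ ≤ 2 * R → ‖p.tail κ w‖ ≤ 1) (i j : Fin N) :
    ‖(operatorScale D : ℂ) • remainderOperator D p κ i j‖ ≤
      6 * sizeParam D * (sizeParam D * logConst + 6 * sizeParam D *
        (|Real.log d| + |Real.log (2 * R)| + L + 1)) := by
  have hL0 : 0 ≤ L := (norm_nonneg _).trans hL
  have hlog0 : 0 ≤ logConst := ENNReal.toReal_nonneg
  obtain ⟨m, -, hm⟩ := hD.exists_sliceBound p κ i j
  have hconst : SliceBound (fun _ _ => (leadingKernel D i j : ℂ)) (volume.restrict (D j))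
      (volume.restrict (D i)) (√((volume.restrict (D j)).real univ) * _) :=
    .of_bound (fun _ => aestronglyMeasurable_const) (.of_forall fun _ => .of_forall fun _ => le_rfl)
  have hop := IsKernelOperator.sub hm hconst (hD.isKernelOperator p κ i j)
    (hD.isKernelOperator_leadingOperator hc hρ i j)
  rw [operatorScale_smul_remainderOperator hs]
  refine (hop.norm_le (by positivity)
    (hD.sliceBound_kernel_sub_leadingKernel hd hρ p hL ht i j)).trans ?_
  gcongr
  · exact hD.sqrt_area_le hρ i
  · exact hD.sqrt_area_le hρ j

lemma norm_remainderOperator_le (hD : IsDilute c d R D) (hc : 0 < c) (hd : 0 < d)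
    (hρ : 0 < sizeParam D) (hρ1 : sizeParam D < 1) (p : KernelTail) {κ : ℂ} {L : ℝ}
    (hL : ‖logGammaHat κ - Real.log (sizeParam D)‖ ≤ L)
    (ht : ∀ w : Plane, ‖w‖ ≤ 2 * R → ‖p.tail κ w‖ ≤ 1) (i j : Fin N) :
    ‖remainderOperator D p κ i j‖ ≤ 12 * Real.pi * (logConst + 6 *
      (|Real.log d| + |Real.log (2 * R)| + L + 1)) / -Real.log (sizeParam D) := by
  have hlog : 0 < -Real.log (sizeParam D) := neg_pos.2 (Real.log_neg hρ hρ1)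
  have hs := operatorScale_pos hρ hρ1
  have hbound := hD.norm_operatorScale_smul_remainderOperator_le hc hd hρ hs.ne' p hL ht i j
  rw [norm_smul, Complex.norm_real, Real.norm_of_nonneg hs.le, ← le_div_iff₀' hs] at hbound
  refine hbound.trans_eq ?_
  rw [operatorScale]
  have := hlog.ne'
  field_simp
  ring

lemma continuousOn_remainderOperator (hD : IsDilute c d R D) (p : KernelTail) (i j : Fin N) :
    ContinuousOn (fun κ => remainderOperator D p κ i j) Complex.slitPlane :=
  ((continuous_const_smul _).comp_continuousOn (hD.continuousOn_pairOperator p i j)).sub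
    continuousOn_const

end IsDilute

end Operators

/-! ### Principal eigenpairs -/

section DominantEigenpairs

section Normed

variable {𝕜 H : Type*} [NontriviallyNormedField 𝕜] [NormedAddCommGroup H] [NormedSpace 𝕜 H]
  {T : H →L[𝕜] H} {μ : 𝕜} {Φ : H}

/-- `Φ` is a unit eigenvector of `T`, and its eigenvalue `μ` has the largest modulus among the
eigenvalues; the notion of `IsPrincipalEigenpair` for an abstract operator. -/
structure IsDominantEigenpair (T : H →L[𝕜] H) (μ : 𝕜) (Φ : H) : Prop where
  norm_eq_one : ‖Φ‖ = 1
  apply_eq : T Φ = μ • Φ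
  norm_le : ∀ (μ' : 𝕜) (Ψ : H), Ψ ≠ 0 → T Ψ = μ' • Ψ → ‖μ'‖ ≤ ‖μ‖

lemma IsDominantEigenpair.ne_zero (h : IsDominantEigenpair T μ Φ) : Φ ≠ 0 :=
  norm_ne_zero_iff.1 (h.norm_eq_one.trans_ne one_ne_zero)

lemma IsDominantEigenpair.smul {c : 𝕜} (hc : c ≠ 0) (h : IsDominantEigenpair T μ Φ) :
    IsDominantEigenpair (c • T) (c * μ) Φ where
  norm_eq_one := h.norm_eq_one
  apply_eq := by rw [smul_apply, h.apply_eq, smul_smul]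
  norm_le μ' Ψ hΨ hμ' := by
    have heig : T Ψ = (c⁻¹ * μ') • Ψ := by
      rw [mul_smul, ← hμ', smul_apply, inv_smul_smul₀ hc]
    calc ‖μ'‖ = ‖c‖ * ‖c⁻¹ * μ'‖ := by rw [← norm_mul, mul_inv_cancel_left₀ hc]
      _ ≤ ‖c * μ‖ := by
        rw [norm_mul c μ]
        gcongr
        exact h.norm_le _ Ψ hΨ heig

lemma isDominantEigenpair_inv_smul_iff {c : 𝕜} (hc : c ≠ 0) :
    IsDominantEigenpair (c⁻¹ • T) (c⁻¹ * μ) Φ ↔ IsDominantEigenpair T μ Φ :=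
  ⟨fun h => by simpa only [smul_inv_smul₀ hc, mul_inv_cancel_left₀ hc] using h.smul hc,
    fun h => h.smul (inv_ne_zero hc)⟩

end Normed

variable {ι : Type*} {H : ι → Type*} [∀ i, NormedAddCommGroup (H i)]
  [∀ i, InnerProductSpace ℂ (H i)] [∀ i, CompleteSpace (H i)] {e : ∀ i, H i} {A : Matrix ι ι ℂ}
  {S : ∀ i j, H j →L[ℂ] H i}

lemma isDominantEigenpair_blockMap_iff (he : ∀ i, ‖e i‖ = 1)
    (hs : ∀ i, ‖scaledRemainder A S i‖ ≤ 1 / 16) {i : ι} (hA : A i i ≠ 0) {μ : ℂ} {Φ : H i} :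
    IsDominantEigenpair (blockMap e A S i i) μ Φ ↔
      μ = blockValue e A S i ∧ ∃ a : ℂ, ‖a‖ = 1 ∧ Φ = a • unitVector e A S i := by
  have hV : ‖unitVector e A S i‖ = 1 := norm_unitVector he hs i
  have hTV := blockMap_unitVector he hs hA
  have hlow := le_norm_blockValue he hs i
  constructor
  · intro h
    have hμ := h.norm_le _ _ (norm_ne_zero_iff.1 (hV.trans_ne one_ne_zero)) hTV
    obtain ⟨rfl, a, rfl⟩ :=
      eq_blockValue_of_eigenvector he hs hA (hlow.trans hμ) h.ne_zero h.apply_eq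
    refine ⟨rfl, a, ?_, rfl⟩
    simpa only [norm_smul, hV, mul_one] using h.norm_eq_one
  · rintro ⟨rfl, a, ha, rfl⟩
    refine ⟨by rw [norm_smul, ha, hV, mul_one], by rw [map_smul, hTV, smul_comm], ?_⟩
    intro μ' Ψ hΨ hμ'
    by_contra! hlt
    obtain ⟨rfl, -⟩ := eq_blockValue_of_eigenvector he hs hA (hlow.trans hlt.le) hΨ hμ'
    exact hlt.false

end DominantEigenpairs

section SquareIntegrable

variable {S : Set Plane} {f g : Plane → ℂ}

lemma toLp_eq_iff (hf : MemLp f 2 (volume.restrict S)) {u : Lp ℂ 2 (volume.restrict S)} :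
    hf.toLp f = u ↔ f =ᵐ[volume.restrict S] u := by
  rw [Lp.ext_iff]
  exact ⟨fun h => hf.coeFn_toLp.symm.trans h, fun h => hf.coeFn_toLp.trans h⟩

lemma toLp_eq_zero_iff (hf : MemLp f 2 (volume.restrict S)) :
    hf.toLp f = 0 ↔ f =ᵐ[volume.restrict S] 0 := by
  rw [← MemLp.toLp_zero (MemLp.zero (ε := ℂ)), MemLp.toLp_eq_toLp_iff]

lemma pairing_toLp (hf : MemLp f 2 (volume.restrict S)) (hg : MemLp g 2 (volume.restrict S)) :
    pairing S f g = inner ℂ (hg.toLp g) (hf.toLp f) := by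
  rw [L2.inner_def, pairing]
  refine integral_congr_ae ?_
  filter_upwards [hf.coeFn_toLp, hg.coeFn_toLp] with x hfx hgx
  rw [hfx, hgx, RCLike.inner_apply]

lemma pairing_self_eq_one_iff (hf : MemLp f 2 (volume.restrict S)) :
    pairing S f f = 1 ↔ ‖hf.toLp f‖ = 1 := by
  rw [pairing_toLp hf hf, inner_self_eq_norm_sq_to_K, ← RCLike.ofReal_pow,
    ← pow_eq_one_iff_of_nonneg (norm_nonneg (hf.toLp f)) two_ne_zero]
  exact Complex.ofReal_eq_one

end SquareIntegrable

section Translation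

variable {N : ℕ} {D : Fin N → Set Plane} {c d R : ℝ} {p : KernelTail}
  {Op : ℂ → Set Plane → (Plane → ℂ) → Plane → ℂ} {κ : ℂ}

lemma pairOperator_toLp_ae_eq (hOp : Realizes p Op) (hκ : κ ∈ Complex.slitPlane)
    (hD : IsDilute c d R D) (i j : Fin N) {u : Plane → ℂ} (hu : MemLp u 2 (volume.restrict (D j))) :
    pairOperator p D κ i j (hu.toLp u) =ᵐ[volume.restrict (D i)] Op κ (D j) u := by
  filter_upwards [hD.isKernelOperator p κ i j (hu.toLp u)] with x hx
  rw [hx, hOp κ hκ (D j) (hD.isBounded j) (hD.isOpen j).measurableSet u hu]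
  refine integral_congr_ae ?_
  filter_upwards [hu.coeFn_toLp] with y hy
  rw [hy]

lemma ae_system_eq_zero_iff (hOp : Realizes p Op) (hκ : κ ∈ Complex.slitPlane)
    (hD : IsDilute c d R D) {s : ℂ} {u : Fin N → Plane → ℂ}
    (hu : ∀ i, MemLp (u i) 2 (volume.restrict (D i))) (i : Fin N) :
    (∀ᵐ x ∂(volume.restrict (D i)),
      u i x - s * Op κ (D i) (u i) x - s * ∑ j ∈ Finset.univ.erase i, Op κ (D j) (u j) x = 0) ↔
    (hu i).toLp (u i) = s • ∑ j, pairOperator p D κ i j ((hu j).toLp (u j)) := by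
  rw [toLp_eq_iff]
  refine eventually_congr ?_
  have hop : ∀ᵐ x ∂(volume.restrict (D i)), ∀ j ∈ (Finset.univ : Finset (Fin N)),
      pairOperator p D κ i j ((hu j).toLp (u j)) x = Op κ (D j) (u j) x :=
    (Finset.eventually_all _).2 fun j _ => pairOperator_toLp_ae_eq hOp hκ hD i j (hu j)
  filter_upwards [hop, Lp.coeFn_smul s (∑ j, pairOperator p D κ i j ((hu j).toLp (u j))),
    Lp.coeFn_fun_finsetSum Finset.univ fun j => pairOperator p D κ i j ((hu j).toLp (u j))]
    with x hop hsmul hsum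
  rw [hsmul, Pi.smul_apply, hsum, Finset.sum_congr rfl hop, smul_eq_mul,
    ← Finset.add_sum_erase _ _ (Finset.mem_univ i), sub_sub, ← mul_add, sub_eq_zero]

lemma isSystemResonance_iff_pairOperator (hOp : Realizes p Op) (hD : IsDilute c d R D)
    {m : Material} {k δ : ℝ} {ω : ℂ} (hκ : scaledWavenumber m δ ω ∈ Complex.slitPlane) :
    IsSystemResonance Op Op m k δ D ω ↔ ω ∈ Complex.slitPlane ∧ ω ∉ materialPoles m k ∧
      ∃ u : ∀ i, Lp ℂ 2 (volume.restrict (D i)), u ≠ 0 ∧ ∀ i,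
        u i = strength m k δ ω • ∑ j, pairOperator p D (scaledWavenumber m δ ω) i j (u j) := by
  refine and_congr_right fun _ => and_congr_right fun _ => ⟨?_, ?_⟩
  · rintro ⟨u, hu, ⟨i, hi⟩, h⟩
    refine ⟨fun i => (hu i).toLp (u i), fun h0 => hi ?_,
      fun i => (ae_system_eq_zero_iff hOp hκ hD hu i).1 (h i)⟩
    exact (toLp_eq_zero_iff _).1 (congrFun h0 i)
  · rintro ⟨u, hu0, h⟩
    obtain ⟨i, hi⟩ := Function.ne_iff.1 hu0
    refine ⟨fun i => u i, fun i => Lp.memLp (u i),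
      ⟨i, fun h0 => hi ((Lp.eq_zero_iff_ae_eq_zero).2 h0)⟩, fun i => ?_⟩
    refine (ae_system_eq_zero_iff hOp hκ hD (fun i => Lp.memLp (u i)) i).2 ?_
    simpa only [Lp.toLp_coeFn] using h i

lemma isPrincipalEigenpair_iff_isDominantEigenpair (hκ : κ ∈ Complex.slitPlane)
    (hD : IsDilute c d R D) {i : Fin N} {ν : ℂ} {φ : Plane → ℂ} :
    IsPrincipalEigenpair κ (D i) ν φ ↔ ∃ hφ : MemLp φ 2 (volume.restrict (D i)),
      IsDominantEigenpair (pairOperator expandedTail D κ i i) ν (hφ.toLp φ) := by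
  have heigen : ∀ (μ : ℂ) (ψ : Plane → ℂ) (hψ : MemLp ψ 2 (volume.restrict (D i))),
      (∀ᵐ x ∂(volume.restrict (D i)), opM κ (D i) ψ x = μ * ψ x) ↔
        pairOperator expandedTail D κ i i (hψ.toLp ψ) = μ • hψ.toLp ψ := by
    intro μ ψ hψ
    rw [Lp.ext_iff]
    refine eventually_congr ?_
    filter_upwards [pairOperator_toLp_ae_eq realizes_opM hκ hD i i hψ, hψ.coeFn_toLp,
      Lp.coeFn_smul μ (hψ.toLp ψ)] with x hop hcoe hsmul
    rw [hop, hsmul, Pi.smul_apply, hcoe, smul_eq_mul]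
  constructor
  · rintro ⟨hφ, hφ1, hφe, hmax⟩
    refine ⟨hφ, (pairing_self_eq_one_iff hφ).1 hφ1, (heigen ν φ hφ).1 hφe, ?_⟩
    intro μ Ψ hΨ hμ
    refine hmax μ Ψ (Lp.memLp Ψ) (fun h0 => hΨ (Lp.eq_zero_iff_ae_eq_zero.2 h0)) ?_
    rw [heigen μ Ψ (Lp.memLp Ψ), Lp.toLp_coeFn, hμ]
  · rintro ⟨hφ, hdom⟩
    refine ⟨hφ, (pairing_self_eq_one_iff hφ).2 hdom.norm_eq_one, (heigen ν φ hφ).2 hdom.apply_eq,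
      fun μ ψ hψ hψ0 hψe => ?_⟩
    exact hdom.norm_le μ (hψ.toLp ψ) (fun h0 => hψ0 ((toLp_eq_zero_iff hψ).1 h0))
      ((heigen μ ψ hψ).1 hψe)

variable [∀ i, IsFiniteMeasure (volume.restrict (D i))]

lemma smul_eq_sum_blockMap_remainderOperator_iff {s z : ℂ} (hz : z * (s * operatorScale D) = 1)
    {i : Fin N} (u : ∀ i, Lp ℂ 2 (volume.restrict (D i))) :
    z • u i = ∑ j, blockMap (constVectors D) (leadingMatrix (relSize D))
        (remainderOperator D p κ) i j (u j) ↔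
      u i = s • ∑ j, pairOperator p D κ i j (u j) := by
  have hz0 : z ≠ 0 := left_ne_zero_of_mul_eq_one hz
  have hs : z⁻¹ * (operatorScale D : ℂ)⁻¹ = s := by
    rw [← mul_inv, inv_eq_of_mul_eq_one_right]
    rw [← hz]; ring
  have hsum : ∑ j, blockMap (constVectors D) (leadingMatrix (relSize D))
      (remainderOperator D p κ) i j (u j) =
        (operatorScale D : ℂ)⁻¹ • ∑ j, pairOperator p D κ i j (u j) := by
    rw [Finset.smul_sum]
    exact Finset.sum_congr rfl fun j _ =>
      congrArg (fun T => T (u j)) (blockMap_remainderOperator p κ i j)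
  rw [hsum, ← eq_inv_smul_iff₀ hz0, smul_smul, hs]

lemma isSystemResonance_iff (hOp : Realizes p Op) (hD : IsDilute c d R D)
    {m : Material} {k δ : ℝ} {ω z : ℂ} (hκ : scaledWavenumber m δ ω ∈ Complex.slitPlane)
    (hz : z * (strength m k δ ω * operatorScale D) = 1) :
    IsSystemResonance Op Op m k δ D ω ↔ ω ∈ Complex.slitPlane ∧ ω ∉ materialPoles m k ∧
      ∃ u : ∀ i, Lp ℂ 2 (volume.restrict (D i)), u ≠ 0 ∧ ∀ i, z • u i =
        ∑ j, blockMap (constVectors D) (leadingMatrix (relSize D))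
          (remainderOperator D p (scaledWavenumber m δ ω)) i j (u j) := by
  simp only [isSystemResonance_iff_pairOperator hOp hD hκ,
    smul_eq_sum_blockMap_remainderOperator_iff hz]

variable (D) in
/-- The eigenvalue of largest modulus of the expanded operator on the `i`-th particle, in units of
`operatorScale D`. -/
def principalValue (κ : ℂ) (i : Fin N) : ℂ :=
  blockValue (constVectors D) (leadingMatrix (relSize D)) (remainderOperator D expandedTail κ) i

variable (D) in
/-- The unit eigenvector of the expanded operator on the `i`-th particle for `principalValue`. -/
def principalVector (κ : ℂ) (i : Fin N) : Lp ℂ 2 (volume.restrict (D i)) :=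
  unitVector (constVectors D) (leadingMatrix (relSize D)) (remainderOperator D expandedTail κ) i

variable (D) in
/-- The matrix of the expanded system with respect to the principal eigenvectors, in units of
`operatorScale D`; `det 𝓛 = 0` is its characteristic equation. -/
def principalMatrix (κ : ℂ) : Matrix (Fin N) (Fin N) ℂ :=
  interactionMatrix (constVectors D) (leadingMatrix (relSize D))
    (remainderOperator D expandedTail κ)

lemma pairing_opN_eq (hκ : κ ∈ Complex.slitPlane) (hD : IsDilute c d R D)
    (hs : operatorScale D ≠ 0) {i j : Fin N} (hij : i ≠ j) {φi φj : Plane → ℂ} {ai aj : ℂ}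
    (hφi : φi =ᵐ[volume.restrict (D i)] ⇑(ai • principalVector D κ i))
    (hφj : φj =ᵐ[volume.restrict (D j)] ⇑(aj • principalVector D κ j)) :
    pairing (D i) (opN κ (D j) φj) φi =
      starRingEnd ℂ ai * aj * (operatorScale D * principalMatrix D κ i j) := by
  have hs' : (operatorScale D : ℂ) ≠ 0 := by exact_mod_cast hs
  have hi : MemLp φi 2 (volume.restrict (D i)) := (memLp_congr_ae hφi).2 (Lp.memLp _)
  have hj : MemLp φj 2 (volume.restrict (D j)) := (memLp_congr_ae hφj).2 (Lp.memLp _)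
  have hop := pairOperator_toLp_ae_eq realizes_opM hκ hD i j hj
  have hN : MemLp (opN κ (D j) φj) 2 (volume.restrict (D i)) :=
    (memLp_congr_ae hop).1 (Lp.memLp _)
  have hblock : (operatorScale D : ℂ)⁻¹ •
      pairOperator expandedTail D κ i j (principalVector D κ j) =
      blockMap (constVectors D) (leadingMatrix (relSize D)) (remainderOperator D expandedTail κ) i j
        (principalVector D κ j) :=
    congrArg (fun T => T (principalVector D κ j))
      (blockMap_remainderOperator expandedTail κ i j).symm
  have hentry : principalMatrix D κ i j = (operatorScale D : ℂ)⁻¹ * inner ℂ (principalVector D κ i)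
      (pairOperator expandedTail D κ i j (principalVector D κ j)) := by
    rw [← inner_smul_right, hblock]
    exact interactionMatrix_of_ne hij
  rw [pairing_toLp hN hi, (toLp_eq_iff hN).2 hop.symm, (toLp_eq_iff hi).2 hφi,
    (toLp_eq_iff hj).2 hφj, hentry, mul_inv_cancel_left₀ hs', map_smul, inner_smul_left,
    inner_smul_right, mul_assoc]

section Principal

variable (hκ : κ ∈ Complex.slitPlane) (hD : IsDilute c d R D) (hc : 0 < c)
  (hρ : 0 < sizeParam D) (hs : operatorScale D ≠ 0)
  (hrem : ∀ i,
    ‖scaledRemainder (leadingMatrix (relSize D)) (remainderOperator D expandedTail κ) i‖ ≤ 1 / 16)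
include hκ hD hc hρ hs hrem

lemma isPrincipalEigenpair_iff {i : Fin N} {ν : ℂ} {φ : Plane → ℂ} :
    IsPrincipalEigenpair κ (D i) ν φ ↔ ν = operatorScale D * principalValue D κ i ∧
      ∃ a : ℂ, ‖a‖ = 1 ∧ φ =ᵐ[volume.restrict (D i)] ⇑(a • principalVector D κ i) := by
  have hs' : (operatorScale D : ℂ) ≠ 0 := by exact_mod_cast hs
  have hdom : ∀ Φ, IsDominantEigenpair (pairOperator expandedTail D κ i i) ν Φ ↔
      (operatorScale D : ℂ)⁻¹ * ν = principalValue D κ i ∧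
        ∃ a : ℂ, ‖a‖ = 1 ∧ Φ = a • principalVector D κ i := by
    intro Φ
    rw [← isDominantEigenpair_inv_smul_iff hs', ← blockMap_remainderOperator]
    exact isDominantEigenpair_blockMap_iff (fun i => norm_constVector (hD.area_pos hc hρ i)) hrem
      (norm_pos_iff.1 ((by positivity : 0 < 2 * c).trans_le
        (hD.two_mul_le_norm_leadingMatrix_self hρ i)))
  rw [isPrincipalEigenpair_iff_isDominantEigenpair hκ hD]
  constructor
  · rintro ⟨hφ, h⟩
    obtain ⟨hν, a, ha, hφa⟩ := (hdom _).1 h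
    exact ⟨by rw [← hν, mul_inv_cancel_left₀ hs'], a, ha, (toLp_eq_iff hφ).1 hφa⟩
  · rintro ⟨rfl, a, ha, hφa⟩
    have hφ : MemLp φ 2 (volume.restrict (D i)) := (memLp_congr_ae hφa).2 (Lp.memLp _)
    exact ⟨hφ, (hdom _).2 ⟨inv_mul_cancel_left₀ hs' _, a, ha, (toLp_eq_iff hφ).2 hφa⟩⟩

lemma isPrincipalEigenpair_principalVector (i : Fin N) :
    IsPrincipalEigenpair κ (D i) (operatorScale D * principalValue D κ i)
      ⇑((1 : ℂ) • principalVector D κ i) :=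
  (isPrincipalEigenpair_iff hκ hD hc hρ hs hrem).2 ⟨rfl, 1, norm_one, EventuallyEq.rfl⟩

lemma IsPrincipalEigenpair.unique {i : Fin N} {ν ν' : ℂ} {φ φ' : Plane → ℂ}
    (h : IsPrincipalEigenpair κ (D i) ν φ) (h' : IsPrincipalEigenpair κ (D i) ν' φ') :
    ν' = ν ∧ ∃ a : ℂ, ‖a‖ = 1 ∧ ∀ᵐ x ∂(volume.restrict (D i)), φ' x = a * φ x := by
  rw [isPrincipalEigenpair_iff hκ hD hc hρ hs hrem] at h h'
  obtain ⟨rfl, a, ha, hφ⟩ := h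
  obtain ⟨rfl, a', ha', hφ'⟩ := h'
  have ha0 : a ≠ 0 := norm_ne_zero_iff.1 (ha.trans_ne one_ne_zero)
  refine ⟨rfl, a' / a, by rw [norm_div, ha, ha', div_one], ?_⟩
  filter_upwards [hφ, hφ', Lp.coeFn_smul a (principalVector D κ i),
    Lp.coeFn_smul a' (principalVector D κ i)] with x hφx hφx' hsmul hsmul'
  rw [hφx, hφx', hsmul, hsmul', Pi.smul_apply, Pi.smul_apply, smul_eq_mul, smul_eq_mul,
    ← mul_assoc, div_mul_cancel₀ a' ha0]

end Principal

end Translation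

/-! ### The determinant of `matL` -/

section Determinant

lemma det_eq_zero_iff_of_eq_mul_mul {n K : Type*} [Fintype n] [DecidableEq n] [Field K]
    {A B : Matrix n n K} {v w : n → K} (hv : ∀ i, v i ≠ 0) (hw : ∀ i, w i ≠ 0)
    (h : ∀ i j, A i j = v i * B i j * w j) : A.det = 0 ↔ B.det = 0 := by
  have hA : A = Matrix.diagonal v * B * Matrix.diagonal w := by
    ext i j
    rw [Matrix.mul_diagonal, Matrix.diagonal_mul, h]
  rw [hA, Matrix.det_mul, Matrix.det_mul, Matrix.det_diagonal, Matrix.det_diagonal, mul_eq_zero,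
    mul_eq_zero, or_iff_left (Finset.prod_ne_zero_iff.2 fun i _ => hw i),
    or_iff_right (Finset.prod_ne_zero_iff.2 fun i _ => hv i)]

lemma finRotate_ne_self {N : ℕ} (hN : 2 ≤ N) (i : Fin N) : finRotate N i ≠ i := by
  obtain ⟨n, rfl⟩ : ∃ n, N = n + 2 := ⟨N - 2, by omega⟩
  rw [finRotate_apply]
  exact add_ne_left.2 one_ne_zero

variable {N : ℕ} {D : Fin N → Set Plane} {m : Material} {k δ : ℝ} {ω z : ℂ}

lemma matL_apply_self (ν : Fin N → ℂ) (φ : Fin N → Plane → ℂ) (i : Fin N) :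
    matL m k δ D ω ν φ i i = pairing (D (finRotate N i))
      (opN (scaledWavenumber m δ ω) (D i) (φ i)) (φ (finRotate N i)) :=
  if_pos rfl

lemma matL_apply_of_ne (ν : Fin N → ℂ) (φ : Fin N → Plane → ℂ) {i j : Fin N} (hij : i ≠ j) :
    matL m k δ D ω ν φ i j = -bFactor m k δ ω (ν i) *
      pairing (D i) (opN (scaledWavenumber m δ ω) (D j) (φ j)) (φ i) * matL m k δ D ω ν φ i i := by
  rw [matL_apply_self]
  exact if_neg hij

variable [∀ i, IsFiniteMeasure (volume.restrict (D i))] {c d R : ℝ}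

lemma one_sub_strength_mul_eq (hz : z * (strength m k δ ω * operatorScale D) = 1) (i : Fin N) :
    1 - strength m k δ ω * (operatorScale D * principalValue D (scaledWavenumber m δ ω) i) =
      (z - principalValue D (scaledWavenumber m δ ω) i) * (strength m k δ ω * operatorScale D) := by
  rw [sub_mul, hz]
  ring

section Phases

variable (hD : IsDilute c d R D) (hκ : scaledWavenumber m δ ω ∈ Complex.slitPlane)
  (hz : z * (strength m k δ ω * operatorScale D) = 1)
  {φ : Fin N → Plane → ℂ} {a : Fin N → ℂ} (ha : ∀ i, ‖a i‖ = 1)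
  (hφ : ∀ i, φ i =ᵐ[volume.restrict (D i)] ⇑(a i • principalVector D (scaledWavenumber m δ ω) i))
include hD hκ hz ha hφ

lemma pairing_opN_eq_div {i j : Fin N} (hij : i ≠ j) :
    pairing (D i) (opN (scaledWavenumber m δ ω) (D j) (φ j)) (φ i) =
      a j / a i * (operatorScale D * principalMatrix D (scaledWavenumber m δ ω) i j) := by
  have hs : operatorScale D ≠ 0 := by
    exact_mod_cast right_ne_zero_of_mul (right_ne_zero_of_mul_eq_one hz)
  rw [pairing_opN_eq hκ hD hs hij (hφ i) (hφ j), ← Complex.inv_eq_conj (ha i), div_eq_inv_mul]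

lemma smul_one_sub_principalMatrix_apply {ν : Fin N → ℂ}
    (hν : ν = fun i => operatorScale D * principalValue D (scaledWavenumber m δ ω) i)
    (hzv : ∀ i, z ≠ principalValue D (scaledWavenumber m δ ω) i)
    (hL : ∀ i, matL m k δ D ω ν φ i i ≠ 0) (i j : Fin N) :
    (z • (1 : Matrix (Fin N) (Fin N) ℂ) - principalMatrix D (scaledWavenumber m δ ω)) i j =
      (z - principalValue D (scaledWavenumber m δ ω) i) * a i / matL m k δ D ω ν φ i i *
        matL m k δ D ω ν φ i j * (a j)⁻¹ := by
  have ha0 : ∀ i, a i ≠ 0 := fun i => norm_ne_zero_iff.1 ((ha i).trans_ne one_ne_zero)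
  have hai := ha0 i
  have haj := ha0 j
  have hLi := hL i
  have hstr : strength m k δ ω * operatorScale D ≠ 0 := right_ne_zero_of_mul_eq_one hz
  have hzi : z - principalValue D (scaledWavenumber m δ ω) i ≠ 0 := sub_ne_zero.2 (hzv i)
  rw [Matrix.sub_apply, Matrix.smul_apply, Matrix.one_apply, smul_eq_mul]
  by_cases hij : i = j
  · subst hij
    have hdiag : principalMatrix D (scaledWavenumber m δ ω) i i = principalValue D _ i :=
      interactionMatrix_self i
    rw [if_pos rfl, hdiag]
    field_simp
  · rw [if_neg hij, matL_apply_of_ne ν φ hij, pairing_opN_eq_div hD hκ hz ha hφ hij, bFactor, hν,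
      one_sub_strength_mul_eq hz, ← hν]
    have := left_ne_zero_of_mul hstr
    have := right_ne_zero_of_mul hstr
    field_simp
    ring

lemma det_matL_eq_zero_iff (hN : 2 ≤ N)
    (hne : ∀ i j, i ≠ j → principalMatrix D (scaledWavenumber m δ ω) i j ≠ 0)
    (hzv : ∀ i, z ≠ principalValue D (scaledWavenumber m δ ω) i) :
    (matL m k δ D ω
        (fun i => operatorScale D * principalValue D (scaledWavenumber m δ ω) i) φ).det = 0 ↔
      (z • (1 : Matrix (Fin N) (Fin N) ℂ) -
        principalMatrix D (scaledWavenumber m δ ω)).det = 0 := by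
  have ha0 : ∀ i, a i ≠ 0 := fun i => norm_ne_zero_iff.1 ((ha i).trans_ne one_ne_zero)
  have hs : (operatorScale D : ℂ) ≠ 0 := right_ne_zero_of_mul (right_ne_zero_of_mul_eq_one hz)
  have hL : ∀ ν i, matL m k δ D ω ν φ i i ≠ 0 := fun ν i => by
    have hr := finRotate_ne_self hN i
    rw [matL_apply_self, pairing_opN_eq_div hD hκ hz ha hφ hr]
    exact mul_ne_zero (div_ne_zero (ha0 _) (ha0 _)) (mul_ne_zero hs (hne _ _ hr))
  exact (det_eq_zero_iff_of_eq_mul_mul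
    (fun i => div_ne_zero (mul_ne_zero (sub_ne_zero.2 (hzv i)) (ha0 i)) (hL _ i))
    (fun j => inv_ne_zero (ha0 j))
    (smul_one_sub_principalMatrix_apply hD hκ hz ha hφ rfl hzv (hL _))).symm

end Phases

lemma isDetZero_iff (hN : 2 ≤ N) (hD : IsDilute c d R D) (hc : 0 < c) (hρ : 0 < sizeParam D)
    (hκ : scaledWavenumber m δ ω ∈ Complex.slitPlane)
    (hrem : ∀ i, ‖scaledRemainder (leadingMatrix (relSize D))
      (remainderOperator D expandedTail (scaledWavenumber m δ ω)) i‖ ≤ 1 / 16)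
    (hne : ∀ i j, i ≠ j → principalMatrix D (scaledWavenumber m δ ω) i j ≠ 0)
    (hz : z * (strength m k δ ω * operatorScale D) = 1) :
    IsDetZero m k δ D ω ↔ ω ∈ Complex.slitPlane ∧ ω ∉ materialPoles m k ∧
      (∀ i, z ≠ principalValue D (scaledWavenumber m δ ω) i) ∧
      (z • (1 : Matrix (Fin N) (Fin N) ℂ) -
        principalMatrix D (scaledWavenumber m δ ω)).det = 0 := by
  have hstr : strength m k δ ω * operatorScale D ≠ 0 := right_ne_zero_of_mul_eq_one hz
  have hs : operatorScale D ≠ 0 := by exact_mod_cast right_ne_zero_of_mul hstr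
  have hcond : ∀ i, 1 - strength m k δ ω *
      (operatorScale D * principalValue D (scaledWavenumber m δ ω) i) ≠ 0 ↔
        z ≠ principalValue D (scaledWavenumber m δ ω) i := by
    intro i
    rw [one_sub_strength_mul_eq hz, mul_ne_zero_iff_right hstr, sub_ne_zero]
  refine and_congr_right fun _ => and_congr_right fun _ => ⟨?_, ?_⟩
  · rintro ⟨ν, φ, hpair, hν, hL⟩
    have hspec := fun i => (isPrincipalEigenpair_iff hκ hD hc hρ hs hrem).1 (hpair i)
    obtain rfl : ν = fun i => operatorScale D * principalValue D (scaledWavenumber m δ ω) i :=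
      funext fun i => (hspec i).1
    choose a ha hφ using fun i => (hspec i).2
    have hzv := fun i => (hcond i).1 (hν i)
    exact ⟨hzv, (det_matL_eq_zero_iff hD hκ hz ha hφ hN hne hzv).1 hL⟩
  · rintro ⟨hzv, hdet⟩
    exact ⟨_, _, isPrincipalEigenpair_principalVector hκ hD hc hρ hs hrem,
      fun i => (hcond i).2 (hzv i), (det_matL_eq_zero_iff hD hκ hz (fun _ => norm_one)
        (fun _ => EventuallyEq.rfl) hN hne hzv).2 hdet⟩

end Determinant

/-! ### The poles of the permittivity -/

section Parameters

variable (m : Material) {δ : ℝ} {ω : ℂ}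

lemma scaledWavenumber_eq_ofReal_mul (δ : ℝ) (ω : ℂ) :
    scaledWavenumber m δ ω = ((δ * (m.mu0 * m.eps0) : ℝ) : ℂ) * ω := by
  rw [scaledWavenumber]
  push_cast
  ring

lemma scaledWavenumber_mem_slitPlane (hδ : 0 < δ) (hω : ω ∈ Complex.slitPlane) :
    scaledWavenumber m δ ω ∈ Complex.slitPlane := by
  have hpos : 0 < δ * (m.mu0 * m.eps0) := mul_pos hδ (mul_pos m.mu0_pos m.eps0_pos)
  rw [scaledWavenumber_eq_ofReal_mul, Complex.mem_slitPlane_iff, Complex.re_ofReal_mul,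
    Complex.im_ofReal_mul]
  exact (Complex.mem_slitPlane_iff.1 hω).imp (mul_pos hpos) (mul_ne_zero hpos.ne')

lemma continuous_scaledWavenumber (δ : ℝ) : Continuous (scaledWavenumber m δ) := by
  unfold scaledWavenumber
  fun_prop

lemma norm_scaledWavenumber (hδ : 0 < δ) (ω : ℂ) :
    ‖scaledWavenumber m δ ω‖ = δ * (m.mu0 * m.eps0) * ‖ω‖ := by
  rw [scaledWavenumber_eq_ofReal_mul, norm_mul, Complex.norm_real,
    Real.norm_of_nonneg (mul_pos hδ (mul_pos m.mu0_pos m.eps0_pos)).le]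

lemma abs_log_sub_log_le {x y a : ℝ} (hx : 0 < x) (hy : 0 < y) (ha : 0 < a)
    (hxy : x ≤ a * y) (hyx : y ≤ a * x) : |Real.log x - Real.log y| ≤ |Real.log a| := by
  have h₁ := Real.log_le_log hx hxy
  have h₂ := Real.log_le_log hy hyx
  rw [Real.log_mul ha.ne' hy.ne'] at h₁
  rw [Real.log_mul ha.ne' hx.ne'] at h₂
  exact (abs_le.2 ⟨by linarith, by linarith⟩ : _ ≤ Real.log a).trans (le_abs_self _)

variable {m} in
lemma norm_logGammaHat_sub_log_le {ρ κ₀ L : ℝ} (hδ : 0 < δ) (hρ : 0 < ρ) (hκ₀ : 0 < κ₀)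
    (hρδ : ρ ≤ κ₀ * δ) (hδρ : δ ≤ κ₀ * ρ) (hω : ω ≠ 0)
    (hL : ‖Complex.log (scaledWavenumber m 1 ω)‖ ≤ L) :
    ‖logGammaHat (scaledWavenumber m δ ω) - Real.log ρ‖ ≤
      |Real.log κ₀| + L + ‖Complex.log gammaHat‖ := by
  have hne : scaledWavenumber m 1 ω ≠ 0 := by
    rw [scaledWavenumber_eq_ofReal_mul, one_mul]
    exact mul_ne_zero (by exact_mod_cast (mul_pos m.mu0_pos m.eps0_pos).ne') hω
  have hscale : scaledWavenumber m δ ω = δ * scaledWavenumber m 1 ω := by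
    simp only [scaledWavenumber, Complex.ofReal_one, one_mul]
  have hsplit : logGammaHat (scaledWavenumber m δ ω) - Real.log ρ =
      ((Real.log δ - Real.log ρ : ℝ) : ℂ) + Complex.log (scaledWavenumber m 1 ω) +
        Complex.log gammaHat := by
    rw [logGammaHat, hscale, Complex.log_ofReal_mul hδ hne]
    push_cast
    ring
  have hlog : ‖((Real.log δ - Real.log ρ : ℝ) : ℂ)‖ ≤ |Real.log κ₀| := by
    rw [Complex.norm_real]
    exact abs_log_sub_log_le hδ hρ hκ₀ hδρ hρδ
  rw [hsplit]
  exact (norm_add₃_le ..).trans (by gcongr)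

lemma eventually_mul_le (K : ℝ) {y : ℝ} (hy : 0 < y) : ∀ᶠ x in 𝓝[>] (0 : ℝ), K * x ≤ y := by
  have h : Tendsto (fun x : ℝ => K * x) (𝓝[>] 0) (𝓝 (K * 0)) :=
    ((continuous_const.mul continuous_id).tendsto 0).mono_left nhdsWithin_le_nhds
  rw [mul_zero] at h
  exact h.eventually_le_const hy

lemma eventually_div_neg_log_le (K : ℝ) {y : ℝ} (hy : 0 < y) :
    ∀ᶠ x in 𝓝[>] (0 : ℝ), K / -Real.log x ≤ y :=
  ((tendsto_neg_atBot_atTop.comp Real.tendsto_log_nhdsGT_zero).const_div_atTop K)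
    |>.eventually_le_const hy

lemma eventually_norm_remainderOperator_le (p : KernelTail) {c d R κ₀ η : ℝ}
    (hc : 0 < c) (hd : 0 < d) (hκ₀ : 0 < κ₀) (hη : 0 < η) {K : Set ℂ}
    (hK : IsCompact K) (hKs : K ⊆ Complex.slitPlane) :
    ∀ᶠ ρ in 𝓝[>] (0 : ℝ), ∀ (N : ℕ) (D : Fin N → Set Plane) (δ : ℝ)
      [∀ i, IsFiniteMeasure (volume.restrict (D i))], sizeParam D = ρ → IsDilute c d R D → 0 < δ →
      ρ ≤ κ₀ * δ → δ ≤ κ₀ * ρ → ∀ ω ∈ K, ∀ i j,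
        ‖remainderOperator D p (scaledWavenumber m δ ω) i j‖ ≤ η := by
  obtain ⟨κ₁, hκ₁, htail⟩ := p.exists_norm_tail_le (2 * R)
  obtain ⟨L, hL⟩ := hK.exists_bound_of_continuousOn <|
    (continuous_scaledWavenumber m 1).continuousOn.clog
      fun ω hω => scaledWavenumber_mem_slitPlane m one_pos (hKs hω)
  obtain ⟨W, hW⟩ := hK.exists_bound_of_continuousOn (f := fun ω : ℂ => ω) continuousOn_id
  filter_upwards [self_mem_nhdsWithin, eventually_mul_le 2 one_pos,
    eventually_mul_le (κ₀ * (m.mu0 * m.eps0) * W) hκ₁, eventually_div_neg_log_le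
      (12 * Real.pi * (logConst + 6 * (|Real.log d| + |Real.log (2 * R)| +
        (|Real.log κ₀| + L + ‖Complex.log gammaHat‖) + 1))) hη] with ρ hρ hρ1 hρκ hρη
  rintro N D δ _ rfl hD hδ hρδ hδρ ω hω i j
  refine (hD.norm_remainderOperator_le hc hd hρ (by linarith) p (norm_logGammaHat_sub_log_le hδ hρ
    hκ₀ hρδ hδρ (Complex.slitPlane_ne_zero (hKs hω)) (hL ω hω)) (htail _ ?_) i j).trans hρη
  have hWω := hW ω hω
  have : 0 < sizeParam D := hρ
  have := m.mu0_pos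
  have := m.eps0_pos
  calc ‖scaledWavenumber m δ ω‖ = δ * (m.mu0 * m.eps0) * ‖ω‖ := norm_scaledWavenumber m hδ ω
    _ ≤ κ₀ * sizeParam D * (m.mu0 * m.eps0) * W := by gcongr
    _ = κ₀ * (m.mu0 * m.eps0) * W * sizeParam D := by ring
    _ ≤ κ₁ := hρκ

end Parameters

section Poles

variable (m : Material) (k : ℝ)

lemma exists_dispersion_eq : ∃ p₁ p₂ : ℂ, ∀ ω, dispersion m k ω = -((ω - p₁) * (ω - p₂)) := by
  obtain ⟨s, hs⟩ := IsAlgClosed.exists_pow_nat_eq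
    (-(m.gamma : ℂ) ^ 2 + 4 * (m.beta + m.eta * (k : ℂ) ^ 2)) (n := 2) two_pos
  refine ⟨(-Complex.I * m.gamma + s) / 2, (-Complex.I * m.gamma - s) / 2, fun ω => ?_⟩
  rw [dispersion]
  linear_combination (-1 / 4 : ℂ) * hs + (m.gamma : ℂ) ^ 2 / 4 * Complex.I_sq

/-- The roots `y`, `y'` of the dispersion polynomial, ordered by their distance to `ω`. -/
structure IsPoleFactorization (ω y y' : ℂ) : Prop where
  dispersion_eq : ∀ w, dispersion m k w = -((w - y) * (w - y'))
  norm_sub_le_norm_sub : ‖ω - y‖ ≤ ‖ω - y'‖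

variable {m k} {ω y y' : ℂ}

namespace IsPoleFactorization

lemma norm_sub_eq_infDist (h : IsPoleFactorization m k ω y y') :
    ‖ω - y‖ = Metric.infDist ω (materialPoles m k) := by
  have hy : y ∈ materialPoles m k := by simp [materialPoles, h.dispersion_eq]
  refine le_antisymm ((Metric.le_infDist ⟨y, hy⟩).2 fun w hw => ?_)
    ((Metric.infDist_le_dist_of_mem hy).trans_eq (dist_eq_norm ω y))
  have hw' : (w - y) * (w - y') = 0 := neg_eq_zero.1 ((h.dispersion_eq w).symm.trans hw)
  rw [dist_eq_norm]
  rcases mul_eq_zero.1 hw' with h₁ | h₁ <;> rw [sub_eq_zero.1 h₁]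
  exact h.norm_sub_le_norm_sub

lemma norm_sub_sq_le (h : IsPoleFactorization m k ω y y') :
    ‖ω - y‖ ^ 2 ≤ ‖dispersion m k ω‖ := by
  rw [h.dispersion_eq, norm_neg, norm_mul, sq]
  gcongr
  exact h.norm_sub_le_norm_sub

lemma sub_ne_zero_left (h : IsPoleFactorization m k ω y y') (hω : ω ∉ materialPoles m k) :
    ω - y ≠ 0 :=
  fun h0 => hω ((h.dispersion_eq ω).trans (by rw [h0, zero_mul, neg_zero]))

lemma sub_ne_zero_right (h : IsPoleFactorization m k ω y y') (hω : ω ∉ materialPoles m k) :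
    ω - y' ≠ 0 :=
  fun h0 => hω ((h.dispersion_eq ω).trans (by rw [h0, mul_zero, neg_zero]))

lemma norm_div_le_one (h : IsPoleFactorization m k ω y y') : ‖(ω - y) / (ω - y')‖ ≤ 1 := by
  rw [norm_div]
  exact div_le_one_of_le₀ h.norm_sub_le_norm_sub (norm_nonneg _)

end IsPoleFactorization

variable (m k) in
lemma exists_isPoleFactorization : ∃ Δ > 0, ∀ ω : ℂ, ∃ y y' : ℂ,
    IsPoleFactorization m k ω y y' ∧ (y = y' ∨ Δ ≤ ‖y - y'‖) := by
  obtain ⟨p₁, p₂, hp⟩ := exists_dispersion_eq m k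
  have hp' : ∀ w, dispersion m k w = -((w - p₂) * (w - p₁)) := fun w => by rw [hp, mul_comm]
  refine ⟨if p₁ = p₂ then 1 else ‖p₁ - p₂‖, ?_, fun ω => ?_⟩
  · split_ifs with h
    · exact one_pos
    · exact norm_pos_iff.2 (sub_ne_zero.2 h)
  · have hgap : p₁ = p₂ ∨ (if p₁ = p₂ then 1 else ‖p₁ - p₂‖) ≤ ‖p₁ - p₂‖ := by
      split_ifs with h
      · exact .inl h
      · exact .inr le_rfl
    rcases le_total ‖ω - p₁‖ ‖ω - p₂‖ with hle | hle
    · exact ⟨p₁, p₂, ⟨hp, hle⟩, hgap⟩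
    · exact ⟨p₂, p₁, ⟨hp', hle⟩, hgap.imp Eq.symm fun h => h.trans_eq (norm_sub_rev _ _)⟩

lemma half_le_norm_one_add_of_norm_le {𝕜 : Type*} [NormedDivisionRing 𝕜] {r : 𝕜}
    (hr : ‖r‖ ≤ 1 / 2) : 1 / 2 ≤ ‖1 + r‖ := by
  have := norm_sub_norm_le (1 : 𝕜) (-r)
  rw [norm_one, norm_neg, sub_neg_eq_add] at this
  linarith

/-- A double root is at the same distance from `ω` twice, and distinct roots are separated: either
way the contributions of the two roots to the logarithmic derivative do not cancel. -/
lemma IsPoleFactorization.half_le_norm_one_add_div {Δ : ℝ} (h : IsPoleFactorization m k ω y y')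
    (hω : ω ∉ materialPoles m k) (hy : y = y' ∨ Δ ≤ ‖y - y'‖) (hΔ : ‖ω - y‖ ≤ Δ / 3) :
    1 / 2 ≤ ‖1 + (ω - y) / (ω - y')‖ := by
  rcases hy with rfl | hy
  · rw [div_self (h.sub_ne_zero_left hω)]
    norm_num
  · have htri : ‖y - y'‖ ≤ ‖ω - y'‖ + ‖ω - y‖ := by simpa using norm_sub_le (ω - y') (ω - y)
    refine half_le_norm_one_add_of_norm_le ?_
    rw [norm_div, div_le_iff₀ (norm_pos_iff.2 (h.sub_ne_zero_right hω))]
    linarith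

lemma norm_quotient_numerator_le {r ξ t : ℂ} {ε : ℝ} (hε : ε ≤ 1 / 4) (hr : ‖r‖ ≤ 1)
    (hξ : ‖ξ‖ ≤ ε) (ht : ‖t‖ ≤ ε) :
    ‖r * t ^ 2 - (1 + (1 + r) * t) * (2 * (ξ * t) + (ξ * t) ^ 2)‖ ≤ 41 / 10 * ε ^ 2 := by
  have hε0 : 0 ≤ ε := (norm_nonneg _).trans ht
  have hξt : ‖ξ * t‖ ≤ ε ^ 2 := by
    rw [norm_mul, sq]
    gcongr
  have hξt' : ‖ξ * t‖ ≤ 1 / 16 := hξt.trans (by nlinarith)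
  have h₁ : ‖r * t ^ 2‖ ≤ 1 * ε ^ 2 := by
    rw [norm_mul, norm_pow]
    gcongr
  have h₂ : ‖1 + (1 + r) * t‖ ≤ 1 + (1 + 1) * (1 / 4) := by
    refine (norm_add_le _ _).trans ?_
    rw [norm_one, norm_mul]
    gcongr
    · exact (norm_add_le _ _).trans (by rw [norm_one]; gcongr)
    · exact ht.trans hε
  have h₃ : ‖2 * (ξ * t) + (ξ * t) ^ 2‖ ≤ 2 * ε ^ 2 + 1 / 16 * ε ^ 2 := by
    refine (norm_add_le _ _).trans ?_
    rw [norm_mul, norm_pow, sq ‖ξ * t‖, Complex.norm_ofNat]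
    gcongr
  calc ‖r * t ^ 2 - (1 + (1 + r) * t) * (2 * (ξ * t) + (ξ * t) ^ 2)‖
      ≤ 1 * ε ^ 2 + (1 + (1 + 1) * (1 / 4)) * (2 * ε ^ 2 + 1 / 16 * ε ^ 2) := by
        refine (norm_sub_le _ _).trans ?_
        rw [norm_mul (1 + (1 + r) * t)]
        gcongr
    _ ≤ 41 / 10 * ε ^ 2 := by nlinarith [sq_nonneg ε]

lemma norm_quotient_sub_affine_le {r ξ t : ℂ} {ε : ℝ} (hε : ε ≤ 1 / 4) (hr : ‖r‖ ≤ 1)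
    (hξ : ‖ξ‖ ≤ ε) (ht : ‖t‖ ≤ ε) :
    ‖(1 + t) * (1 + r * t) / (1 + ξ * t) ^ 2 - (1 + (1 + r) * t)‖ ≤ 5 * ε ^ 2 := by
  have hden : 15 / 16 ≤ ‖1 + ξ * t‖ := by
    have hξt : ‖ξ * t‖ ≤ 1 / 16 := by
      rw [norm_mul]
      nlinarith [norm_nonneg ξ, norm_nonneg t]
    have := norm_sub_norm_le (1 : ℂ) (-(ξ * t))
    rw [norm_one, norm_neg, sub_neg_eq_add] at this
    linarith
  have hne : (1 + ξ * t) ^ 2 ≠ 0 := pow_ne_zero _ (norm_pos_iff.1 (by linarith))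
  have hquot : (1 + t) * (1 + r * t) / (1 + ξ * t) ^ 2 - (1 + (1 + r) * t) =
      (r * t ^ 2 - (1 + (1 + r) * t) * (2 * (ξ * t) + (ξ * t) ^ 2)) / (1 + ξ * t) ^ 2 := by
    rw [eq_div_iff hne, sub_mul, div_mul_cancel₀ _ hne]
    ring
  have : (15 / 16 : ℝ) ^ 2 ≤ ‖1 + ξ * t‖ ^ 2 := by gcongr
  rw [hquot, norm_div, norm_pow, div_le_iff₀ (by positivity)]
  exact (norm_quotient_numerator_le hε hr hξ ht).trans (by nlinarith [sq_nonneg ε])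

end Poles

/-! ### The spectral parameter -/

section SpectralParameter

/-- The spectral parameter `p(ω) / (τ ω²)` of the block system; with `τ = spectralScale m δ D` it is
the inverse of `strength m k δ ω * operatorScale D`. -/
def spectralParameter (m : Material) (k τ : ℝ) (ω : ℂ) : ℂ := dispersion m k ω / (τ * ω ^ 2)

/-- The normalisation of `spectralParameter` for the configuration `D`. -/
def spectralScale {N : ℕ} (m : Material) (δ : ℝ) (D : Fin N → Set Plane) : ℝ :=
  δ ^ 2 * (m.mu0 * m.alpha) * operatorScale D

variable {m : Material} {k τ : ℝ} {ω y y' t : ℂ} {ε : ℝ}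

lemma spectralScale_pos {N : ℕ} {D : Fin N → Set Plane} {δ : ℝ} (hδ : 0 < δ)
    (hs : 0 < operatorScale D) : 0 < spectralScale m δ D := by
  have := m.mu0_pos
  have := m.alpha_pos
  rw [spectralScale]
  positivity

lemma spectralParameter_mul_strength {N : ℕ} {D : Fin N → Set Plane} {δ : ℝ}
    (hδ : 0 < δ) (hs : 0 < operatorScale D) (hω : ω ≠ 0) (hP : ω ∉ materialPoles m k) :
    spectralParameter m k (spectralScale m δ D) ω * (strength m k δ ω * operatorScale D) = 1 := by
  have hp : dispersion m k ω ≠ 0 := hP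
  have hδ' : (δ : ℂ) ≠ 0 := by exact_mod_cast hδ.ne'
  have hs' : (operatorScale D : ℂ) ≠ 0 := by exact_mod_cast hs.ne'
  have hμ : (m.mu0 : ℂ) ≠ 0 := by exact_mod_cast m.mu0_pos.ne'
  have hα : (m.alpha : ℂ) ≠ 0 := by exact_mod_cast m.alpha_pos.ne'
  rw [spectralParameter, spectralScale, strength, contrast, permittivity]
  push_cast
  field_simp
  ring

lemma continuousOn_spectralParameter (hτ : τ ≠ 0) :
    ContinuousOn (spectralParameter m k τ) {0}ᶜ := by
  have h : Continuous (dispersion m k) := by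
    unfold dispersion
    fun_prop
  exact h.continuousOn.div (by fun_prop)
    fun ω hω => mul_ne_zero (by exact_mod_cast hτ) (pow_ne_zero 2 hω)

lemma norm_dispersion_eq (hτ : 0 < τ) (hω : ω ≠ 0) :
    ‖dispersion m k ω‖ = ‖spectralParameter m k τ ω‖ * (τ * ‖ω‖ ^ 2) := by
  have := norm_pos_iff.2 hω
  rw [spectralParameter, norm_div, norm_mul, norm_pow, Complex.norm_real,
    Real.norm_of_nonneg hτ.le, div_mul_cancel₀ _ (by positivity)]

lemma one_add_ne_zero_of_norm_lt_one {𝕜 : Type*} [NormedDivisionRing 𝕜] {x : 𝕜} (hx : ‖x‖ < 1) :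
    1 + x ≠ 0 := fun h => by
  rw [← neg_eq_of_add_eq_zero_right h, norm_neg, norm_one] at hx
  exact lt_irrefl 1 hx

namespace IsPoleFactorization

lemma dispersion_add_mul (h : IsPoleFactorization m k ω y y') (hP : ω ∉ materialPoles m k) (t : ℂ) :
    dispersion m k (ω + (ω - y) * t) =
      dispersion m k ω * ((1 + t) * (1 + (ω - y) / (ω - y') * t)) := by
  have hy := h.sub_ne_zero_right hP
  rw [h.dispersion_eq, h.dispersion_eq ω]
  field_simp
  ring

lemma add_mul_notMem_materialPoles (h : IsPoleFactorization m k ω y y')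
    (hP : ω ∉ materialPoles m k) (ht : ‖t‖ < 1) : ω + (ω - y) * t ∉ materialPoles m k := by
  have hrt : ‖(ω - y) / (ω - y') * t‖ < 1 := by
    rw [norm_mul]
    exact mul_lt_one_of_nonneg_of_lt_one_right h.norm_div_le_one (norm_nonneg t) ht
  rw [materialPoles, mem_ofPred_eq, h.dispersion_add_mul hP]
  exact mul_ne_zero hP (mul_ne_zero (one_add_ne_zero_of_norm_lt_one ht)
    (one_add_ne_zero_of_norm_lt_one hrt))

/-- To first order in `t`, the two zeros of the dispersion polynomial contribute the factor
`1 + (1 + r) * t`; the factor `ω ^ 2` varies on a larger scale. -/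
lemma norm_spectralParameter_sub_le (h : IsPoleFactorization m k ω y y') (hω : ω ≠ 0)
    (hP : ω ∉ materialPoles m k) (hε : ε ≤ 1 / 4) (hy : ‖ω - y‖ ≤ ε * ‖ω‖) (ht : ‖t‖ ≤ ε) :
    ‖spectralParameter m k τ (ω + (ω - y) * t) -
        spectralParameter m k τ ω * (1 + (1 + (ω - y) / (ω - y')) * t)‖ ≤
      ‖spectralParameter m k τ ω‖ * (5 * ε ^ 2) := by
  have hfactor : spectralParameter m k τ (ω + (ω - y) * t) = spectralParameter m k τ ω *
      ((1 + t) * (1 + (ω - y) / (ω - y') * t) / (1 + (ω - y) / ω * t) ^ 2) := by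
    have hden : ω + (ω - y) * t = ω * (1 + (ω - y) / ω * t) := by
      field_simp
    rw [spectralParameter, h.dispersion_add_mul hP, hden, mul_pow, ← mul_assoc (τ : ℂ),
      mul_div_mul_comm, spectralParameter]
  have hξ : ‖(ω - y) / ω‖ ≤ ε := by
    rwa [norm_div, div_le_iff₀ (norm_pos_iff.2 hω)]
  rw [hfactor, ← mul_sub, norm_mul]
  gcongr
  exact norm_quotient_sub_affine_le hε h.norm_div_le_one hξ ht

end IsPoleFactorization

/-- On the ball of radius `ε ‖q‖` about `ω`, where `‖q‖` is the distance to the poles, every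
`spectralParameter` is affine with slope `b`, up to a fraction `1 / M` of its variation. -/
structure IsAffineModel (m : Material) (k ε M : ℝ) (ω q b : ℂ) : Prop where
  norm_eq_infDist : ‖q‖ = Metric.infDist ω (materialPoles m k)
  half_le : 1 / 2 ≤ ‖b‖
  le_two : ‖b‖ ≤ 2
  ne_zero : ∀ t ∈ Metric.closedBall (0 : ℂ) ε, ω + q * t ≠ 0
  notMem_materialPoles : ∀ t ∈ Metric.closedBall (0 : ℂ) ε, ω + q * t ∉ materialPoles m k
  norm_sub_le : ∀ τ : ℝ, ∀ t ∈ Metric.closedBall (0 : ℂ) ε,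
    ‖spectralParameter m k τ (ω + q * t) - spectralParameter m k τ ω * (1 + b * t)‖ ≤
      ‖spectralParameter m k τ ω‖ * (‖b‖ * ε / M)

lemma exists_isAffineModel (m : Material) (k : ℝ) {M w₀ r₀ : ℝ} (hε : 0 < ε) (hM : 1 ≤ M)
    (hεM : 10 * M * ε ≤ 1) (hw₀ : 0 < w₀) (hr₀ : 0 < r₀) :
    ∃ q₀ > 0, ∀ ω : ℂ, w₀ ≤ ‖ω‖ → ω ∉ materialPoles m k → ‖dispersion m k ω‖ ≤ q₀ →
      ∃ q b : ℂ, ‖q‖ ≤ r₀ ∧ IsAffineModel m k ε M ω q b := by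
  obtain ⟨Δ, hΔ, hpole⟩ := exists_isPoleFactorization m k
  have hε10 : ε ≤ 1 / 10 := by nlinarith
  refine ⟨min (min (Δ / 3) (ε * w₀)) r₀ ^ 2, by positivity, fun ω hω hP hdisp => ?_⟩
  obtain ⟨y, y', h, hyy⟩ := hpole ω
  have hω0 : ω ≠ 0 := norm_pos_iff.1 (hw₀.trans_le hω)
  have hy : ‖ω - y‖ ≤ min (min (Δ / 3) (ε * w₀)) r₀ :=
    le_of_sq_le_sq (h.norm_sub_sq_le.trans hdisp) (by positivity)
  obtain ⟨⟨hyΔ, hyw⟩, hyr⟩ : (‖ω - y‖ ≤ Δ / 3 ∧ ‖ω - y‖ ≤ ε * w₀) ∧ ‖ω - y‖ ≤ r₀ := by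
    simpa only [le_min_iff] using hy
  have hyω : ‖ω - y‖ ≤ ε * ‖ω‖ := hyw.trans (by gcongr)
  have hb := h.half_le_norm_one_add_div hP hyy hyΔ
  refine ⟨ω - y, 1 + (ω - y) / (ω - y'), hyr, h.norm_sub_eq_infDist, hb, ?_, fun t ht h0 => ?_,
    fun t ht => ?_, fun τ t ht => ?_⟩
  · exact (norm_add_le _ _).trans (by rw [norm_one]; linarith [h.norm_div_le_one])
  · have ht' := mem_closedBall_zero_iff.1 ht
    have hlt : ‖(ω - y) * t‖ < ‖ω‖ := by
      rw [norm_mul]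
      nlinarith [norm_pos_iff.2 hω0, norm_nonneg t, norm_nonneg (ω - y)]
    rw [← neg_eq_of_add_eq_zero_right h0, norm_neg] at hlt
    exact lt_irrefl _ hlt
  · exact h.add_mul_notMem_materialPoles hP (by linarith [mem_closedBall_zero_iff.1 ht])
  · refine (h.norm_spectralParameter_sub_le hω0 hP (by linarith) hyω
      (mem_closedBall_zero_iff.1 ht)).trans ?_
    gcongr
    rw [le_div_iff₀ (by linarith)]
    nlinarith

end SpectralParameter

section Transfer

/-- The ball of frequencies that agree with `ω` at leading order, up to the relative error `ε`. -/
def leadingOrderBall (m : Material) (k ε : ℝ) (ω : ℂ) : Set ℂ :=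
  Metric.closedBall ω (ε * Metric.infDist ω (materialPoles m k))

variable {m : Material} {k τ : ℝ} {ω q b : ℂ} {ε M : ℝ}

lemma exists_closeAtLeadingOrder {ε' : ℝ} {P : ℂ → Prop} (hε : ε ≤ ε')
    (h : ∃ w ∈ leadingOrderBall m k ε ω, P w) : ∃ w, P w ∧ CloseAtLeadingOrder ε' m k ω w :=
  h.imp fun _ ⟨hw, hP⟩ => ⟨hP, (mem_closedBall_iff_norm.1 hw).trans
    (mul_le_mul_of_nonneg_right hε Metric.infDist_nonneg)⟩

namespace IsAffineModel

lemma add_mul_mem_leadingOrderBall (h : IsAffineModel m k ε M ω q b) {t : ℂ}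
    (ht : t ∈ Metric.closedBall (0 : ℂ) ε) : ω + q * t ∈ leadingOrderBall m k ε ω := by
  rw [leadingOrderBall, mem_closedBall_iff_norm, add_sub_cancel_left, norm_mul, mul_comm,
    h.norm_eq_infDist]
  exact mul_le_mul_of_nonneg_right (mem_closedBall_zero_iff.1 ht) Metric.infDist_nonneg

lemma exists_eq_add_mul (h : IsAffineModel m k ε M ω q b) (hε : 0 ≤ ε)
    {w : ℂ} (hw : w ∈ leadingOrderBall m k ε ω) :
    ∃ t ∈ Metric.closedBall (0 : ℂ) ε, w = ω + q * t := by
  rw [leadingOrderBall, mem_closedBall_iff_norm, ← h.norm_eq_infDist] at hw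
  rcases eq_or_ne q 0 with rfl | hq
  · rw [norm_zero, mul_zero, norm_le_zero_iff, sub_eq_zero] at hw
    exact ⟨0, Metric.mem_closedBall_self hε, by rw [hw, zero_mul, add_zero]⟩
  · refine ⟨(w - ω) / q, ?_, by rw [mul_div_cancel₀ _ hq, add_sub_cancel]⟩
    rwa [mem_closedBall_zero_iff, norm_div, div_le_iff₀ (norm_pos_iff.2 hq)]

lemma norm_spectralParameter_sub_le (h : IsAffineModel m k ε M ω q b) (hM : 1 ≤ M)
    (hε : 0 ≤ ε) (τ : ℝ) {w : ℂ} (hw : w ∈ leadingOrderBall m k ε ω) :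
    ‖spectralParameter m k τ w - spectralParameter m k τ ω‖ ≤
      4 * ε * ‖spectralParameter m k τ ω‖ := by
  obtain ⟨t, ht, rfl⟩ := h.exists_eq_add_mul hε hw
  set z₀ := spectralParameter m k τ ω
  have hlin : ‖z₀ * (b * t)‖ ≤ ‖z₀‖ * (2 * ε) := by
    rw [norm_mul, norm_mul]
    gcongr
    · exact h.le_two
    · exact mem_closedBall_zero_iff.1 ht
  have herr : ‖z₀‖ * (‖b‖ * ε / M) ≤ ‖z₀‖ * (2 * ε) := by
    gcongr
    exact (div_le_self (by positivity) hM).trans (by gcongr; exact h.le_two)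
  have hsplit : spectralParameter m k τ (ω + q * t) - z₀ =
      (spectralParameter m k τ (ω + q * t) - z₀ * (1 + b * t)) + z₀ * (b * t) := by ring
  rw [hsplit]
  exact (norm_add_le _ _).trans (by linarith [h.norm_sub_le τ t ht])

end IsAffineModel

/-- Zeros of the characteristic determinant of a matrix near `A` exist in `leadingOrderBall`,
where the spectral parameter stays away from the poles and nearly constant. -/
structure IsTransferBall {ι : Type*} [Fintype ι] [DecidableEq ι] (m : Material) (k τ ε η : ℝ)
    (A : Matrix ι ι ℂ) (ω : ℂ) : Prop where
  notMem_materialPoles : ∀ w ∈ leadingOrderBall m k ε ω, w ∉ materialPoles m k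
  norm_spectralParameter_sub_le : ∀ w ∈ leadingOrderBall m k ε ω,
    ‖spectralParameter m k τ w - spectralParameter m k τ ω‖ ≤
      4 * ε * ‖spectralParameter m k τ ω‖
  exists_det_eq_zero : ∀ B : ℂ → Matrix ι ι ℂ, ContinuousOn B (leadingOrderBall m k ε ω) →
    (∀ w ∈ leadingOrderBall m k ε ω, ∀ i j, ‖B w i j - A i j‖ ≤ η) →
    ∃ w ∈ leadingOrderBall m k ε ω,
      (spectralParameter m k τ w • (1 : Matrix ι ι ℂ) - B w).det = 0

variable {ι : Type*} [Fintype ι] [DecidableEq ι]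

lemma exists_isTransferBall_of_isAffineModel {K β : ℝ} (hβ : 0 < β) (hε : 0 < ε) (hε1 : ε ≤ 1) :
    ∃ η > 0, η ≤ 1 ∧ ∀ (A B₀ : Matrix ι ι ℂ) (m : Material) (k τ : ℝ) (ω q b : ℂ),
      (∀ i j, ‖A i j‖ ≤ K) → τ ≠ 0 →
      IsAffineModel m k ε (16 * (Fintype.card ι + 1)) ω q b →
      2 * β ≤ ‖spectralParameter m k τ ω‖ → (∀ i j, ‖B₀ i j - A i j‖ ≤ η) →
      (spectralParameter m k τ ω • (1 : Matrix ι ι ℂ) - B₀).det = 0 →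
      IsTransferBall m k τ ε η A ω := by
  obtain ⟨η, hη, hη1, hdet⟩ := exists_det_eq_zero_of_near (ι := ι) (K := K) hβ hε hε1
  refine ⟨η, hη, hη1, fun A B₀ m k τ ω q b hA hτ h hz hB₀ hB₀0 => ⟨fun w hw => ?_,
    fun w hw => h.norm_spectralParameter_sub_le (by linarith) hε.le τ hw, fun B hB hBA => ?_⟩⟩
  · obtain ⟨t, ht, rfl⟩ := h.exists_eq_add_mul hε.le hw
    exact h.notMem_materialPoles t ht
  · have hmaps : MapsTo (fun t => ω + q * t) (Metric.closedBall 0 ε) (leadingOrderBall m k ε ω) :=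
      fun t ht => h.add_mul_mem_leadingOrderBall ht
    set z₀ := spectralParameter m k τ ω
    have hslope : β ≤ ‖z₀ * b‖ := by
      rw [norm_mul]
      nlinarith [h.half_le, norm_nonneg z₀]
    have hslope' : ‖z₀ * b‖ ≤ 2 * ‖z₀‖ := by
      rw [norm_mul]
      nlinarith [h.le_two, norm_nonneg z₀]
    have haffine : ∀ t ∈ Metric.closedBall (0 : ℂ) ε,
        ‖spectralParameter m k τ (ω + q * t) - (z₀ + z₀ * b * t)‖ ≤
          ‖z₀ * b‖ * ε / (16 * (Fintype.card ι + 1)) := fun t ht => by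
      have hrhs : ‖z₀ * b‖ * ε / (16 * (Fintype.card ι + 1)) =
          ‖z₀‖ * (‖b‖ * ε / (16 * (Fintype.card ι + 1))) := by
        rw [norm_mul, mul_assoc, mul_div_assoc]
      rw [hrhs, mul_assoc, ← mul_one_add]
      exact h.norm_sub_le τ t ht
    obtain ⟨t, ht, hdet0⟩ := hdet A hA z₀ (z₀ * b) (fun t => spectralParameter m k τ (ω + q * t)) B₀
      (fun t => B (ω + q * t)) hslope hslope'
      ((continuousOn_spectralParameter hτ).comp (by fun_prop) h.ne_zero)
      (hB.comp (by fun_prop) hmaps) haffine (fun t ht => hBA _ (hmaps ht)) hB₀ hB₀0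
    exact ⟨_, hmaps ht, hdet0⟩

/-- Since `‖z‖` is bounded by the size of `B₀`, the frequency `ω` is close to the poles once the
scale `τ` is small. -/
lemma exists_isTransferBall (m : Material) (k : ℝ) {K β w₀ W r₀ : ℝ} (hβ : 0 < β) (hε : 0 < ε)
    (hεn : 160 * (Fintype.card ι + 1) * ε ≤ 1) (hw₀ : 0 < w₀) (hr₀ : 0 < r₀) :
    ∃ η > 0, ∃ q₀ > 0, ∀ (A B₀ : Matrix ι ι ℂ) (τ : ℝ) (ω : ℂ), (∀ i j, ‖A i j‖ ≤ K) → 0 < τ →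
      Fintype.card ι * (K + 1) * W ^ 2 * τ ≤ q₀ → w₀ ≤ ‖ω‖ → ‖ω‖ ≤ W → ω ∉ materialPoles m k →
      2 * β ≤ ‖spectralParameter m k τ ω‖ → (∀ i j, ‖B₀ i j - A i j‖ ≤ η) →
      (spectralParameter m k τ ω • (1 : Matrix ι ι ℂ) - B₀).det = 0 →
      Metric.infDist ω (materialPoles m k) ≤ r₀ ∧ IsTransferBall m k τ ε η A ω := by
  have : (0 : ℝ) ≤ Fintype.card ι := Nat.cast_nonneg _
  obtain ⟨η, hη, hη1, htransfer⟩ :=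
    exists_isTransferBall_of_isAffineModel (ι := ι) (K := K) hβ hε (by nlinarith)
  obtain ⟨q₀, hq₀, hmodel⟩ := exists_isAffineModel m k (M := 16 * (Fintype.card ι + 1)) hε
    (by linarith) (by linarith) hw₀ hr₀
  refine ⟨η, hη, q₀, hq₀, fun A B₀ τ ω hA hτ hτq hω hωW hP hz hB₀ hB₀0 => ?_⟩
  have hz' : ‖spectralParameter m k τ ω‖ ≤ Fintype.card ι * (K + 1) :=
    norm_le_of_det_eq_zero (norm_apply_le_add_one hA hη1 hB₀) hB₀0
  have hdisp : ‖dispersion m k ω‖ ≤ q₀ := by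
    rw [norm_dispersion_eq hτ (norm_pos_iff.1 (hw₀.trans_le hω))]
    have := (norm_nonneg _).trans hz'
    calc ‖spectralParameter m k τ ω‖ * (τ * ‖ω‖ ^ 2)
        ≤ Fintype.card ι * (K + 1) * (τ * W ^ 2) := by gcongr
      _ = Fintype.card ι * (K + 1) * W ^ 2 * τ := by ring
      _ ≤ q₀ := hτq
  obtain ⟨q, b, hq, hqb⟩ := hmodel ω hω hP hdisp
  exact ⟨hqb.norm_eq_infDist.symm.trans_le hq,
    htransfer A B₀ m k τ ω q b hA hτ.ne' hqb hz hB₀ hB₀0⟩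

end Transfer

/-! ### Uniform perturbation bounds -/

section Perturbation

variable {N : ℕ} {c d R : ℝ} {D : Fin N → Set Plane} {m : Material} {k δ : ℝ} {p : KernelTail}
  {Op : ℂ → Set Plane → (Plane → ℂ) → Plane → ℂ} {K : Set ℂ} {ω : ℂ} {β ε η η₁ C : ℝ}

/-- Numerical bounds under which both the matrices of the resonance problem, with remainders at most
`η₁`, are `η`-close to the leading-order matrix of `N` particles of relative area at least `c`, and
the spectral parameters of size at least `β` in the regime of constant `C` persist under relative
perturbations of size `4 * ε`. -/
structure IsTolerance (N : ℕ) (c C β ε η η₁ : ℝ) : Prop where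
  beta_pos : 0 < β
  eta_one_pos : 0 < η₁
  two_mul_beta_le : 2 * β ≤ c / C
  two_mul_beta_add_le : 2 * β + N * η ≤ c
  eta_lt : η < c
  four_mul_eps_le : 4 * ε ≤ 1 / 2
  four_mul_eps_le_inv : 4 * ε ≤ 1 / (4 * C)
  remainder_le : η₁ / (2 * c) ≤ 1 / 16
  principal_le : (15 * 72 / (2 * c) + 4) * η₁ ≤ η
  card_mul_le : N * η₁ ≤ β / 2
  reduced_le : 2 * N ^ 2 * 72 / β * η₁ ≤ η
  separation_le : 4 * η₁ ≤ β / (4 * C)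

/-- A configuration of small particles for which the operators with tail `p` are, in units of
`operatorScale D` and up to errors `η₁`, equal to `leadingMatrix (relSize D)` on the constants. -/
structure IsNearLeadingOrder (p : KernelTail) (m : Material) (c d R η₁ : ℝ) (K : Set ℂ) (δ : ℝ)
    (D : Fin N → Set Plane) [∀ i, IsFiniteMeasure (volume.restrict (D i))] : Prop where
  isDilute : IsDilute c d R D
  area_pos : 0 < c
  delta_pos : 0 < δ
  sizeParam_pos : 0 < sizeParam D
  sizeParam_lt_one : sizeParam D < 1
  subset_slitPlane : K ⊆ Complex.slitPlane
  norm_remainderOperator_le : ∀ ω ∈ K, ∀ i j,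
    ‖remainderOperator D p (scaledWavenumber m δ ω) i j‖ ≤ η₁

lemma IsDilute.norm_leadingMatrix_le (hD : IsDilute c d R D) (hρ : 0 < sizeParam D) (i j : Fin N) :
    ‖leadingMatrix (relSize D) i j‖ ≤ 72 :=
  (HalideResonators.norm_leadingMatrix_le (fun i => (Real.sqrt_nonneg c).trans (hD.le_relSize hρ i))
    (hD.relSize_le hρ) i j).trans (by norm_num)

lemma IsDilute.le_norm_leadingMatrix (hD : IsDilute c d R D) (hc : 0 ≤ c) (hρ : 0 < sizeParam D)
    (i j : Fin N) : c ≤ ‖leadingMatrix (relSize D) i j‖ := by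
  have hi := hD.le_relSize hρ i
  have hj := hD.le_relSize hρ j
  have h0 := Real.sqrt_nonneg c
  have hprod : c ≤ relSize D i * relSize D j := by
    rw [← Real.mul_self_sqrt hc]
    exact mul_le_mul hi hj h0 (h0.trans hi)
  rw [leadingMatrix, Matrix.of_apply, Complex.norm_real, Real.norm_eq_abs]
  refine le_trans ?_ (le_abs_self _)
  split_ifs <;> linarith

variable [∀ i, IsFiniteMeasure (volume.restrict (D i))]

variable (p D m k δ ω) in
/-- The matrix to which the Feshbach reduction to the constant functions brings the resonance
problem with tail `p`. -/
def reducedMatrix : Matrix (Fin N) (Fin N) ℂ :=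
  feshbachMatrix (constVectors D) (leadingMatrix (relSize D))
    (remainderOperator D p (scaledWavenumber m δ ω))
    (spectralParameter m k (spectralScale m δ D) ω)

namespace IsNearLeadingOrder

lemma operatorScale_pos (h : IsNearLeadingOrder p m c d R η₁ K δ D) : 0 < operatorScale D :=
  HalideResonators.operatorScale_pos h.sizeParam_pos h.sizeParam_lt_one

lemma spectralScale_pos (h : IsNearLeadingOrder p m c d R η₁ K δ D) : 0 < spectralScale m δ D :=
  HalideResonators.spectralScale_pos h.delta_pos h.operatorScale_pos

lemma norm_constVectors (h : IsNearLeadingOrder p m c d R η₁ K δ D) (i : Fin N) :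
    ‖constVectors D i‖ = 1 :=
  norm_constVector (h.isDilute.area_pos h.area_pos h.sizeParam_pos i)

lemma scaledWavenumber_mem_slitPlane (h : IsNearLeadingOrder p m c d R η₁ K δ D) (hω : ω ∈ K) :
    scaledWavenumber m δ ω ∈ Complex.slitPlane :=
  HalideResonators.scaledWavenumber_mem_slitPlane m h.delta_pos (h.subset_slitPlane hω)

lemma ne_zero (h : IsNearLeadingOrder p m c d R η₁ K δ D) (hω : ω ∈ K) : ω ≠ 0 :=
  Complex.slitPlane_ne_zero (h.subset_slitPlane hω)

lemma spectralParameter_mul_strength (h : IsNearLeadingOrder p m c d R η₁ K δ D) (hω : ω ∈ K)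
    (hP : ω ∉ materialPoles m k) :
    spectralParameter m k (spectralScale m δ D) ω * (strength m k δ ω * operatorScale D) = 1 :=
  HalideResonators.spectralParameter_mul_strength h.delta_pos h.operatorScale_pos (h.ne_zero hω) hP

lemma continuousOn_remainderOperator (h : IsNearLeadingOrder p m c d R η₁ K δ D) (i j : Fin N) :
    ContinuousOn (fun ω => remainderOperator D p (scaledWavenumber m δ ω) i j) K :=
  (h.isDilute.continuousOn_remainderOperator p i j).comp
    (continuous_scaledWavenumber m δ).continuousOn fun _ => h.scaledWavenumber_mem_slitPlane

section Reduced

lemma norm_inv_smul_blockOperator_le (h : IsNearLeadingOrder p m c d R η₁ K δ D)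
    (hT : IsTolerance N c C β ε η η₁) (hω : ω ∈ K)
    (hz : β ≤ ‖spectralParameter m k (spectralScale m δ D) ω‖) :
    ‖(spectralParameter m k (spectralScale m δ D) ω)⁻¹ •
      blockOperator (remainderOperator D p (scaledWavenumber m δ ω))‖ ≤ 1 / 2 := by
  refine (HalideResonators.norm_inv_smul_blockOperator_le hT.eta_one_pos.le
    (h.norm_remainderOperator_le ω hω) hT.beta_pos hz).trans ?_
  rw [Fintype.card_fin, div_le_iff₀ hT.beta_pos]
  linarith [hT.card_mul_le]

lemma isSystemResonance_iff_det (h : IsNearLeadingOrder p m c d R η₁ K δ D)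
    (hT : IsTolerance N c C β ε η η₁) (hOp : Realizes p Op) (hω : ω ∈ K)
    (hP : ω ∉ materialPoles m k) (hz : β ≤ ‖spectralParameter m k (spectralScale m δ D) ω‖) :
    IsSystemResonance Op Op m k δ D ω ↔
      (spectralParameter m k (spectralScale m δ D) ω • (1 : Matrix (Fin N) (Fin N) ℂ) -
        reducedMatrix D m k δ p ω).det = 0 := by
  rw [isSystemResonance_iff hOp h.isDilute (h.scaledWavenumber_mem_slitPlane hω)
    (h.spectralParameter_mul_strength hω hP), and_iff_right (h.subset_slitPlane hω),
    and_iff_right hP]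
  exact exists_blockMap_eigenvector_iff (norm_pos_iff.1 (hT.beta_pos.trans_le hz))
    (h.norm_inv_smul_blockOperator_le hT hω hz)

lemma norm_reducedMatrix_sub_le (h : IsNearLeadingOrder p m c d R η₁ K δ D)
    (hT : IsTolerance N c C β ε η η₁) (hω : ω ∈ K)
    (hz : β ≤ ‖spectralParameter m k (spectralScale m δ D) ω‖) (i j : Fin N) :
    ‖reducedMatrix D m k δ p ω i j - leadingMatrix (relSize D) i j‖ ≤ η :=
  (norm_feshbachMatrix_sub_le h.norm_constVectors (h.isDilute.norm_leadingMatrix_le h.sizeParam_pos)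
    (h.norm_remainderOperator_le ω hω) hT.beta_pos hz
    (by rw [Fintype.card_fin]; exact hT.card_mul_le) i j).trans
    (by rw [Fintype.card_fin]; exact hT.reduced_le)

lemma continuousOn_reducedMatrix (h : IsNearLeadingOrder p m c d R η₁ K δ D)
    (hT : IsTolerance N c C β ε η η₁) {U : Set ℂ} (hU : U ⊆ K)
    (hz : ∀ w ∈ U, β ≤ ‖spectralParameter m k (spectralScale m δ D) w‖) :
    ContinuousOn (fun ω => reducedMatrix D m k δ p ω) U :=
  continuousOn_feshbachMatrix
    ((continuousOn_spectralParameter h.spectralScale_pos.ne').mono fun _ hw => h.ne_zero (hU hw))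
    (fun w hw => norm_pos_iff.1 (hT.beta_pos.trans_le (hz w hw)))
    (fun i j => (h.continuousOn_remainderOperator i j).mono hU)
    fun w hw => h.norm_inv_smul_blockOperator_le hT (hU hw) (hz w hw)

end Reduced

section Principal

lemma norm_scaledRemainder_le (h : IsNearLeadingOrder p m c d R η₁ K δ D)
    (hT : IsTolerance N c C β ε η η₁) (hω : ω ∈ K) (i : Fin N) :
    ‖scaledRemainder (leadingMatrix (relSize D))
      (remainderOperator D p (scaledWavenumber m δ ω)) i‖ ≤ 1 / 16 :=
  (HalideResonators.norm_scaledRemainder_le (mul_pos two_pos h.area_pos)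
    (h.isDilute.two_mul_le_norm_leadingMatrix_self h.sizeParam_pos)
    (h.norm_remainderOperator_le ω hω) i).trans hT.remainder_le

lemma norm_principalMatrix_sub_le (h : IsNearLeadingOrder expandedTail m c d R η₁ K δ D)
    (hT : IsTolerance N c C β ε η η₁) (hω : ω ∈ K) (i j : Fin N) :
    ‖principalMatrix D (scaledWavenumber m δ ω) i j - leadingMatrix (relSize D) i j‖ ≤ η :=
  (norm_interactionMatrix_sub_le h.norm_constVectors (h.norm_scaledRemainder_le hT hω)
    (mul_pos two_pos h.area_pos) (h.isDilute.two_mul_le_norm_leadingMatrix_self h.sizeParam_pos)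
    (h.isDilute.norm_leadingMatrix_le h.sizeParam_pos)
    (h.norm_remainderOperator_le ω hω) i j).trans hT.principal_le

lemma principalMatrix_ne_zero (h : IsNearLeadingOrder expandedTail m c d R η₁ K δ D)
    (hT : IsTolerance N c C β ε η η₁) (hω : ω ∈ K) (i j : Fin N) :
    principalMatrix D (scaledWavenumber m δ ω) i j ≠ 0 := fun h0 => by
  have hnear := h.norm_principalMatrix_sub_le hT hω i j
  rw [h0, zero_sub, norm_neg] at hnear
  linarith [h.isDilute.le_norm_leadingMatrix h.area_pos.le h.sizeParam_pos i j, hT.eta_lt]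

lemma continuousOn_principalMatrix (h : IsNearLeadingOrder expandedTail m c d R η₁ K δ D)
    (hT : IsTolerance N c C β ε η η₁) :
    ContinuousOn (fun ω => principalMatrix D (scaledWavenumber m δ ω)) K :=
  continuousOn_interactionMatrix h.norm_constVectors (fun _ => h.norm_scaledRemainder_le hT)
    h.continuousOn_remainderOperator

lemma norm_principalValue_sub_le (h : IsNearLeadingOrder expandedTail m c d R η₁ K δ D)
    (hT : IsTolerance N c C β ε η η₁) (hω : ω ∈ K) (i : Fin N) :
    ‖principalValue D (scaledWavenumber m δ ω) i - leadingMatrix (relSize D) i i‖ ≤ 2 * η₁ :=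
  norm_blockValue_sub_le h.norm_constVectors (h.norm_scaledRemainder_le hT hω)
    (norm_pos_iff.1 (h.area_pos.trans_le
      (h.isDilute.le_norm_leadingMatrix h.area_pos.le h.sizeParam_pos i i)))
    (h.norm_remainderOperator_le ω hω)

lemma le_norm_principalValue (h : IsNearLeadingOrder expandedTail m c d R η₁ K δ D)
    (hT : IsTolerance N c C β ε η η₁) (hω : ω ∈ K) (i : Fin N) :
    c ≤ ‖principalValue D (scaledWavenumber m δ ω) i‖ := by
  have hblock := le_norm_blockValue h.norm_constVectors (h.norm_scaledRemainder_le hT hω) i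
  rw [principalValue]
  linarith [h.isDilute.two_mul_le_norm_leadingMatrix_self h.sizeParam_pos i]

lemma isDetZero_iff (h : IsNearLeadingOrder expandedTail m c d R η₁ K δ D)
    (hT : IsTolerance N c C β ε η η₁) (hN : 2 ≤ N) (hω : ω ∈ K) (hP : ω ∉ materialPoles m k) :
    IsDetZero m k δ D ω ↔
      (∀ i, spectralParameter m k (spectralScale m δ D) ω ≠
        principalValue D (scaledWavenumber m δ ω) i) ∧
      (spectralParameter m k (spectralScale m δ D) ω • (1 : Matrix (Fin N) (Fin N) ℂ) -
        principalMatrix D (scaledWavenumber m δ ω)).det = 0 := by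
  rw [HalideResonators.isDetZero_iff hN h.isDilute h.area_pos h.sizeParam_pos
    (h.scaledWavenumber_mem_slitPlane hω) (h.norm_scaledRemainder_le hT hω)
    (fun i j _ => h.principalMatrix_ne_zero hT hω i j) (h.spectralParameter_mul_strength hω hP),
    and_iff_right (h.subset_slitPlane hω), and_iff_right hP]

lemma existsUnique_isPrincipalEigenpair (h : IsNearLeadingOrder expandedTail m c d R η₁ K δ D)
    (hT : IsTolerance N c C β ε η η₁) (hω : ω ∈ K) (i : Fin N) :
    (∃ ν φ, IsPrincipalEigenpair (scaledWavenumber m δ ω) (D i) ν φ) ∧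
    ∀ ν φ ν' φ', IsPrincipalEigenpair (scaledWavenumber m δ ω) (D i) ν φ →
      IsPrincipalEigenpair (scaledWavenumber m δ ω) (D i) ν' φ' →
      ν' = ν ∧ ∃ a : ℂ, ‖a‖ = 1 ∧ ∀ᵐ x ∂(volume.restrict (D i)), φ' x = a * φ x := by
  have hκ := h.scaledWavenumber_mem_slitPlane hω
  have hrem := h.norm_scaledRemainder_le hT hω
  have hs := h.operatorScale_pos.ne'
  exact ⟨⟨_, _, isPrincipalEigenpair_principalVector hκ h.isDilute h.area_pos h.sizeParam_pos hs
    hrem i⟩, fun ν φ ν' φ' hν hν' =>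
      hν.unique hκ h.isDilute h.area_pos h.sizeParam_pos hs hrem hν'⟩

end Principal

end IsNearLeadingOrder

end Perturbation

/-! ### Correspondence of the zeros -/

section Correspondence

lemma ne_of_norm_sub_le {z z' v v' l : ℂ} {β C ε η : ℝ} (hC : 0 < C) (hβ : 0 < β)
    (hz : β ≤ ‖z‖) (hsep : ‖z‖ / C ≤ ‖z - v‖) (hz' : ‖z' - z‖ ≤ 4 * ε * ‖z‖)
    (hε : 4 * ε ≤ 1 / (4 * C)) (hv : ‖v - l‖ ≤ 2 * η) (hv' : ‖v' - l‖ ≤ 2 * η)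
    (hη : 4 * η ≤ β / (4 * C)) : z' ≠ v' := by
  rintro rfl
  have hz0 : 0 < ‖z‖ / (4 * C) := div_pos (hβ.trans_le hz) (by positivity)
  have hmove : ‖z - v‖ ≤ 4 * ε * ‖z‖ + 2 * η + 2 * η := by
    rw [show z - v = -(z' - z) + (z' - l) - (v - l) by ring]
    refine (norm_sub_le _ _).trans (add_le_add ((norm_add_le _ _).trans ?_) hv)
    rw [norm_neg]
    exact add_le_add hz' hv'
  have hfirst : 4 * ε * ‖z‖ ≤ ‖z‖ / (4 * C) :=
    (mul_le_mul_of_nonneg_right hε (norm_nonneg z)).trans_eq (by ring)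
  have hsecond : β / (4 * C) ≤ ‖z‖ / (4 * C) := by gcongr
  have hsplit : ‖z‖ / C = 4 * (‖z‖ / (4 * C)) := by field_simp
  linarith

namespace IsTransferBall

variable {ι : Type*} [Fintype ι] [DecidableEq ι] {m : Material} {k τ ε η η' β : ℝ}
  {A : Matrix ι ι ℂ} {ω w : ℂ}

lemma of_le (h : IsTransferBall m k τ ε η A ω) (hη : η' ≤ η) : IsTransferBall m k τ ε η' A ω where
  notMem_materialPoles := h.notMem_materialPoles
  norm_spectralParameter_sub_le := h.norm_spectralParameter_sub_le
  exists_det_eq_zero B hB hBA :=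
    h.exists_det_eq_zero B hB fun w hw i j => (hBA w hw i j).trans hη

lemma le_norm_spectralParameter (h : IsTransferBall m k τ ε η A ω) (hε : 4 * ε ≤ 1 / 2)
    (hz : 2 * β ≤ ‖spectralParameter m k τ ω‖) (hw : w ∈ leadingOrderBall m k ε ω) :
    β ≤ ‖spectralParameter m k τ w‖ := by
  have hsub := h.norm_spectralParameter_sub_le w hw
  have htri := norm_sub_norm_le (spectralParameter m k τ ω) (spectralParameter m k τ w)
  rw [norm_sub_rev] at htri
  have := mul_le_mul_of_nonneg_right hε (norm_nonneg (spectralParameter m k τ ω))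
  linarith

end IsTransferBall

/-- Wherever a matrix `η`-close to the leading-order matrix of `D` has the spectral parameter at
`ω ∈ Z` as an eigenvalue, the ball of leading-order agreement about `ω` lies in `K` and contains a
zero of the characteristic determinant of every continuous family of `η`-close matrices. -/
def TransfersZeros {N : ℕ} (m : Material) (k β ε η : ℝ) (Z K : Set ℂ) (δ : ℝ)
    (D : Fin N → Set Plane) : Prop :=
  ∀ ω ∈ Z, ω ∉ materialPoles m k → 2 * β ≤ ‖spectralParameter m k (spectralScale m δ D) ω‖ →
    ∀ B₀ : Matrix (Fin N) (Fin N) ℂ, (∀ i j, ‖B₀ i j - leadingMatrix (relSize D) i j‖ ≤ η) →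
      (spectralParameter m k (spectralScale m δ D) ω • (1 : Matrix (Fin N) (Fin N) ℂ) -
        B₀).det = 0 →
      leadingOrderBall m k ε ω ⊆ K ∧
        IsTransferBall m k (spectralScale m δ D) ε η (leadingMatrix (relSize D)) ω

namespace IsNearLeadingOrder

variable {N : ℕ} {c d R : ℝ} {D : Fin N → Set Plane} {m : Material} {k δ : ℝ} {p : KernelTail}
  {Op : ℂ → Set Plane → (Plane → ℂ) → Plane → ℂ} {Z K : Set ℂ} {ω : ℂ} {β ε η η₁ C : ℝ}
  [∀ i, IsFiniteMeasure (volume.restrict (D i))]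

section Regime

lemma exists_isPrincipalEigenpair_mul_eq (h : IsNearLeadingOrder expandedTail m c d R η₁ K δ D)
    (hT : IsTolerance N c C β ε η η₁) (hω : ω ∈ K) (hP : ω ∉ materialPoles m k) (i : Fin N) :
    ∃ ν φ, IsPrincipalEigenpair (scaledWavenumber m δ ω) (D i) ν φ ∧
      spectralParameter m k (spectralScale m δ D) ω * (strength m k δ ω * ν) =
        principalValue D (scaledWavenumber m δ ω) i :=
  ⟨_, _, isPrincipalEigenpair_principalVector (h.scaledWavenumber_mem_slitPlane hω) h.isDilute
    h.area_pos h.sizeParam_pos h.operatorScale_pos.ne' (h.norm_scaledRemainder_le hT hω) i, by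
    rw [← mul_assoc (strength m k δ ω), ← mul_assoc, h.spectralParameter_mul_strength hω hP,
      one_mul]⟩

lemma div_le_norm_spectralParameter (h : IsNearLeadingOrder expandedTail m c d R η₁ K δ D)
    (hT : IsTolerance N c C β ε η η₁) (hω : ω ∈ K) (hP : ω ∉ materialPoles m k) (hC : 0 < C)
    (hreg : InPrincipalRegime C m k δ D ω) (i : Fin N) :
    c / C ≤ ‖spectralParameter m k (spectralScale m δ D) ω‖ := by
  obtain ⟨ν, φ, hνφ, hν⟩ := h.exists_isPrincipalEigenpair_mul_eq hT hω hP i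
  rw [div_le_iff₀ hC]
  calc c ≤ ‖principalValue D (scaledWavenumber m δ ω) i‖ := h.le_norm_principalValue hT hω i
    _ = ‖spectralParameter m k (spectralScale m δ D) ω‖ * ‖strength m k δ ω * ν‖ := by
      rw [← hν, norm_mul]
    _ ≤ ‖spectralParameter m k (spectralScale m δ D) ω‖ * C := by
      gcongr
      exact (hreg i ν φ hνφ).1

lemma div_le_norm_spectralParameter_sub (h : IsNearLeadingOrder expandedTail m c d R η₁ K δ D)
    (hT : IsTolerance N c C β ε η η₁) (hω : ω ∈ K) (hP : ω ∉ materialPoles m k)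
    (hreg : InPrincipalRegime C m k δ D ω) (i : Fin N) :
    ‖spectralParameter m k (spectralScale m δ D) ω‖ / C ≤
      ‖spectralParameter m k (spectralScale m δ D) ω -
        principalValue D (scaledWavenumber m δ ω) i‖ := by
  obtain ⟨ν, φ, hνφ, hν⟩ := h.exists_isPrincipalEigenpair_mul_eq hT hω hP i
  rw [← hν, ← mul_one_sub, norm_mul, div_eq_mul_inv]
  exact mul_le_mul_of_nonneg_left (hreg i ν φ hνφ).2 (norm_nonneg _)

end Regime

lemma exists_isSystemResonance (h : IsNearLeadingOrder p m c d R η₁ K δ D)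
    (hT : IsTolerance N c C β ε η η₁) (hOp : Realizes p Op)
    (hball : IsTransferBall m k (spectralScale m δ D) ε η (leadingMatrix (relSize D)) ω)
    (hK : leadingOrderBall m k ε ω ⊆ K)
    (hz : 2 * β ≤ ‖spectralParameter m k (spectralScale m δ D) ω‖) :
    ∃ w ∈ leadingOrderBall m k ε ω, IsSystemResonance Op Op m k δ D w := by
  have hzw := fun w => hball.le_norm_spectralParameter (w := w) hT.four_mul_eps_le hz
  obtain ⟨w, hw, hdet⟩ := hball.exists_det_eq_zero (fun w => reducedMatrix D m k δ p w)
    (h.continuousOn_reducedMatrix hT hK hzw)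
    fun w hw => h.norm_reducedMatrix_sub_le hT (hK hw) (hzw w hw)
  exact ⟨w, hw, (h.isSystemResonance_iff_det hT hOp (hK hw) (hball.notMem_materialPoles w hw)
    (hzw w hw)).2 hdet⟩

lemma exists_isDetZero (h : IsNearLeadingOrder expandedTail m c d R η₁ K δ D)
    (hT : IsTolerance N c C β ε η η₁) (hN : 2 ≤ N) (hC : 0 < C) (hω : ω ∈ K)
    (hball : IsTransferBall m k (spectralScale m δ D) ε η (leadingMatrix (relSize D)) ω)
    (hK : leadingOrderBall m k ε ω ⊆ K)
    (hz : 2 * β ≤ ‖spectralParameter m k (spectralScale m δ D) ω‖)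
    (hsep : ∀ i, ‖spectralParameter m k (spectralScale m δ D) ω‖ / C ≤
      ‖spectralParameter m k (spectralScale m δ D) ω -
        principalValue D (scaledWavenumber m δ ω) i‖) :
    ∃ w ∈ leadingOrderBall m k ε ω, IsDetZero m k δ D w := by
  obtain ⟨w, hw, hdet⟩ := hball.exists_det_eq_zero
    (fun w => principalMatrix D (scaledWavenumber m δ w))
    ((h.continuousOn_principalMatrix hT).mono hK)
    fun w hw => h.norm_principalMatrix_sub_le hT (hK hw)
  refine ⟨w, hw, (h.isDetZero_iff hT hN (hK hw) (hball.notMem_materialPoles w hw)).2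
    ⟨fun i => ?_, hdet⟩⟩
  exact ne_of_norm_sub_le hC hT.beta_pos (by linarith [hT.beta_pos]) (hsep i)
    (hball.norm_spectralParameter_sub_le w hw) hT.four_mul_eps_le_inv
    (h.norm_principalValue_sub_le hT hω i) (h.norm_principalValue_sub_le hT (hK hw) i)
    hT.separation_le

theorem exists_isDetZero_of_isSystemResonance (hp : IsNearLeadingOrder p m c d R η₁ K δ D)
    (hE : IsNearLeadingOrder expandedTail m c d R η₁ K δ D) (hT : IsTolerance N c C β ε η η₁)
    (hOp : Realizes p Op) (hN : 2 ≤ N) (hC : 0 < C) (htr : TransfersZeros m k β ε η Z K δ D)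
    (hωZ : ω ∈ Z) (hωK : ω ∈ K) (hres : IsSystemResonance Op Op m k δ D ω)
    (hreg : InPrincipalRegime C m k δ D ω) :
    ∃ w ∈ leadingOrderBall m k ε ω, IsDetZero m k δ D w := by
  have hP := hres.2.1
  have hz := hT.two_mul_beta_le.trans
    (hE.div_le_norm_spectralParameter hT hωK hP hC hreg ⟨0, by lia⟩)
  have hz' : β ≤ ‖spectralParameter m k (spectralScale m δ D) ω‖ := by linarith [hT.beta_pos]
  obtain ⟨hK, hball⟩ := htr ω hωZ hP hz _ (hp.norm_reducedMatrix_sub_le hT hωK hz')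
    ((hp.isSystemResonance_iff_det hT hOp hωK hP hz').1 hres)
  exact hE.exists_isDetZero hT hN hC hωK hball hK hz
    (hE.div_le_norm_spectralParameter_sub hT hωK hP hreg)

theorem exists_isSystemResonance_of_isDetZero (hp : IsNearLeadingOrder p m c d R η₁ K δ D)
    (hE : IsNearLeadingOrder expandedTail m c d R η₁ K δ D) (hT : IsTolerance N c C β ε η η₁)
    (hOp : Realizes p Op) (hN : 2 ≤ N) (htr : TransfersZeros m k β ε η Z K δ D)
    (hωZ : ω ∈ Z) (hωK : ω ∈ K) (hzero : IsDetZero m k δ D ω) :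
    ∃ w ∈ leadingOrderBall m k ε ω, IsSystemResonance Op Op m k δ D w := by
  have hdet := ((hE.isDetZero_iff hT hN hωK hzero.2.1).1 hzero).2
  have hnear := hE.norm_principalMatrix_sub_le hT hωK
  have hz : 2 * β ≤ ‖spectralParameter m k (spectralScale m δ D) ω‖ := by
    have hlow := le_norm_of_det_eq_zero (posSemidef_leadingMatrix_sub (Real.sqrt_nonneg c)
      (hE.isDilute.le_relSize hE.sizeParam_pos)) hnear hdet
    rw [Real.sq_sqrt hE.area_pos.le, Fintype.card_fin] at hlow
    linarith [hT.two_mul_beta_add_le]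
  obtain ⟨hK, hball⟩ := htr ω hωZ hzero.2.1 hz _ hnear hdet
  exact hp.exists_isSystemResonance hT hOp hball hK hz

end IsNearLeadingOrder

end Correspondence

/-! ### Small particles -/

section SmallParticles

variable {N : ℕ} {c d R κ₀ ε C r : ℝ} {D : Fin N → Set Plane} {m : Material} {k δ : ℝ} {Z K : Set ℂ}

lemma operatorScale_le (hρ : 0 < sizeParam D) : operatorScale D ≤ sizeParam D := by
  have hlog : -Real.log (sizeParam D) ≤ (sizeParam D)⁻¹ := by
    rw [← Real.log_inv]
    exact (Real.log_le_sub_one_of_pos (inv_pos.2 hρ)).trans (sub_le_self _ zero_le_one)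
  rw [operatorScale, div_le_iff₀ (by positivity)]
  calc -Real.log (sizeParam D) * sizeParam D ^ 2 ≤ (sizeParam D)⁻¹ * sizeParam D ^ 2 := by gcongr
    _ = sizeParam D * 1 := by field_simp
    _ ≤ sizeParam D * (2 * Real.pi) := by
      gcongr
      linarith [Real.pi_gt_three]

lemma spectralScale_le (hδ : 0 < δ) (hρ : 0 < sizeParam D) (hρ1 : sizeParam D < 1)
    (hδρ : δ ≤ κ₀ * sizeParam D) :
    spectralScale m δ D ≤ κ₀ ^ 2 * (m.mu0 * m.alpha) * sizeParam D := by
  have hκ₀ : 0 < κ₀ := pos_of_mul_pos_left (hδ.trans_le hδρ) hρ.le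
  have := m.mu0_pos
  have := m.alpha_pos
  have := operatorScale_pos hρ hρ1
  rw [spectralScale]
  gcongr
  · exact hδρ.trans (mul_le_of_le_one_right hκ₀.le hρ1.le)
  · exact operatorScale_le hρ

lemma exists_pos_of_eventually {P : ℝ → Prop} (h : ∀ᶠ x in 𝓝[>] (0 : ℝ), P x) :
    ∃ x > 0, P x := by
  obtain ⟨x, hP, hx⟩ := (h.and self_mem_nhdsWithin).exists
  exact ⟨x, hx, hP⟩

lemma exists_isTolerance (N : ℕ) (hc : 0 < c) (hC : 0 < C) (hε : 0 < ε) :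
    ∃ β > 0, ∃ e > 0, e ≤ ε ∧ 160 * ((N : ℝ) + 1) * e ≤ 1 ∧
      ∀ η₀ > 0, ∃ η ≤ η₀, ∃ η₁, IsTolerance N c C β e η η₁ := by
  obtain ⟨β, hβ, hβC, hβc⟩ := exists_pos_of_eventually
    ((eventually_mul_le 2 (div_pos hc hC)).and (eventually_mul_le 2 (half_pos hc)))
  obtain ⟨e, he, heε, heN, hehalf, heC⟩ := exists_pos_of_eventually <|
    (eventually_mul_le 1 hε).and <| (eventually_mul_le (160 * ((N : ℝ) + 1)) one_pos).and <|
    (eventually_mul_le 4 one_half_pos).and (eventually_mul_le 4 (y := 1 / (4 * C)) (by positivity))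
  refine ⟨β, hβ, e, he, by linarith, heN, fun η₀ hη₀ => ?_⟩
  obtain ⟨η, hη, hηη₀, hηN, hηc⟩ := exists_pos_of_eventually <|
    (eventually_mul_le 1 hη₀).and <| (eventually_mul_le (N : ℝ) (half_pos hc)).and
    (eventually_mul_le 2 hc)
  obtain ⟨η₁, hη₁, hrem, hprin, hcard, hred, hsep⟩ := exists_pos_of_eventually <|
    (eventually_mul_le (1 / (2 * c)) (y := 1 / 16) (by positivity)).and <|
    (eventually_mul_le (15 * 72 / (2 * c) + 4) hη).and <|
    (eventually_mul_le (N : ℝ) (half_pos hβ)).and <|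
    (eventually_mul_le (2 * N ^ 2 * 72 / β) hη).and
    (eventually_mul_le 4 (y := β / (4 * C)) (by positivity))
  exact ⟨η, by linarith, η₁, {
    beta_pos := hβ
    eta_one_pos := hη₁
    two_mul_beta_le := hβC
    two_mul_beta_add_le := by linarith
    eta_lt := by linarith
    four_mul_eps_le := hehalf
    four_mul_eps_le_inv := heC
    remainder_le := by rwa [div_eq_mul_one_div, mul_comm]
    principal_le := hprin
    card_mul_le := hcard
    reduced_le := hred
    separation_le := hsep }⟩

lemma exists_norm_bounds (hZ : IsCompact Z) (hZ0 : 0 ∉ Z) :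
    ∃ w₀ > 0, ∃ W, ∀ ω ∈ Z, w₀ ≤ ‖ω‖ ∧ ‖ω‖ ≤ W := by
  obtain ⟨w₀, hw₀, hle⟩ := hZ.exists_forall_le' continuous_norm.continuousOn (a := 0)
    fun ω hω => norm_pos_iff.2 fun h => hZ0 (h ▸ hω)
  obtain ⟨W, hW⟩ := hZ.exists_bound_of_continuousOn (f := fun ω : ℂ => ω) continuousOn_id
  exact ⟨w₀, hw₀, W, fun ω hω => ⟨hle ω hω, hW ω hω⟩⟩

lemma eventually_isNearLeadingOrder (p : KernelTail) (m : Material) (d R : ℝ) {η₁ : ℝ} (hc : 0 < c)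
    (hd : 0 < d) (hκ₀ : 0 < κ₀) (hη₁ : 0 < η₁) (hK : IsCompact K) (hKs : K ⊆ Complex.slitPlane) :
    ∀ᶠ ρ in 𝓝[>] (0 : ℝ), ∀ (N : ℕ) (D : Fin N → Set Plane) (δ : ℝ)
      [∀ i, IsFiniteMeasure (volume.restrict (D i))], sizeParam D = ρ → IsDilute c d R D → 0 < δ →
      ρ ≤ κ₀ * δ → δ ≤ κ₀ * ρ → IsNearLeadingOrder p m c d R η₁ K δ D := by
  filter_upwards [self_mem_nhdsWithin, eventually_mul_le 2 one_pos,
    eventually_norm_remainderOperator_le m p hc hd hκ₀ hη₁ hK hKs] with ρ hρ hρ1 hrem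
  rintro N D δ _ rfl hD hδ hρδ hδρ
  have hpos : 0 < sizeParam D := hρ
  exact ⟨hD, hc, hδ, hpos, by linarith, hKs, hrem N D δ rfl hD hδ hρδ hδρ⟩

lemma exists_eventually_transfersZeros (N : ℕ) (m : Material) (k c d R κ₀ : ℝ) {β : ℝ} (hβ : 0 < β)
    (hε : 0 < ε) (hεN : 160 * ((N : ℝ) + 1) * ε ≤ 1) (hZ : IsCompact Z) (hZ0 : 0 ∉ Z)
    (hr : 0 < r) :
    ∃ η₀ > 0, ∀ η ≤ η₀, ∀ᶠ ρ in 𝓝[>] (0 : ℝ), ∀ (D : Fin N → Set Plane) (δ : ℝ),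
      sizeParam D = ρ → IsDilute c d R D → 0 < δ → δ ≤ κ₀ * ρ →
      TransfersZeros m k β ε η Z (Metric.cthickening r Z) δ D := by
  obtain ⟨w₀, hw₀, W, hW⟩ := exists_norm_bounds hZ hZ0
  obtain ⟨η₀, hη₀, q₀, hq₀, hball⟩ := exists_isTransferBall (ι := Fin N) m k (K := 72) (W := W) hβ
    hε (by rwa [Fintype.card_fin]) hw₀ (div_pos hr hε)
  refine ⟨η₀, hη₀, fun η hη => ?_⟩
  filter_upwards [self_mem_nhdsWithin, eventually_mul_le 2 one_pos,
    eventually_mul_le (N * (72 + 1) * W ^ 2 * (κ₀ ^ 2 * (m.mu0 * m.alpha))) hq₀] with ρ hρ hρ1 hρq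
  rintro D δ rfl hD hδ hδρ ω hω hP hz B₀ hB₀ hdet
  have hpos : 0 < sizeParam D := hρ
  have hlt : sizeParam D < 1 := by linarith
  have hscale : Fintype.card (Fin N) * (72 + 1) * W ^ 2 * spectralScale m δ D ≤ q₀ := by
    rw [Fintype.card_fin]
    refine le_trans ?_ hρq
    rw [mul_assoc _ (κ₀ ^ 2 * _)]
    exact mul_le_mul_of_nonneg_left (spectralScale_le hδ hpos hlt hδρ) (by positivity)
  obtain ⟨hdist, htransfer⟩ := hball (leadingMatrix (relSize D)) B₀ (spectralScale m δ D) ω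
    (hD.norm_leadingMatrix_le hpos) (spectralScale_pos hδ (operatorScale_pos hpos hlt)) hscale
    (hW ω hω).1 (hW ω hω).2 hP hz (fun i j => (hB₀ i j).trans hη) hdet
  have hradius : ε * Metric.infDist ω (materialPoles m k) ≤ r := by
    rwa [mul_comm, ← le_div_iff₀ hε]
  exact ⟨(Metric.closedBall_subset_closedBall hradius).trans
    (Metric.closedBall_subset_cthickening hω r), htransfer.of_le hη⟩

theorem exists_eventually_isNearLeadingOrder (N : ℕ) (m : Material) (k d R : ℝ) (hc : 0 < c)
    (hd : 0 < d) (hκ₀ : 0 < κ₀) (hC : 0 < C) (hε : 0 < ε) (hZ : IsCompact Z)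
    (hZs : Z ⊆ Complex.slitPlane) :
    ∃ (β e η η₁ : ℝ) (K : Set ℂ), e ≤ ε ∧ Z ⊆ K ∧ IsTolerance N c C β e η η₁ ∧
      ∀ᶠ ρ in 𝓝[>] (0 : ℝ), ∀ (D : Fin N → Set Plane) (δ : ℝ)
        [∀ i, IsFiniteMeasure (volume.restrict (D i))], sizeParam D = ρ → IsDilute c d R D → 0 < δ →
        ρ ≤ κ₀ * δ → δ ≤ κ₀ * ρ →
        IsNearLeadingOrder greenTail m c d R η₁ K δ D ∧
        IsNearLeadingOrder expandedTail m c d R η₁ K δ D ∧ TransfersZeros m k β e η Z K δ D := by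
  obtain ⟨r, hr, hKs⟩ := hZ.exists_cthickening_subset_open Complex.isOpen_slitPlane hZs
  obtain ⟨β, hβ, e, he, heε, heN, htol⟩ := exists_isTolerance N hc hC hε
  obtain ⟨η₀, hη₀, htransfers⟩ := exists_eventually_transfersZeros N m k c d R κ₀ hβ he heN hZ
    (fun h => Complex.slitPlane_ne_zero (hZs h) rfl) hr
  obtain ⟨η, hη, η₁, hT⟩ := htol η₀ hη₀
  refine ⟨β, e, η, η₁, Metric.cthickening r Z, heε, Metric.self_subset_cthickening Z, hT, ?_⟩
  have hnear := fun p =>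
    eventually_isNearLeadingOrder p m d R hc hd hκ₀ hT.eta_one_pos hZ.cthickening hKs
  filter_upwards [hnear greenTail, hnear expandedTail, htransfers η hη] with ρ hG hE htr
  exact fun D δ _ hDρ hD hδ hρδ hδρ => ⟨hG N D δ hDρ hD hδ hρδ hδρ, hE N D δ hDρ hD hδ hρδ hδρ,
    htr D δ hDρ hD hδ hδρ⟩

end SmallParticles

end HalideResonators

end

theorem theorem2p6 (N : ℕ) (hN : 2 ≤ N) (m : Material) (k : ℝ)
    (c d R κ C : ℝ) (hc : 0 < c) (hd : 0 < d) (hR : 0 < R) (hκ : 0 < κ) (hC : 0 < C)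
    (Z : Set ℂ) (hZ : IsCompact Z) (hZs : Z ⊆ Complex.slitPlane)
    (ε : ℝ) (hε : 0 < ε) :
    ∃ ρ₀ : ℝ, 0 < ρ₀ ∧ ∀ (D : Fin N → Set Plane) (δ : ℝ), IsDilute c d R D →
      0 < δ → sizeParam D < ρ₀ → sizeParam D ≤ κ * δ → δ ≤ κ * sizeParam D →
      -- the principal eigenpairs are well defined, up to a phase of the eigenvector
      (∀ ω ∈ Z, ∀ i,
        (∃ ν φ, IsPrincipalEigenpair (scaledWavenumber m δ ω) (D i) ν φ) ∧
        ∀ ν φ ν' φ', IsPrincipalEigenpair (scaledWavenumber m δ ω) (D i) ν φ →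
          IsPrincipalEigenpair (scaledWavenumber m δ ω) (D i) ν' φ' →
          ν' = ν ∧ ∃ a : ℂ, ‖a‖ = 1 ∧
            ∀ᵐ x ∂(MeasureTheory.volume.restrict (D i)), φ' x = a * φ x) ∧
      -- resonant frequencies are zeros of the determinant, at leading order
      (∀ ω ∈ Z, (IsResonance m k δ D ω ∨ IsExpandedResonance m k δ D ω) →
        InPrincipalRegime C m k δ D ω →
        ∃ ω', IsDetZero m k δ D ω' ∧ CloseAtLeadingOrder ε m k ω ω') ∧
      -- zeros of the determinant are resonant frequencies, at leading order
      (∀ ω ∈ Z, IsDetZero m k δ D ω →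
        (∃ ω', IsResonance m k δ D ω' ∧ CloseAtLeadingOrder ε m k ω ω') ∧
        (∃ ω', IsExpandedResonance m k δ D ω' ∧ CloseAtLeadingOrder ε m k ω ω')) := by
  obtain ⟨β, e, η, η₁, K, heε, hZK, hT, hev⟩ :=
    exists_eventually_isNearLeadingOrder N m k d R hc hd hκ hC hε hZ hZs
  obtain ⟨ρ₀, hρ₀, hsmall⟩ := (mem_nhdsGT_iff_exists_Ioo_subset (a := (0 : ℝ))).1 hev
  refine ⟨ρ₀, hρ₀, fun D δ hD hδ hρ hρδ hδρ => ?_⟩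
  have := hD.isFiniteMeasure
  have hpos : 0 < sizeParam D := pos_of_mul_pos_right (hδ.trans_le hδρ) hκ.le
  obtain ⟨hG, hE, htr⟩ := hsmall ⟨hpos, hρ⟩ D δ rfl hD hδ hρδ hδρ
  refine ⟨fun ω hω => hE.existsUnique_isPrincipalEigenpair hT (hZK hω), fun ω hω hres hreg => ?_,
    fun ω hω hzero => ⟨?_, ?_⟩⟩
  · exact exists_closeAtLeadingOrder heε <| hres.elim
      (hG.exists_isDetZero_of_isSystemResonance hE hT realizes_opK hN hC htr hω (hZK hω) · hreg)
      (hE.exists_isDetZero_of_isSystemResonance hE hT realizes_opM hN hC htr hω (hZK hω) · hreg)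
  · exact exists_closeAtLeadingOrder heε <|
      hG.exists_isSystemResonance_of_isDetZero hE hT realizes_opK hN htr hω (hZK hω) hzero
  · exact exists_closeAtLeadingOrder heε <|
      hE.exists_isSystemResonance_of_isDetZero hE hT realizes_opM hN htr hω (hZK hω) hzero
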